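/- **Notation.** Let $\mathcal{BC}_\infty=\bigcup_n\mathcal{BC}_n$ be the group of finitary signed permutations, generated by $s_0=(1\leftrightarrow-1)$ and $s_i=(i\leftrightarrow i+1)$, $i\ge1$; $\mathcal{BC}_n$ consists of those fixing every $i$ with $|i|>n$, and $\mathcal S_n\subset\mathcal{BC}_n$ of those without sign changes. Let $\ell$ be the length, $R(w)$ the set of reduced words of $w$, and $s(w)$ the number of positive integers that $w$ maps to negative ones. In $\mathbb Q[\mathbf z,p_1(\mathbf x),p_3(\mathbf x),\dots]$ (a polynomial ring, graded by $\deg z_i=1$, $\deg p_k=k$) let $s_i$ ($i\ge1$) exchange $z_i$ and $z_{i+1}$, let $s_0$ send $z_1\mapsto -z_1$, $p_k\mapsto p_k+z_1^k$ (all other generators are fixed), and put $\partial_0f=\frac{f-s_0f}{-2z_1}$, $\partial_if=\frac{f-s_if}{z_i-z_{i+1}}$ for $i\geq 1$. There is a unique family of homogeneous elements $\mathfrak C_w$, $w\in\mathcal{BC}_\infty$, with $\mathfrak C_{\mathrm{id}}=1$ and, for all $i\ge0$, $\partial_i\mathfrak C_w=\mathfrak C_{ws_i}$ if $\ell(ws_i)<\ell(w)$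 and $\partial_i\mathfrak C_w=0$ otherwise. Put $\mathfrak B_w=2^{-s(w)}\mathfrak C_w$, and let $\mathfrak B_w^{[k]}$ be obtained from it by setting $x_{k+1}=x_{k+2}=\dots=0$. For a word $\mathbf a=s_{a_1}\cdots s_{a_l}$, let $\mathscr A_x(\mathbf a)$ be the set of monomials $\mathbf x^\alpha=x_{j_1}\cdots x_{j_l}$ with $j_1\ge\dots\ge j_l\ge1$ such that $j_{i-1}=j_i=j_{i+1}$ never holds at a peak $a_{i-1}<a_i>a_{i+1}$. Let $\mathscr A_z(\mathbf a)$ be the set of monomials $\mathbf z^\beta=z_{j_1}\cdots z_{j_l}$ with $1\le j_1\le\dots\le j_l$, $j_i\le a_i$ for all $i$, and $a_i>a_{i+1}$ whenever $j_i=j_{i+1}$. Let $i(\alpha)$ be the number of variables occurring in $\mathbf x^\alpha$. The base of a *b-signed pipe dream* of size $n$ with $k$ $\Gamma$-blocks consists, from top to bottom, of $\Gamma$-blocks number $k,k-1,\dots,1$ and the staircase diagram with rows of length $n-1,\dots,2,1$. A $\Gamma$-block is a row of $n$ boxes and a column of $n$ boxes sharing their upper left corner ($2n-1$ boxes); the boxes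 of the row and of the column are labelled $0,1,\dots,n-1$, starting at the corner. The staircase box in row $r$ and column $c$ is labelled $r+c-1$. Each box labelled $0$ contains an elbow without or with a faucet; each other box contains a double elbow or a cross. Reading all boxes row by row from top to bottom, each row from right to left, and writing $s_0$ for each faucet and $s_i$ for each cross in a box labelled $i$, one gets $\mathrm{word}(D)=\mathrm{word}_x(D)\,\mathrm{word}_z(D)$, the two parts coming from the $\Gamma$-blocks and from the staircase. The monomial $\mathbf x^{\alpha(D)}\mathbf z^{\beta(D)}$ is the product, over all crosses and faucets, of $x_i$ for those in $\Gamma$-block $i$ and $z_r$ for those in row $r$ of the staircase. $D$ is *reduced* of *shape* $w$ if $\mathrm{word}(D)\in R(w)$; $\mathrm{PD}^k_{\mathcal B_n}(w)$ is the set of these $D$. **Theorem 3.4.** Let $w\in\mathcal{BC}_n$ and $k\ge0$. Then $$\sum_{D\in\mathrm{PD}^k_{\mathcal B_n}(w)}\mathbf x^{\alpha(D)}\mathbf z^{\beta(D)}=\sum_{\substack{uv=w\\ \ell(u)+\ell(v)=\ell(w)\\ v\in\mathcal S_n}}\ \sum_{\substack{\mathbf a\in R(u)\\ \mathbf x^\alpha\in\mathscr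 A_x(\mathbf a)\\ \alpha_{k+1}=\alpha_{k+2}=\dots=0}}\ \sum_{\substack{\mathbf b\in R(v)\\ \mathbf z^\beta\in\mathscr A_z(\mathbf b)}}2^{i(\alpha)-s(w)}\,\mathbf x^\alpha\mathbf z^\beta=\mathfrak B_w^{[k]}(\mathbf z,\mathbf x),$$ where the sums are finite. Moreover, for each $(u,v,\mathbf a,\alpha,\mathbf b,\beta)$ in the middle sum there are exactly $2^{i(\alpha)-s(w)}$ reduced b-signed pipe dreams $D$ of size $n$ with $k$ $\Gamma$-blocks such that $\mathrm{word}_x(D)=\mathbf a$, $\mathrm{word}_z(D)=\mathbf b$, $\alpha(D)=\alpha$ and $\beta(D)=\beta$. -/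

import Mathlib

namespace SignedPD

/-! ### Signed permutations -/

/-- The group of finitary signed permutations: permutations `w` of the integers with
`w (-i) = -w i` (so that `w 0 = 0`) that move only finitely many points. -/
def BCInf : Subgroup (Equiv.Perm ℤ) where
  carrier := {w | (∀ i, w (-i) = -w i) ∧ {i | w i ≠ i}.Finite}
  one_mem' := by simp
  mul_mem' := by
    rintro u v ⟨hu, hu'⟩ ⟨hv, hv'⟩
    refine ⟨fun i => by simp [hu, hv], (hu'.union hv').subset ?_⟩
    intro i hi
    by_contra h
    simp only [Set.mem_union, Set.mem_ofPred_eq, not_or, not_not] at h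
    exact hi (by simp [h.1, h.2])
  inv_mem' := by
    rintro u ⟨hu, hu'⟩
    refine ⟨fun i => ?_, hu'.subset ?_⟩
    · rw [Equiv.Perm.inv_eq_iff_eq, hu]; simp
    · intro i hi h
      exact hi (by rw [Equiv.Perm.inv_eq_iff_eq]; exact h.symm)

/-- The hyperoctahedral group: signed permutations that fix every `i` with `|i| > n`. -/
def BC (n : ℕ) : Subgroup BCInf where
  carrier := {w | ∀ i : ℤ, (n : ℤ) < |i| → (w : Equiv.Perm ℤ) i = i}
  one_mem' := by simp
  mul_mem' := by
    intro u v hu hv i hi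
    simp [hv i hi, hu i hi]
  inv_mem' := by
    intro u hu i hi
    simp only [Subgroup.coe_inv]
    rw [Equiv.Perm.inv_eq_iff_eq, hu i hi]

/-- The symmetric group on `{1, …, n}`, as the set of elements of `BC n` without sign changes. -/
def Sym (n : ℕ) : Set BCInf :=
  {w | w ∈ BC n ∧ ∀ i : ℤ, 0 < i → 0 < (w : Equiv.Perm ℤ) i}

/-- The underlying permutation of the `i`-th generator: `1 ↔ -1` for `i = 0`, and
`i ↔ i + 1` (hence also `-i ↔ -(i + 1)`) for `i ≥ 1`. -/
def simplePerm (i : ℕ) : Equiv.Perm ℤ :=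
  if i = 0 then Equiv.swap 1 (-1)
  else Equiv.swap (i : ℤ) (i + 1) * Equiv.swap (-(i : ℤ)) (-(i + 1))

theorem simplePerm_mem (i : ℕ) : simplePerm i ∈ BCInf := by
  refine ⟨fun j => ?_, (Set.finite_Icc (-(i + 1 : ℤ)) (i + 1)).subset ?_⟩
  · unfold simplePerm
    split_ifs with h
    · simp only [Equiv.swap_apply_def]
      split_ifs <;> omega
    · simp only [Equiv.Perm.mul_apply, Equiv.swap_apply_def]
      split_ifs <;> omega
  · intro j hj
    by_contra hc
    apply hj
    simp only [Set.mem_Icc, not_and_or, not_le] at hc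
    unfold simplePerm
    split_ifs with h
    · simp only [Equiv.swap_apply_def]
      split_ifs <;> omega
    · simp only [Equiv.Perm.mul_apply, Equiv.swap_apply_def]
      split_ifs <;> omega

/-- The generator `s_i`, `i ≥ 0`. -/
def gen (i : ℕ) : BCInf := ⟨simplePerm i, simplePerm_mem i⟩

/-- The element represented by the word `s_{a_1} s_{a_2} ⋯`. -/
def wordProd (a : List ℕ) : BCInf := (a.map gen).prod

/-- The length of `w`: the least number of letters in a word that represents `w`. -/
noncomputable def len (w : BCInf) : ℕ :=
  sInf {m | ∃ a : List ℕ, a.length = m ∧ wordProd a = w}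

/-- The set `R(w)` of reduced words for `w`. -/
def reducedWords (w : BCInf) : Set (List ℕ) :=
  {a | wordProd a = w ∧ a.length = len w}

/-- `s(w)`: the number of positive integers that change their sign under `w`. -/
noncomputable def numSigns (w : BCInf) : ℕ :=
  {i : ℤ | 0 < i ∧ (w : Equiv.Perm ℤ) i < 0}.ncard

/-! ### Schubert polynomials of types C and B -/

/-- Generators of `ℚ[z_1, z_2, …, p_1(x), p_3(x), …]`:
`z i` is the variable `z_{i+1}` and `p j` is the odd power sum `p_{2j+1}(x)`. -/
inductive ZP
  | z (i : ℕ)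
  | p (j : ℕ)

/-- Variables of `ℚ[z_1, z_2, …, x_1, x_2, …]`:
`z i` is the variable `z_{i+1}` and `x i` is the variable `x_{i+1}`. -/
inductive ZX
  | z (i : ℕ)
  | x (i : ℕ)

open MvPolynomial in
/-- The action of `s_i` on `ℚ[z, p_1(x), p_3(x), …]`. For `i ≥ 1` it exchanges `z_i` and
`z_{i+1}`; and `s_0 f(z_1, z_2, …; x_1, x_2, …) = f(-z_1, z_2, …; z_1, x_1, x_2, …)`, that is,
`z_1 ↦ -z_1` and `p_k(x) ↦ p_k(x) + z_1 ^ k`. -/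
noncomputable def act : ℕ → (MvPolynomial ZP ℚ →ₐ[ℚ] MvPolynomial ZP ℚ)
  | 0 => aeval fun
      | .z 0 => -X (.z 0)
      | .z (i + 1) => X (.z (i + 1))
      | .p j => X (.p j) + X (.z 0) ^ (2 * j + 1)
  | i + 1 => rename fun
      | .z j => .z (Equiv.swap i (i + 1) j)
      | .p j => .p j

open MvPolynomial in
/-- The denominator of the divided difference: `-2 z_1` for `i = 0`, and `z_i - z_{i+1}` for
`i ≥ 1`. -/
noncomputable def denom : ℕ → MvPolynomial ZP ℚ
  | 0 => -2 * X (.z 0)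
  | i + 1 => X (.z i) - X (.z (i + 1))

/-- `∂_i f = g`, where `∂_i f = (f - s_i f) / denom i`. As the ring is a domain, there is at most
one such `g`. -/
def IsDividedDiff (i : ℕ) (f g : MvPolynomial ZP ℚ) : Prop :=
  denom i * g = f - act i f

/-- The grading in which `z_i` has degree `1` and `p_k` has degree `k`. -/
def degZP : ZP → ℕ
  | .z _ => 1
  | .p j => 2 * j + 1

/-- The relations that define the Schubert polynomials of type C. -/
structure IsSchubertC (S : BCInf → MvPolynomial ZP ℚ) : Prop where
  homogeneous : ∀ w, ∃ d, MvPolynomial.IsWeightedHomogeneous degZP (S w) d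
  one : S 1 = 1
  descent : ∀ w i, len (w * gen i) < len w → IsDividedDiff i (S w) (S (w * gen i))
  ascent : ∀ w i, ¬ len (w * gen i) < len w → IsDividedDiff i (S w) 0

/-- The Schubert polynomials of type C: the family that satisfies the defining relations. -/
noncomputable def schubertC : BCInf → MvPolynomial ZP ℚ :=
  Classical.epsilon IsSchubertC

/-- The Schubert polynomials of type B. -/
noncomputable def schubertB (w : BCInf) : MvPolynomial ZP ℚ :=
  ((2 : ℚ) ^ numSigns w)⁻¹ • schubertC w

open MvPolynomial in
/-- The `k`-truncation `F(z, x_1, …, x_k, 0, 0, …)`. -/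
noncomputable def truncation (k : ℕ) : MvPolynomial ZP ℚ →ₐ[ℚ] MvPolynomial ZX ℚ :=
  aeval fun
    | .z i => X (.z i)
    | .p j => ∑ i ∈ Finset.range k, X (.x i) ^ (2 * j + 1)

/-! ### Admissible monomials -/

/-- The letter of `a` at (zero-based) position `i + 1` is a peak. -/
def IsPeak (a : List ℕ) (i : ℕ) : Prop :=
  i + 2 < a.length ∧ a.getD i 0 < a.getD (i + 1) 0 ∧ a.getD (i + 2) 0 < a.getD (i + 1) 0

/-- `j` is a weakly decreasing sequence of indices of `x`-variables, admissible for `a`. -/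
def IsXAdmissible (a j : List ℕ) : Prop :=
  j.length = a.length ∧ j.Pairwise (· ≥ ·) ∧
    ∀ i, i + 2 < a.length → j.getD i 0 = j.getD (i + 1) 0 → j.getD (i + 1) 0 = j.getD (i + 2) 0 →
      ¬ IsPeak a i

/-- `j` is a weakly increasing sequence of indices of `z`-variables, admissible for `b`. The entry
`j_i` stands for the variable `z_{j_i + 1}`, so the bound `j_i + 1 ≤ b_i` is on its subscript. -/
def IsZAdmissible (b j : List ℕ) : Prop :=
  j.length = b.length ∧ j.Pairwise (· ≤ ·) ∧
    (∀ i, i < b.length → j.getD i 0 + 1 ≤ b.getD i 0) ∧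
    ∀ i, i + 1 < b.length → j.getD i 0 = j.getD (i + 1) 0 → b.getD (i + 1) 0 < b.getD i 0

/-- The exponent vector of the monomial `x_{j_1} x_{j_2} ⋯`. -/
noncomputable def exponent (j : List ℕ) : ℕ →₀ ℕ := Multiset.toFinsupp (j : Multiset ℕ)

/-- The exponents of the `x`-admissible monomials for `a`. -/
def admX (a : List ℕ) : Set (ℕ →₀ ℕ) := {α | ∃ j, IsXAdmissible a j ∧ exponent j = α}

/-- The exponents of the `z`-admissible monomials for `b`. -/
def admZ (b : List ℕ) : Set (ℕ →₀ ℕ) := {β | ∃ j, IsZAdmissible b j ∧ exponent j = β}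

open MvPolynomial in
/-- The monomial `x^α z^β`. -/
noncomputable def xzMonomial (α β : ℕ →₀ ℕ) : MvPolynomial ZX ℚ :=
  (α.prod fun i e => X (.x i) ^ e) * (β.prod fun i e => X (.z i) ^ e)

/-- A pair of elements with a word and an exponent vector for each of them. -/
structure Datum where
  u : BCInf
  v : BCInf
  a : List ℕ
  b : List ℕ
  α : ℕ →₀ ℕ
  β : ℕ →₀ ℕ

/-- The index set of the summation: `uv = w` with `ℓ(u) + ℓ(v) = ℓ(w)` and `v` in the symmetric
group, `a ∈ R(u)`, `x^α ∈ A_x(a)` with `α_{k+1} = α_{k+2} = ⋯ = 0`, `b ∈ R(v)`,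
`z^β ∈ A_z(b)`. -/
structure Datum.IsAdmissible (n k : ℕ) (w : BCInf) (d : Datum) : Prop where
  mul_eq : d.u * d.v = w
  len_add : len d.u + len d.v = len w
  v_mem : d.v ∈ Sym n
  a_mem : d.a ∈ reducedWords d.u
  α_mem : d.α ∈ admX d.a
  α_zero : ∀ i, k ≤ i → d.α i = 0
  b_mem : d.b ∈ reducedWords d.v
  β_mem : d.β ∈ admZ d.b

/-- `2^{i(α) - s(w)}`, where `i(α)` is the number of variables that occur in `x^α`. -/
noncomputable def coeffB (w : BCInf) (α : ℕ →₀ ℕ) : ℚ :=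
  (2 : ℚ) ^ ((α.support.card : ℤ) - (numSigns w : ℤ))

/-! ### b-signed pipe dreams -/

/-- The boxes `(row, column)` of a Γ-block: the union of a `1 × n` row and an `n × 1` column that
share their corner `(0, 0)`; there are `2 n - 1` of them if `n ≥ 1`. -/
abbrev GammaBox (n : ℕ) := {q : Fin n × Fin n // q.1.val = 0 ∨ q.2.val = 0}

/-- The boxes `(row, column)`, counted from `0`, of the staircase diagram
`(n - 1, n - 2, …, 2, 1)`. -/
abbrev StairBox (n : ℕ) := {q : Fin n × Fin n // q.1.val + q.2.val + 1 < n}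

/-- The base: `k` Γ-blocks and one staircase block. The Γ-block `i` is the `(i+1)`-st from below. -/
abbrev Box (n k : ℕ) := (Fin k × GammaBox n) ⊕ StairBox n

/-- The integer written in a box of a Γ-block: `0, …, n - 1` along the row and down the column. -/
def gammaLabel {n : ℕ} (q : GammaBox n) : ℕ := q.1.1.val + q.1.2.val

/-- The integer written in a box of the staircase: the number of its antidiagonal, from `1`. -/
def stairLabel {n : ℕ} (q : StairBox n) : ℕ := q.1.1.val + q.1.2.val + 1

/-- The integer written in a box of the base. -/
def label {n k : ℕ} : Box n k → ℕ
  | .inl q => gammaLabel q.2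
  | .inr q => stairLabel q

/-- The contents of a box: a single elbow, a single elbow with a faucet, a double elbow,
or a cross. -/
inductive Tile
  | elbow
  | faucet
  | elbows
  | cross
  deriving DecidableEq

instance : Fintype Tile :=
  ⟨{.elbow, .faucet, .elbows, .cross}, by intro t; cases t <;> decide⟩

/-- A corner of a Γ-block (the boxes labelled `0`) holds a single elbow with or without a faucet;
every other box holds a double elbow or a cross. -/
def Tile.Fits (t : Tile) (l : ℕ) : Prop :=
  if l = 0 then t = .elbow ∨ t = .faucet else t = .elbows ∨ t = .cross

instance (t : Tile) (l : ℕ) : Decidable (t.Fits l) := by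
  unfold Tile.Fits
  infer_instance

/-- The weight: `1` for the significant elements (crosses and faucets), `0` for the others. -/
def Tile.wt : Tile → ℕ
  | .elbow => 0
  | .faucet => 1
  | .elbows => 0
  | .cross => 1

/-- The letter contributed by an element in a box labelled `l`. -/
def Tile.letter (t : Tile) (l : ℕ) : Option ℕ :=
  match t with
  | .elbow => none
  | .faucet => some 0
  | .elbows => none
  | .cross => some l

/-- b-signed pipe dreams of size `n` with `k` Γ-blocks. -/
abbrev BPipeDream (n k : ℕ) := {D : Box n k → Tile // ∀ q, (D q).Fits (label q)}

/-- The boxes of a Γ-block read from right to left, top to bottom. -/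
def gammaReading (n : ℕ) : List (GammaBox n) :=
  (List.finRange n).flatMap fun r => (List.finRange n).reverse.filterMap fun c =>
    if h : r.val = 0 ∨ c.val = 0 then some ⟨(r, c), h⟩ else none

/-- The boxes of the staircase read from right to left, top to bottom. -/
def stairReading (n : ℕ) : List (StairBox n) :=
  (List.finRange n).flatMap fun r => (List.finRange n).reverse.filterMap fun c =>
    if h : r.val + c.val + 1 < n then some ⟨(r, c), h⟩ else none

namespace BPipeDream

variable {n k : ℕ}

/-- The part of the word of `D` that comes from the Γ-blocks, which are read from the topmost one
(number `k`) to the lowest one (number `1`). -/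
def wordX (D : BPipeDream n k) : List ℕ :=
  (List.finRange k).reverse.flatMap fun i =>
    (gammaReading n).filterMap fun q => (D.1 (.inl (i, q))).letter (gammaLabel q)

/-- The part of the word of `D` that comes from the staircase, which lies below the Γ-blocks. -/
def wordZ (D : BPipeDream n k) : List ℕ :=
  (stairReading n).filterMap fun q => (D.1 (.inr q)).letter (stairLabel q)

/-- The word of `D`: all boxes of the base are read from right to left, top to bottom. -/
def word (D : BPipeDream n k) : List ℕ := wordX D ++ wordZ D

/-- The exponent `α(D)`: a significant element in Γ-block `i` contributes the variable `x i`. -/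
noncomputable def α (D : BPipeDream n k) : ℕ →₀ ℕ :=
  ∑ q : Fin k × GammaBox n, Finsupp.single q.1.val (D.1 (.inl q)).wt

/-- The exponent `β(D)`: a significant element in row `r` of the staircase contributes the
variable `z r`. -/
noncomputable def β (D : BPipeDream n k) : ℕ →₀ ℕ :=
  ∑ q : StairBox n, Finsupp.single q.1.1.val (D.1 (.inr q)).wt

/-- The shape of `D` (of interest if `D` is reduced). -/
def shape (D : BPipeDream n k) : BCInf := wordProd (word D)

/-- `D` is reduced if its word is a reduced word. -/
def IsReduced (D : BPipeDream n k) : Prop := word D ∈ reducedWords (shape D)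

end BPipeDream

open Classical in
/-- The set of all reduced b-signed pipe dreams of size `n` with `k` Γ-blocks and shape `w`. -/
noncomputable def PD (n k : ℕ) (w : BCInf) : Finset (BPipeDream n k) :=
  Finset.univ.filter fun D => BPipeDream.IsReduced D ∧ BPipeDream.shape D = w

end SignedPD

open SignedPD

/-! The proof follows the nilCoxeter method of Fomin, Kirillov and Stanley. Let u_i be the matrices
`nilMat` of right multiplication in the nilCoxeter algebra of `BC n`. A monomial u_{a_1} u_{a_2} ⋯
has entry 1 at (1, w) if a is a reduced word of w, and 0 otherwise (`prod_nilMat_one_apply`). If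
each box of the base with label l and variable t stands for the factor 1 + t u_l, then expanding the
product in reading order amounts to choosing the significant boxes, and the entry at (1, w) is the
sum over the reduced pipe dreams of shape w (`baseProd_eq_sum`). Each Γ-block contributes a
`gammaProd`, the staircase a `stairProd`.

To recognise this entry as a Schubert polynomial, let γ(x) be the factor of a Γ-block with u_0
replaced by 2 u_0. Yang–Baxter equations show that γ(x) and γ(y) commute (`gammaProd_commute`), and
γ(x) γ(-x) = 1. Hence γ(x) = exp(∑ e_j x^{2j+1}) with commuting e_j and only odd powers
(`exists_exp_gammaLog`), and a product of γ(x_i) depends on the x_i only through odd power sums: it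
is a value of exp(∑ p_{2j+1} e_j). Multiplied by the staircase, this exponential gives a matrix on
which every ∂_i acts as right multiplication by u_i (`schubertMat_sub_act`). For s_0 this holds
because p_k ↦ p_k + z_1^k multiplies the exponential by γ(z_1), whose ascending half cancels the
first staircase row taken at -z_1.

The family is unique because a polynomial fixed by all s_i is constant (`eq_C_of_act_eq`):
finiteness of the set of variables removes the z_i, and invariance under p_k ↦ p_k + z_1^k forces
all ∂/∂p_k to vanish. Uniqueness also makes the entries independent of n, and homogeneous, since
rescaling the family yields another solution. Conjugation by the diagonal matrix with entries
2^{s(w)} turns 2 u_0 into u_0, which is the passage from type C to type B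
(`blockProd_mul_stairProd_apply`).

The middle sum is obtained by counting the pipe dreams over each of its terms. Along a Γ-block, row
minus column increases from -(n-1) to n-1 and the label is its absolute value, so filling a block
with given letters means choosing signs that make the letters increase. For a valley-shaped word
only the sign of the smallest letter is free, and it is not free if that letter is 0
(`numSignings_eq`). Each occupied block thus contributes 2 and each letter 0 divides by 2; the zeros
of a reduced word number s(w). In the staircase, row and label determine the box. -/

namespace SignedPD

/-! ### Descents and reduced words -/

/-- The smaller entry of the positive root inverted by the `i`-th generator. -/
def rootLo (i : ℕ) : ℤ := if i = 0 then -1 else i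

/-- The larger entry of the positive root inverted by the `i`-th generator. -/
def rootHi (i : ℕ) : ℤ := i + 1

/-- `w` has a descent at `i`. -/
def IsDescent (w : BCInf) (i : ℕ) : Prop := w.1 (rootHi i) < w.1 (rootLo i)

theorem apply_neg_eq (w : BCInf) (x : ℤ) : w.1 (-x) = -w.1 x := w.2.1 x

theorem map_zero' (w : BCInf) : w.1 0 = 0 := by
  have := apply_neg_eq w 0
  simp at this
  omega

theorem map_ne_zero' (w : BCInf) {x : ℤ} (hx : x ≠ 0) : w.1 x ≠ 0 := fun h =>
  hx (w.1.injective (by rw [h, map_zero']))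

theorem rootLo_ne_zero (i : ℕ) : rootLo i ≠ 0 := by
  unfold rootLo
  split_ifs <;> omega

theorem rootHi_ne_zero (i : ℕ) : rootHi i ≠ 0 := by
  unfold rootHi
  omega

theorem gen_apply (i : ℕ) (x : ℤ) : (gen i).1 x =
    if x = rootLo i then rootHi i else if x = rootHi i then rootLo i else
    if x = -rootLo i then -rootHi i else if x = -rootHi i then -rootLo i else x := by
  change simplePerm i x = _
  unfold simplePerm rootLo rootHi
  split_ifs <;> simp only [Equiv.Perm.mul_apply, Equiv.swap_apply_def] <;> split_ifs <;> omega

theorem gen_apply_lo (i : ℕ) : (gen i).1 (rootLo i) = rootHi i := by simp [gen_apply]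

theorem gen_apply_hi (i : ℕ) : (gen i).1 (rootHi i) = rootLo i := by
  rw [gen_apply]
  unfold rootLo rootHi
  split_ifs <;> omega

theorem gen_mul_self (i : ℕ) : gen i * gen i = 1 := by
  ext x
  change (gen i).1 ((gen i).1 x) = x
  rw [gen_apply, gen_apply]
  unfold rootLo rootHi
  split_ifs <;> omega

theorem mul_gen_gen (w : BCInf) (i : ℕ) : w * gen i * gen i = w := by
  rw [mul_assoc, gen_mul_self, mul_one]

theorem mul_gen_apply (w : BCInf) (i : ℕ) (x : ℤ) : (w * gen i).1 x = w.1 ((gen i).1 x) := rfl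

theorem isDescent_mul_gen (w : BCInf) (i : ℕ) : IsDescent (w * gen i) i ↔ ¬ IsDescent w i := by
  unfold IsDescent
  rw [mul_gen_apply, mul_gen_apply, gen_apply_lo, gen_apply_hi]
  have : w.1 (rootHi i) ≠ w.1 (rootLo i) := by
    rw [Ne, w.1.injective.eq_iff]
    unfold rootLo rootHi
    split_ifs <;> omega
  omega

/-- A simple reflection makes only its own simple root negative. A pair x < y of nonzero integers
stands for a positive root, and (-y, -x) for the same root, whence the two alternatives. -/
theorem eq_root_of_gen_reverses {i : ℕ} {x y : ℤ} (hx : x ≠ 0) (hy : y ≠ 0) (hxy : x < y)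
    (h : (gen i).1 y < (gen i).1 x) :
    (x = rootLo i ∧ y = rootHi i) ∨ (x = -rootHi i ∧ y = -rootLo i) := by
  rw [gen_apply, gen_apply] at h
  unfold rootLo rootHi at *
  split_ifs at * <;> omega

theorem wordProd_cons (i : ℕ) (a : List ℕ) : wordProd (i :: a) = gen i * wordProd a := by
  simp [wordProd]

theorem wordProd_append (a b : List ℕ) : wordProd (a ++ b) = wordProd a * wordProd b := by
  simp [wordProd]

theorem wordProd_concat (a : List ℕ) (i : ℕ) : wordProd (a ++ [i]) = wordProd a * gen i := by
  simp [wordProd]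

/-- The exchange property: at a descent one letter can be deleted from any word. -/
theorem exists_deletion (a : List ℕ) (i : ℕ) (h : IsDescent (wordProd a) i) :
    ∃ a' : List ℕ, a'.length + 1 = a.length ∧ wordProd a' = wordProd a * gen i := by
  induction a with
  | nil =>
    exfalso
    simp only [IsDescent, wordProd, List.map_nil, List.prod_nil] at h
    change rootHi i < rootLo i at h
    unfold rootLo rootHi at h
    split_ifs at h <;> omega
  | cons k t ih =>
    by_cases ht : IsDescent (wordProd t) i
    · obtain ⟨t', h1, h2⟩ := ih ht
      exact ⟨k :: t', by simp [h1], by rw [wordProd_cons, h2, wordProd_cons, mul_assoc]⟩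
    -- Here the descent is created by the first letter k, so k is the letter to delete. Since s_k
    -- reverses the pair of values of v at the root of s_i, that pair is the root of s_k, and s_k v
    -- = v s_i.
    · refine ⟨t, rfl, ?_⟩
      set v := wordProd t with hv
      rw [wordProd_cons, ← hv] at h ⊢
      have hne : v.1 (rootHi i) ≠ v.1 (rootLo i) := by
        rw [Ne, v.1.injective.eq_iff]
        unfold rootLo rootHi
        split_ifs <;> omega
      have hlt : v.1 (rootLo i) < v.1 (rootHi i) := by
        unfold IsDescent at ht
        omega
      have hroot := eq_root_of_gen_reverses (map_ne_zero' v (rootLo_ne_zero i))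
        (map_ne_zero' v (rootHi_ne_zero i)) hlt h
      have key : gen k * v = v * gen i := by
        ext x
        change (gen k).1 (v.1 x) = v.1 ((gen i).1 x)
        have hlo : (gen k).1 (v.1 (rootLo i)) = v.1 (rootHi i) := by
          rcases hroot with ⟨h1, h2⟩ | ⟨h1, h2⟩
          · rw [h1, h2, gen_apply_lo]
          · rw [h1, h2, apply_neg_eq, gen_apply_hi]
        have hhi : (gen k).1 (v.1 (rootHi i)) = v.1 (rootLo i) := by
          rcases hroot with ⟨h1, h2⟩ | ⟨h1, h2⟩
          · rw [h1, h2, gen_apply_hi]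
          · rw [h1, h2, apply_neg_eq, gen_apply_lo]
        by_cases x1 : x = rootLo i
        · rw [x1, gen_apply_lo, hlo]
        by_cases x2 : x = rootHi i
        · rw [x2, gen_apply_hi, hhi]
        by_cases x3 : x = -rootLo i
        · rw [x3, apply_neg_eq, apply_neg_eq, apply_neg_eq, gen_apply_lo, hlo, apply_neg_eq]
        by_cases x4 : x = -rootHi i
        · rw [x4, apply_neg_eq, apply_neg_eq, apply_neg_eq, gen_apply_hi, hhi, apply_neg_eq]
        have e1 : v.1 x ≠ v.1 (rootLo i) := fun e => x1 (v.1.injective e)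
        have e2 : v.1 x ≠ v.1 (rootHi i) := fun e => x2 (v.1.injective e)
        have e3 : v.1 x ≠ -v.1 (rootLo i) := fun e => x3 (v.1.injective (by rw [e, apply_neg_eq]))
        have e4 : v.1 x ≠ -v.1 (rootHi i) := fun e => x4 (v.1.injective (by rw [e, apply_neg_eq]))
        rw [gen_apply i x, if_neg x1, if_neg x2, if_neg x3, if_neg x4, gen_apply]
        rcases hroot with ⟨h1, h2⟩ | ⟨h1, h2⟩ <;> rw [h1] at e1 e3 <;> rw [h2] at e2 e4 <;>
          split_ifs <;> omega
      rw [key, mul_gen_gen]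

/-- The weighted sum `∑ i w(i)`, which increases when a descent is removed. -/
noncomputable def weightedSum (n : ℕ) (w : BCInf) : ℤ := ∑ i ∈ Finset.Icc (1 : ℤ) n, i * w.1 i

theorem abs_le_of_mem_BC {n : ℕ} {w : BCInf} (hw : w ∈ BC n) {x : ℤ} (hx : |x| ≤ n) :
    |w.1 x| ≤ n := by
  by_contra h
  push Not at h
  have := hw _ h
  rw [w.1.injective.eq_iff] at this
  rw [this] at h
  omega

theorem gen_mem_BC {n i : ℕ} (hi : i < n) : gen i ∈ BC n := by
  intro x hx
  rw [lt_abs] at hx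
  rw [gen_apply]
  unfold rootLo rootHi
  split_ifs <;> omega

theorem lt_of_isDescent {n i : ℕ} {w : BCInf} (hw : w ∈ BC n) (h : IsDescent w i) : i < n := by
  by_contra hi
  unfold IsDescent at h
  have h1 : w.1 (rootHi i) = rootHi i := hw _ (by unfold rootHi; rw [lt_abs]; omega)
  rw [h1] at h
  unfold rootLo rootHi at h
  split_ifs at h with h0
  · have : w.1 (-1) = -1 := hw _ (by simp; omega)
    omega
  · by_cases hin : n < i
    · have : w.1 i = i := hw _ (by rw [lt_abs]; omega)
      omega
    · have := abs_le.1 (abs_le_of_mem_BC hw (x := i) (by rw [abs_le]; omega))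
      omega

theorem mul_gen_mem_BC {n i : ℕ} {w : BCInf} (hw : w ∈ BC n) (h : IsDescent w i) :
    w * gen i ∈ BC n := mul_mem hw (gen_mem_BC (lt_of_isDescent hw h))

theorem exists_mem_BC (w : BCInf) : ∃ n, w ∈ BC n := by
  obtain ⟨M, hM⟩ := (w.2.2.image (fun x => |x|)).bddAbove
  refine ⟨M.toNat, fun x hx => ?_⟩
  by_contra h
  have := hM (Set.mem_image_of_mem _ (show x ∈ {i | w.1 i ≠ i} from h))
  omega

theorem BC_mono {m n : ℕ} (h : m ≤ n) : BC m ≤ BC n := fun w hw x hx => hw x (by omega)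

/-- Without descents the values at 1, 2, … are positive and strictly increasing, so w(i) ≥ i; since
w(i) = i beyond n, no earlier value can exceed its index. -/
theorem eq_one_of_no_descent {n : ℕ} {w : BCInf} (hw : w ∈ BC n)
    (h : ∀ i < n, ¬ IsDescent w i) : w = 1 := by
  have h0 : ∀ i : ℕ, ¬ IsDescent w i := fun i hi => h i (lt_of_isDescent hw hi) hi
  have hpos : 0 < w.1 1 := by
    have := h0 0
    simp only [IsDescent, rootHi, rootLo, Nat.cast_zero, zero_add, if_true, apply_neg_eq] at this
    have := map_ne_zero' w (x := 1) one_ne_zero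
    omega
  have hstep : ∀ i : ℕ, 1 ≤ i → w.1 i < w.1 (i + 1) := by
    intro i hi
    have := h0 i
    simp only [IsDescent, rootHi, rootLo, if_neg (by omega : ¬ i = 0)] at this
    have h2 : w.1 i ≠ w.1 (i + 1) := by rw [Ne, w.1.injective.eq_iff]; omega
    omega
  have hlow : ∀ i : ℕ, 1 ≤ i → (i : ℤ) ≤ w.1 i := by
    intro i hi
    induction i, hi using Nat.le_induction with
    | base => push_cast; omega
    | succ i hi ih => have := hstep i hi; push_cast; omega
  have hup : ∀ d i : ℕ, 1 ≤ i → w.1 i + d ≤ w.1 (i + d) := by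
    intro d i hi
    induction d with
    | zero => simp
    | succ d ih =>
      have := hstep (i + d) (by omega)
      push_cast at this ⊢
      rw [add_assoc] at this
      omega
  have hfix : ∀ i : ℕ, 1 ≤ i → w.1 i = i := by
    intro i hi
    have h1 := hup (n + 1) i hi
    have h2 : w.1 (i + (n + 1 : ℕ)) = i + (n + 1 : ℕ) := hw _ (by rw [lt_abs]; push_cast; omega)
    have := hlow i hi
    omega
  ext x
  change w.1 x = x
  rcases lt_trichotomy x 0 with hx | rfl | hx
  · have := hfix (-x).toNat (by omega)
    rw [Int.toNat_of_nonneg (by omega), apply_neg_eq] at this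
    omega
  · exact map_zero' w
  · have := hfix x.toNat (by omega)
    rwa [Int.toNat_of_nonneg (by omega)] at this

/-- A rearrangement inequality. As the weighted sum is a bounded integer on `BC n`, removing
descents must end, which shows that the generators generate. -/
theorem weightedSum_lt {n i : ℕ} {w : BCInf} (hw : w ∈ BC n) (h : IsDescent w i) :
    weightedSum n w < weightedSum n (w * gen i) := by
  have hi := lt_of_isDescent hw h
  unfold weightedSum
  unfold IsDescent at h
  have hfix : ∀ x : ℤ, 0 < x → x ≠ i → x ≠ i + 1 → (w * gen i).1 x = w.1 x := by
    intro x hx h1 h2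
    rw [mul_gen_apply, gen_apply]
    unfold rootLo rootHi
    congr 1
    split_ifs <;> omega
  have hhi : (w * gen i).1 (i + 1 : ℤ) = w.1 (rootLo i) := by
    rw [mul_gen_apply, ← gen_apply_hi]; rfl
  have hmem : (i + 1 : ℤ) ∈ Finset.Icc (1 : ℤ) n := by rw [Finset.mem_Icc]; omega
  by_cases h0 : i = 0
  · subst h0
    apply Finset.sum_lt_sum
    · intro x hx
      rw [Finset.mem_Icc] at hx
      by_cases hx1 : x = 1
      · subst hx1
        simp only [Nat.cast_zero, zero_add] at hhi
        rw [hhi]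
        unfold rootHi at h
        simp at h
        omega
      · rw [hfix x (by omega) (by push_cast; omega) (by push_cast; omega)]
    · refine ⟨1, by simpa using hmem, ?_⟩
      simp only [Nat.cast_zero, zero_add] at hhi
      rw [hhi]
      unfold rootHi at h
      simp at h
      omega
  · have hlo : (w * gen i).1 (i : ℤ) = w.1 (rootHi i) := by
      rw [mul_gen_apply, ← gen_apply_lo]; simp [rootLo, h0]
    have hmem' : (i : ℤ) ∈ (Finset.Icc (1 : ℤ) n).erase (i + 1 : ℤ) := by
      rw [Finset.mem_erase, Finset.mem_Icc]; omega
    rw [← Finset.add_sum_erase _ _ hmem, ← Finset.add_sum_erase _ _ hmem',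
      ← Finset.add_sum_erase _ _ hmem, ← Finset.add_sum_erase _ _ hmem', hhi, hlo]
    have hrest : ∑ x ∈ ((Finset.Icc (1 : ℤ) n).erase (i + 1 : ℤ)).erase (i : ℤ), x * w.1 x =
        ∑ x ∈ ((Finset.Icc (1 : ℤ) n).erase (i + 1 : ℤ)).erase (i : ℤ), x * (w * gen i).1 x := by
      refine Finset.sum_congr rfl fun x hx => ?_
      simp only [Finset.mem_erase, Finset.mem_Icc] at hx
      rw [hfix x (by omega) (by omega) (by omega)]
    rw [hrest]
    unfold rootHi rootLo at *
    rw [if_neg h0] at *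
    nlinarith

theorem abs_weightedSum_le {n : ℕ} {w : BCInf} (hw : w ∈ BC n) :
    |weightedSum n w| ≤ n * (n * n) := by
  unfold weightedSum
  refine (Finset.abs_sum_le_sum_abs _ _).trans ?_
  refine (Finset.sum_le_card_nsmul _ _ ((n : ℤ) * n) ?_).trans ?_
  · intro x hx
    rw [Finset.mem_Icc] at hx
    rw [abs_mul]
    have hx' : |x| ≤ n := by rw [abs_le]; omega
    exact mul_le_mul hx' (abs_le_of_mem_BC hw hx') (abs_nonneg _) (by omega)
  · simp

theorem exists_word_of_mem_BC {n : ℕ} (m : ℕ) {w : BCInf} (hw : w ∈ BC n)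
    (hm : (n : ℤ) * (n * n) - weightedSum n w ≤ m) :
    ∃ a : List ℕ, a.length ≤ m ∧ wordProd a = w := by
  induction m generalizing w with
  | zero =>
    have hd : ∀ i < n, ¬ IsDescent w i := by
      intro i _ hi
      have := weightedSum_lt hw hi
      have := (abs_le.1 (abs_weightedSum_le (mul_gen_mem_BC hw hi))).2
      push_cast at hm
      omega
    exact ⟨[], le_rfl, (eq_one_of_no_descent hw hd).symm⟩
  | succ m ih =>
    by_cases hd : ∃ i, IsDescent w i
    · obtain ⟨i, hi⟩ := hd
      have := weightedSum_lt hw hi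
      obtain ⟨a, ha, ha'⟩ := ih (mul_gen_mem_BC hw hi) (by push_cast at hm; omega)
      refine ⟨a ++ [i], by simp [ha], ?_⟩
      rw [wordProd_concat, ha', mul_gen_gen]
    · push Not at hd
      exact ⟨[], by simp, (eq_one_of_no_descent hw fun i _ => hd i).symm⟩

theorem exists_word (w : BCInf) : ∃ a : List ℕ, wordProd a = w := by
  obtain ⟨n, hn⟩ := exists_mem_BC w
  obtain ⟨a, -, ha⟩ := exists_word_of_mem_BC ((n : ℤ) * (n * n) - weightedSum n w).toNat hn
    (Int.self_le_toNat _)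
  exact ⟨a, ha⟩

theorem len_le_length (a : List ℕ) : len (wordProd a) ≤ a.length :=
  Nat.sInf_le ⟨a, rfl, rfl⟩

theorem exists_reduced (w : BCInf) : ∃ a : List ℕ, wordProd a = w ∧ a.length = len w := by
  obtain ⟨a, ha⟩ := exists_word w
  obtain ⟨b, hb, hb'⟩ := Nat.sInf_mem (⟨a.length, a, rfl, ha⟩ :
    {m | ∃ a : List ℕ, a.length = m ∧ wordProd a = w}.Nonempty)
  exact ⟨b, hb', hb⟩

/-- A crude bound; only its existence matters, for the finiteness of `BC n` and for nilpotency. -/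
theorem len_le_of_mem_BC {n : ℕ} {w : BCInf} (hw : w ∈ BC n) : len w ≤ 2 * (n * (n * n)) := by
  obtain ⟨a, ha, rfl⟩ := exists_word_of_mem_BC (2 * (n * (n * n))) hw (by
    have := (abs_le.1 (abs_weightedSum_le hw)).1
    push_cast
    omega)
  exact (len_le_length a).trans ha

theorem len_mul_le (u v : BCInf) : len (u * v) ≤ len u + len v := by
  obtain ⟨a, rfl, ha⟩ := exists_reduced u
  obtain ⟨b, rfl, hb⟩ := exists_reduced v
  rw [← ha, ← hb, ← wordProd_append, ← List.length_append]
  exact len_le_length _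

theorem len_one : len 1 = 0 := Nat.le_zero.1 (len_le_length [])

theorem len_gen_le (i : ℕ) : len (gen i) ≤ 1 := by
  have := len_le_length [i]
  simpa [wordProd] using this

theorem eq_one_of_len_eq_zero {w : BCInf} (h : len w = 0) : w = 1 := by
  obtain ⟨a, rfl, ha⟩ := exists_reduced w
  rw [h, List.length_eq_zero_iff] at ha
  simp [ha, wordProd]

/-- The exchange property shortens a reduced word by one letter, and subadditivity of the length
forbids a larger drop. -/
theorem len_mul_gen_of_isDescent {w : BCInf} {i : ℕ} (h : IsDescent w i) :
    len (w * gen i) + 1 = len w := by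
  obtain ⟨a, rfl, ha⟩ := exists_reduced w
  obtain ⟨b, hb, hb'⟩ := exists_deletion a i h
  have h1 := len_le_length b
  have h2 := len_mul_le (wordProd a * gen i) (gen i)
  rw [mul_gen_gen] at h2
  have := len_gen_le i
  rw [hb'] at h1
  omega

theorem len_mul_gen_of_not_isDescent {w : BCInf} {i : ℕ} (h : ¬ IsDescent w i) :
    len (w * gen i) = len w + 1 := by
  have := len_mul_gen_of_isDescent ((isDescent_mul_gen w i).2 h)
  rw [mul_gen_gen] at this
  exact this.symm

theorem len_mul_gen_lt_iff (w : BCInf) (i : ℕ) : len (w * gen i) < len w ↔ IsDescent w i := by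
  by_cases h : IsDescent w i
  · have := len_mul_gen_of_isDescent h
    simp only [h, iff_true]; omega
  · have := len_mul_gen_of_not_isDescent h
    simp only [h, iff_false]; omega

theorem exists_isDescent {w : BCInf} (h : w ≠ 1) : ∃ i, IsDescent w i := by
  obtain ⟨n, hn⟩ := exists_mem_BC w
  by_contra hc
  push Not at hc
  exact h (eq_one_of_no_descent hn fun i _ => hc i)

/-- The recursion on the last letter behind the inductions over reduced words; `nilMat` encodes it.
-/
theorem concat_mem_reducedWords_iff (a : List ℕ) (i : ℕ) (w : BCInf) :
    a ++ [i] ∈ reducedWords w ↔ IsDescent w i ∧ a ∈ reducedWords (w * gen i) := by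
  simp only [reducedWords, Set.mem_ofPred_eq, wordProd_concat, List.length_append,
    List.length_singleton]
  constructor
  · rintro ⟨h, h'⟩
    have h1 : wordProd a = w * gen i := by rw [← h, mul_gen_gen]
    have h2 := len_le_length a
    rw [h1] at h2
    have hd : IsDescent w i := (len_mul_gen_lt_iff w i).1 (by omega)
    have := len_mul_gen_of_isDescent hd
    exact ⟨hd, h1, by omega⟩
  · rintro ⟨hd, h1, h2⟩
    have := len_mul_gen_of_isDescent hd
    exact ⟨by rw [h1, mul_gen_gen], by omega⟩

theorem nil_mem_reducedWords_iff (w : BCInf) : [] ∈ reducedWords w ↔ w = 1 := by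
  simp only [reducedWords, Set.mem_ofPred_eq, wordProd, List.map_nil, List.prod_nil,
    List.length_nil]
  constructor
  · rintro ⟨h, -⟩; exact h.symm
  · rintro rfl; exact ⟨rfl, len_one.symm⟩

theorem reducedWords_letters_lt {n : ℕ} {w : BCInf} (hw : w ∈ BC n) {a : List ℕ}
    (ha : a ∈ reducedWords w) : ∀ i ∈ a, i < n := by
  induction a using List.reverseRecOn generalizing w with
  | nil => simp
  | append_singleton a i ih =>
    rw [concat_mem_reducedWords_iff] at ha
    intro j hj
    rw [List.mem_append, List.mem_singleton] at hj
    rcases hj with hj | rfl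
    · exact ih (mul_gen_mem_BC hw ha.1) ha.2 j hj
    · exact lt_of_isDescent hw ha.1

theorem gen_mem_Sym {n i : ℕ} (h0 : i ≠ 0) (hi : i < n) : gen i ∈ Sym n := by
  refine ⟨gen_mem_BC hi, fun x hx => ?_⟩
  rw [gen_apply]
  unfold rootLo rootHi
  split_ifs <;> omega

theorem mul_mem_Sym {n : ℕ} {u v : BCInf} (hu : u ∈ Sym n) (hv : v ∈ Sym n) : u * v ∈ Sym n :=
  ⟨mul_mem hu.1 hv.1, fun x hx => hu.2 _ (hv.2 x hx)⟩

theorem wordProd_mem_Sym {n : ℕ} {a : List ℕ} (h : ∀ i ∈ a, i ≠ 0 ∧ i < n) :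
    wordProd a ∈ Sym n := by
  induction a with
  | nil => exact ⟨one_mem _, fun x hx => hx⟩
  | cons i a ih =>
    rw [wordProd_cons]
    have := h i (by simp)
    exact mul_mem_Sym (gen_mem_Sym this.1 this.2) (ih fun j hj => h j (by simp [hj]))

theorem finite_BC (n : ℕ) : Finite (BC n) := by
  have hfin : {l : List (Fin n) | l.length ≤ 2 * (n * (n * n))}.Finite :=
    List.finite_length_le _ _
  have : Finite {l : List (Fin n) | l.length ≤ 2 * (n * (n * n))} := hfin
  have hex : ∀ w : BC n, ∃ l : {l : List (Fin n) | l.length ≤ 2 * (n * (n * n))},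
      wordProd (l.1.map Fin.val) = w.1 := by
    rintro ⟨w, hw⟩
    obtain ⟨a, ha, ha'⟩ := exists_reduced w
    have hlt := reducedWords_letters_lt hw ⟨ha, ha'⟩
    refine ⟨⟨a.pmap Fin.mk hlt, ?_⟩, ?_⟩
    · simp only [Set.mem_ofPred_eq, List.length_pmap, ha']
      exact len_le_of_mem_BC hw
    · simp only [List.map_pmap]
      simpa using ha
  choose f hf using hex
  refine Finite.of_injective f fun v w h => Subtype.ext ?_
  rw [← hf v, ← hf w, h]

/-! ### Sign changes -/

theorem finite_neg_set (w : BCInf) : {i : ℤ | 0 < i ∧ w.1 i < 0}.Finite :=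
  w.2.2.subset fun i hi => by
    simp only [Set.mem_ofPred_eq] at hi ⊢
    omega

theorem numSigns_one : numSigns 1 = 0 := by
  have : {i : ℤ | 0 < i ∧ (1 : BCInf).1 i < 0} = ∅ := by
    ext i
    simp only [Set.mem_empty_iff_false, iff_false]
    exact fun h => lt_asymm h.1 h.2
  unfold numSigns
  rw [this, Set.ncard_empty]

theorem numSigns_mul_gen_of_ne_zero (w : BCInf) {i : ℕ} (hi : i ≠ 0) :
    numSigns (w * gen i) = numSigns w := by
  unfold numSigns
  have hpos : ∀ x : ℤ, 0 < (gen i).1 x ↔ 0 < x := by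
    intro x
    rw [gen_apply]
    unfold rootLo rootHi
    split_ifs <;> omega
  have : {x : ℤ | 0 < x ∧ w.1 x < 0} = (gen i).1 '' {x : ℤ | 0 < x ∧ (w * gen i).1 x < 0} := by
    ext x
    rw [← Equiv.symm_symm (gen i).1, Equiv.image_symm_eq_preimage]
    simp only [Set.mem_preimage, Set.mem_ofPred_eq, mul_gen_apply]
    have h := hpos ((Equiv.symm (gen i).1) x)
    rw [Equiv.apply_symm_apply] at h ⊢
    rw [← h]
  rw [this, Set.ncard_image_of_injective _ (gen i).1.injective]

theorem numSigns_mul_gen_zero {w : BCInf} (h : IsDescent w 0) :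
    numSigns (w * gen 0) + 1 = numSigns w := by
  unfold numSigns
  simp only [IsDescent, rootHi, rootLo, Nat.cast_zero, zero_add, if_true, apply_neg_eq] at h
  have : {x : ℤ | 0 < x ∧ w.1 x < 0} = insert 1 {x : ℤ | 0 < x ∧ (w * gen 0).1 x < 0} := by
    ext x
    simp only [Set.mem_insert_iff, Set.mem_ofPred_eq, mul_gen_apply, gen_apply]
    simp only [rootLo, rootHi, if_true, Nat.cast_zero, zero_add, neg_neg]
    split_ifs with h1 h2
    · subst h1; simp
    · subst h2; simp; omega
    · omega
  rw [this, Set.ncard_insert_of_notMem _ (finite_neg_set _)]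
  simp only [Set.mem_ofPred_eq, mul_gen_apply, gen_apply]
  rw [if_neg (by decide), if_pos (by decide)]
  simp only [rootLo, if_true, apply_neg_eq]
  omega

/-- Only s_0 alters the number of sign changes, and in a reduced word each s_0 is appended at an
ascent, where it adds one. -/
theorem numSigns_eq_count {a : List ℕ} {w : BCInf} (ha : a ∈ reducedWords w) :
    numSigns w = a.count 0 := by
  induction a using List.reverseRecOn generalizing w with
  | nil => rw [(nil_mem_reducedWords_iff w).1 ha, numSigns_one]; simp
  | append_singleton a i ih =>
    rw [concat_mem_reducedWords_iff] at ha
    have := ih ha.2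
    rw [List.count_append, ← this]
    by_cases hi : i = 0
    · subst hi
      simp [← numSigns_mul_gen_zero ha.1]
    · rw [numSigns_mul_gen_of_ne_zero w hi]
      simp [hi]

theorem reducedWords_letters_ne_zero {n : ℕ} {v : BCInf} (hv : v ∈ Sym n) {a : List ℕ}
    (ha : a ∈ reducedWords v) : 0 ∉ a := by
  have h1 := numSigns_eq_count ha
  have : {i : ℤ | 0 < i ∧ v.1 i < 0} = ∅ := by
    ext x
    simp only [Set.mem_ofPred_eq, Set.mem_empty_iff_false, iff_false]
    rintro ⟨h, h'⟩
    have := hv.2 x h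
    omega
  unfold numSigns at h1
  rw [this, Set.ncard_empty] at h1
  exact List.count_eq_zero.1 h1.symm

end SignedPD

namespace SignedPD

/-! ### Products in the nilCoxeter algebra -/

/-- The relations of the nilCoxeter algebra of the signed permutations. -/
structure IsNilCoxeter {B : Type*} [Ring B] (u : ℕ → B) : Prop where
  sq : ∀ i, u i * u i = 0
  comm : ∀ i j, i + 2 ≤ j → Commute (u i) (u j)
  braid : ∀ i, u (i + 1) * u (i + 2) * u (i + 1) = u (i + 2) * u (i + 1) * u (i + 2)
  braid_zero : u 0 * u 1 * u 0 * u 1 = u 1 * u 0 * u 1 * u 0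

variable {R B : Type*} [CommRing R] [Ring B] [Algebra R B]

/-- The factor `1 + c u_i`. -/
def factor (u : ℕ → B) (i : ℕ) (c : R) : B := 1 + c • u i

/-- The product `(1 + x u_{i+m-1}) ⋯ (1 + x u_i)`. -/
def descProd (u : ℕ → B) (x : R) : ℕ → ℕ → B
  | 0, _ => 1
  | m + 1, i => descProd u x m (i + 1) * factor u i x

/-- The product `(1 + x u_i) ⋯ (1 + x u_{i+m-1})`. -/
def ascProd (u : ℕ → B) (x : R) : ℕ → ℕ → B
  | 0, _ => 1
  | m + 1, i => factor u i x * ascProd u x m (i + 1)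

/-- The product `(1 + x u_m) ⋯ (1 + x u_1) (1 + c x u_0) (1 + x u_1) ⋯ (1 + x u_m)`. -/
def gammaProd (u : ℕ → B) (c : R) (m : ℕ) (x : R) : B :=
  descProd u x m 1 * factor u 0 (c * x) * ascProd u x m 1

/-- With h_a(t) = 1 + t a, this is the Yang–Baxter equation h_b(x-y) h_a(x) h_b(y) = h_a(y) h_b(x)
h_a(x-y), rearranged so that the sides differ by exchanging x and y. -/
theorem yang_baxter_aux {a b : B} (ha : a * a = 0) (hb : b * b = 0) (hab : a * b * a = b * a * b)
    (x y : R) : (1 + (-y) • b) * (1 + x • a) * (1 + y • b) * (1 + y • a) =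
      (1 + (-x) • b) * (1 + y • a) * (1 + x • b) * (1 + x • a) := by
  have hb' : ∀ w, b * (b * w) = 0 := fun w => by rw [← mul_assoc, hb, zero_mul]
  have hab' : a * (b * a) = b * (a * b) := by simpa only [mul_assoc] using hab
  simp only [mul_add, add_mul, one_mul, mul_one, smul_mul_assoc, mul_smul_comm, mul_assoc, ha, hb,
    hb', hab', mul_zero, smul_zero, add_zero, smul_smul, smul_add]
  module

/-- The analogue for the braid relation of length four, again stated as a symmetry in x and y. The
factor c rescales the generator a and may be arbitrary. -/
theorem yang_baxter_zero_aux {a b : B} (ha : a * a = 0) (hb : b * b = 0)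
    (hab : a * b * a * b = b * a * b * a) (c x y : R) :
    (1 + (-y) • b) * (1 + (c * x) • a) * (1 + (x + y) • b) * (1 + (c * y) • a) * (1 + (-x) • b) =
    (1 + (-x) • b) * (1 + (c * y) • a) * (1 + (y + x) • b) * (1 + (c * x) • a) *
      (1 + (-y) • b) := by
  have hb' : ∀ w, b * (b * w) = 0 := fun w => by rw [← mul_assoc, hb, zero_mul]
  have hab' : a * (b * (a * b)) = b * (a * (b * a)) := by simpa only [mul_assoc] using hab
  simp only [mul_add, add_mul, one_mul, mul_one, smul_mul_assoc, mul_smul_comm, mul_assoc, ha, hb,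
    hb', hab', mul_zero, smul_zero, add_zero, smul_smul, smul_add]
  module

section

variable {u : ℕ → B}

theorem factor_zero (i : ℕ) : factor u i (0 : R) = 1 := by simp [factor]

theorem IsNilCoxeter.factor_mul (hu : IsNilCoxeter u) (i : ℕ) (x y : R) :
    factor u i x * factor u i y = factor u i (x + y) := by
  simp only [factor, mul_add, add_mul, one_mul, mul_one, smul_mul_assoc, mul_smul_comm, hu.sq i,
    smul_zero, add_zero]
  module

theorem IsNilCoxeter.factor_mul_neg (hu : IsNilCoxeter u) (i : ℕ) (x : R) :
    factor u i x * factor u i (-x) = 1 := by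
  rw [hu.factor_mul, add_neg_cancel, factor_zero]

theorem IsNilCoxeter.factor_neg_mul (hu : IsNilCoxeter u) (i : ℕ) (x : R) :
    factor u i (-x) * factor u i x = 1 := by
  rw [hu.factor_mul, neg_add_cancel, factor_zero]

theorem commute_descProd {b : B} {i : ℕ} (h : ∀ j, i ≤ j → Commute b (u j)) (x : R) (m : ℕ) :
    Commute b (descProd u x m i) := by
  induction m generalizing i with
  | zero => exact Commute.one_right _
  | succ m ih =>
    exact (ih fun j hj => h j (by omega)).mul_right
      ((Commute.one_right _).add_right ((h i le_rfl).smul_right x))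

theorem IsNilCoxeter.commute_factor_descProd (hu : IsNilCoxeter u) {i j : ℕ} (h : i + 2 ≤ j)
    (x y : R) (m : ℕ) : Commute (factor u i x) (descProd u y m j) :=
  commute_descProd (fun k hk => (Commute.one_left _).add_left
    ((hu.comm i k (by omega)).smul_left x)) y m

theorem IsNilCoxeter.commute_gen_descProd (hu : IsNilCoxeter u) {i j : ℕ} (h : i + 2 ≤ j)
    (y : R) (m : ℕ) : Commute (u i) (descProd u y m j) :=
  commute_descProd (fun k hk => hu.comm i k (by omega)) y m

theorem IsNilCoxeter.descProd_mul_ascProd (hu : IsNilCoxeter u) (x : R) (m i : ℕ) :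
    descProd u x m i * ascProd u (-x) m i = 1 := by
  induction m generalizing i with
  | zero => simp [descProd, ascProd]
  | succ m ih =>
    rw [descProd, ascProd, mul_assoc, ← mul_assoc (factor u i x), hu.factor_mul_neg, one_mul, ih]

theorem IsNilCoxeter.ascProd_mul_descProd (hu : IsNilCoxeter u) (x : R) (m i : ℕ) :
    ascProd u x m i * descProd u (-x) m i = 1 := by
  induction m generalizing i with
  | zero => simp [descProd, ascProd]
  | succ m ih =>
    rw [descProd, ascProd, mul_assoc, ← mul_assoc (ascProd u x m _), ih, one_mul,
      hu.factor_mul_neg]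

theorem IsNilCoxeter.yang_baxter (hu : IsNilCoxeter u) (i : ℕ) (x y : R) :
    factor u (i + 2) (-y) * factor u (i + 1) x * factor u (i + 2) y * factor u (i + 1) y =
    factor u (i + 2) (-x) * factor u (i + 1) y * factor u (i + 2) x * factor u (i + 1) x :=
  yang_baxter_aux (hu.sq _) (hu.sq _) (hu.braid i) x y

/-- The product of the two is the product of the two shorter ones, symmetric in x and y by
induction, times an expression in the two lowest generators that is symmetric by Yang–Baxter. The
index i + 1 keeps u 0 out, whose braid relation differs. -/
theorem IsNilCoxeter.descProd_commute (hu : IsNilCoxeter u) (x y : R) (m i : ℕ) :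
    Commute (descProd u x m (i + 1)) (descProd u y m (i + 1)) := by
  induction m generalizing i with
  | zero => exact Commute.one_right _
  | succ m ih =>
    cases m with
    | zero =>
      simp only [descProd, one_mul]
      rw [Commute, SemiconjBy, hu.factor_mul, hu.factor_mul, add_comm x y]
    | succ m =>
      have key : ∀ x y : R, descProd u x (m + 2) (i + 1) * descProd u y (m + 2) (i + 1) =
          descProd u x (m + 1) (i + 2) * descProd u y (m + 1) (i + 2) *
          (factor u (i + 2) (-y) * factor u (i + 1) x * factor u (i + 2) y *
            factor u (i + 1) y) := by
        intro x y
        have h1 : descProd u y (m + 1) (i + 2) * factor u (i + 2) (-y) =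
            descProd u y m (i + 3) := by
          rw [descProd, mul_assoc, hu.factor_mul_neg, mul_one]
        have h2 := (hu.commute_factor_descProd (show i + 1 + 2 ≤ i + 3 by omega) x y m).eq
        calc _ = descProd u x (m + 1) (i + 2) * factor u (i + 1) x *
              (descProd u y m (i + 3) * factor u (i + 2) y * factor u (i + 1) y) := rfl
          _ = descProd u x (m + 1) (i + 2) * (factor u (i + 1) x * descProd u y m (i + 3)) *
              factor u (i + 2) y * factor u (i + 1) y := by simp only [mul_assoc]
          _ = _ := by rw [h2, ← h1]; simp only [mul_assoc]
      rw [Commute, SemiconjBy, key x y, key y x, hu.yang_baxter, (ih (i + 1)).eq]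

/-- The ascending product at y is the inverse of the descending product at -y, so this reduces to
`descProd_commute`. -/
theorem IsNilCoxeter.descProd_commute_ascProd (hu : IsNilCoxeter u) (x y : R) (m i : ℕ) :
    Commute (descProd u x m (i + 1)) (ascProd u y m (i + 1)) := by
  have h := hu.descProd_commute x (-y) m i
  have h1 := hu.ascProd_mul_descProd y m (i + 1)
  have h2 := hu.descProd_mul_ascProd (-y) m (i + 1)
  rw [neg_neg] at h2
  calc _ = ascProd u y m (i + 1) * descProd u (-y) m (i + 1) *
        (descProd u x m (i + 1) * ascProd u y m (i + 1)) := by rw [h1, one_mul]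
    _ = ascProd u y m (i + 1) * (descProd u (-y) m (i + 1) * descProd u x m (i + 1)) *
        ascProd u y m (i + 1) := by simp only [mul_assoc]
    _ = ascProd u y m (i + 1) * (descProd u x m (i + 1) * descProd u (-y) m (i + 1)) *
        ascProd u y m (i + 1) := by rw [h.eq]
    _ = ascProd u y m (i + 1) * descProd u x m (i + 1) *
        (descProd u (-y) m (i + 1) * ascProd u y m (i + 1)) := by simp only [mul_assoc]
    _ = _ := by rw [h2, mul_one]

theorem IsNilCoxeter.ascProd_commute (hu : IsNilCoxeter u) (x y : R) (m i : ℕ) :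
    Commute (ascProd u x m (i + 1)) (ascProd u y m (i + 1)) := by
  have h := (hu.descProd_commute_ascProd (-y) x m i).symm
  have h1 := hu.ascProd_mul_descProd y m (i + 1)
  have h2 := hu.descProd_mul_ascProd (-y) m (i + 1)
  rw [neg_neg] at h2
  calc _ = ascProd u y m (i + 1) * descProd u (-y) m (i + 1) *
        (ascProd u x m (i + 1) * ascProd u y m (i + 1)) := by rw [h1, one_mul]
    _ = ascProd u y m (i + 1) * (descProd u (-y) m (i + 1) * ascProd u x m (i + 1)) *
        ascProd u y m (i + 1) := by simp only [mul_assoc]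
    _ = ascProd u y m (i + 1) * (ascProd u x m (i + 1) * descProd u (-y) m (i + 1)) *
        ascProd u y m (i + 1) := by rw [h.eq]
    _ = ascProd u y m (i + 1) * ascProd u x m (i + 1) *
        (descProd u (-y) m (i + 1) * ascProd u y m (i + 1)) := by simp only [mul_assoc]
    _ = _ := by rw [h2, mul_one]

theorem IsNilCoxeter.gammaProd_mul_neg (hu : IsNilCoxeter u) (c : R) (m : ℕ) (x : R) :
    gammaProd u c m x * gammaProd u c m (-x) = 1 := by
  have h1 := hu.ascProd_mul_descProd x m 1
  calc _ = descProd u x m 1 * factor u 0 (c * x) * (ascProd u x m 1 * descProd u (-x) m 1) *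
        factor u 0 (c * -x) * ascProd u (-x) m 1 := by simp only [gammaProd, mul_assoc]
    _ = descProd u x m 1 * (factor u 0 (c * x) * factor u 0 (-(c * x))) * ascProd u (-x) m 1 := by
      rw [h1, mul_neg]; simp only [mul_assoc, one_mul]
    _ = _ := by rw [hu.factor_mul_neg, mul_one, hu.descProd_mul_ascProd]

theorem IsNilCoxeter.gammaProd_commute (hu : IsNilCoxeter u) (c : R) (m : ℕ) (x y : R) :
    Commute (gammaProd u c m x) (gammaProd u c m y) := by
  cases m with
  | zero =>
    simp only [gammaProd, descProd, ascProd, one_mul, mul_one]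
    rw [Commute, SemiconjBy, hu.factor_mul, hu.factor_mul, add_comm]
  | succ m =>
    -- The inner halves commute; the factors in u 0 then pass the letters ≥ 2. Inserting u 1 factors
    -- with parameters -y and -x completes the outer products, leaving a core in u 0 and u 1 that is
    -- symmetric by `yang_baxter_zero_aux`.
    have key : ∀ x y : R, gammaProd u c (m + 1) x * gammaProd u c (m + 1) y =
        descProd u x (m + 1) 1 * descProd u y (m + 1) 1 *
        (factor u 1 (-y) * factor u 0 (c * x) * factor u 1 (x + y) * factor u 0 (c * y) *
          factor u 1 (-x)) * (ascProd u x (m + 1) 1 * ascProd u y (m + 1) 1) := by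
      intro x y
      have h1 : descProd u y (m + 1) 1 * factor u 1 (-y) = descProd u y m 2 := by
        rw [descProd, mul_assoc, hu.factor_mul_neg, mul_one]
      have h2 : factor u 1 (-x) * ascProd u x (m + 1) 1 = ascProd u x m 2 := by
        rw [ascProd, ← mul_assoc, hu.factor_neg_mul, one_mul]
      have h3 := (hu.commute_factor_descProd (show 0 + 2 ≤ 2 by omega) (c * x) y m).eq
      have h4 : factor u 0 (c * y) * ascProd u x m 2 = ascProd u x m 2 * factor u 0 (c * y) := by
        have h := hu.commute_factor_descProd (show 0 + 2 ≤ 2 by omega) (c * y) (-x) m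
        have e1 := hu.ascProd_mul_descProd x m 2
        have e2 := hu.descProd_mul_ascProd (-x) m 2
        rw [neg_neg] at e2
        calc _ = ascProd u x m 2 * (descProd u (-x) m 2 * factor u 0 (c * y)) *
              ascProd u x m 2 := by rw [← mul_assoc, e1, one_mul]
          _ = ascProd u x m 2 * factor u 0 (c * y) * (descProd u (-x) m 2 * ascProd u x m 2) := by
            rw [← h.eq]; simp only [mul_assoc]
          _ = _ := by rw [e2, mul_one]
      have h5 := (hu.descProd_commute_ascProd y x (m + 1) 0).symm.eq
      rw [zero_add] at h5
      calc _ = descProd u x (m + 1) 1 * factor u 0 (c * x) *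
            (ascProd u x (m + 1) 1 * descProd u y (m + 1) 1) * factor u 0 (c * y) *
            ascProd u y (m + 1) 1 := by simp only [gammaProd, mul_assoc]
        _ = descProd u x (m + 1) 1 * (factor u 0 (c * x) * descProd u y m 2) *
            (factor u 1 y * factor u 1 x) * (ascProd u x m 2 * factor u 0 (c * y)) *
            ascProd u y (m + 1) 1 := by
          have d1 : descProd u y (m + 1) 1 = descProd u y m 2 * factor u 1 y := rfl
          have d2 : ascProd u x (m + 1) 1 = factor u 1 x * ascProd u x m 2 := rfl
          rw [h5, d1, d2]; simp only [mul_assoc]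
        _ = _ := by
          rw [h3, ← h4, ← h1, ← h2, hu.factor_mul, add_comm y x]; simp only [mul_assoc]
    have hk : ∀ x y : R, factor u 1 (-y) * factor u 0 (c * x) * factor u 1 (x + y) *
        factor u 0 (c * y) * factor u 1 (-x) = factor u 1 (-x) * factor u 0 (c * y) *
        factor u 1 (y + x) * factor u 0 (c * x) * factor u 1 (-y) := fun x y =>
      yang_baxter_zero_aux (hu.sq _) (hu.sq _) hu.braid_zero c x y
    rw [Commute, SemiconjBy, key x y, key y x, hk,
      (hu.descProd_commute x y (m + 1) 0).eq, (hu.ascProd_commute x y (m + 1) 0).eq]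

end

end SignedPD

namespace SignedPD

/-! ### The nilCoxeter relations for matrices -/

theorem ext_pos {v w : BCInf} (h : ∀ x : ℤ, 0 < x → v.1 x = w.1 x) : v = w := by
  ext x
  rcases lt_trichotomy x 0 with hx | rfl | hx
  · have := h (-x) (by omega)
    rwa [apply_neg_eq, apply_neg_eq, neg_inj] at this
  · rw [map_zero', map_zero']
  · exact h x hx

theorem mul_apply' (v w : BCInf) (x : ℤ) : (v * w).1 x = v.1 (w.1 x) := rfl

theorem gen_zero_apply (x : ℤ) : (gen 0).1 x = if x = 1 then -1 else if x = -1 then 1 else x := by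
  rw [gen_apply]
  unfold rootLo rootHi
  split_ifs <;> omega

theorem gen_succ_apply_pos (i : ℕ) {x : ℤ} (hx : 0 < x) : (gen (i + 1)).1 x =
    if x = (i : ℤ) + 1 then (i : ℤ) + 2 else if x = (i : ℤ) + 2 then (i : ℤ) + 1 else x := by
  rw [gen_apply]
  unfold rootLo rootHi
  push_cast
  split_ifs <;> omega

theorem gen_succ_pos (i : ℕ) {x : ℤ} (hx : 0 < x) : 0 < (gen (i + 1)).1 x := by
  rw [gen_succ_apply_pos i hx]
  split_ifs <;> omega

theorem gen_comm {i j : ℕ} (h : i + 2 ≤ j) : gen i * gen j = gen j * gen i := by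
  refine ext_pos fun x hx => ?_
  obtain ⟨j, rfl⟩ : ∃ k, j = k + 1 := ⟨j - 1, by omega⟩
  cases i with
  | zero =>
    rw [mul_apply', mul_apply', gen_zero_apply, gen_zero_apply]
    have := gen_succ_apply_pos j hx
    have h1 := gen_succ_apply_pos j one_pos
    have h2 := apply_neg_eq (gen (j + 1)) 1
    split_ifs at * <;> omega
  | succ i =>
    rw [mul_apply', mul_apply', gen_succ_apply_pos _ (gen_succ_pos _ hx),
      gen_succ_apply_pos _ (gen_succ_pos _ hx), gen_succ_apply_pos _ hx, gen_succ_apply_pos _ hx]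
    split_ifs <;> omega

theorem gen_braid (i : ℕ) :
    gen (i + 1) * gen (i + 2) * gen (i + 1) = gen (i + 2) * gen (i + 1) * gen (i + 2) := by
  refine ext_pos fun x hx => ?_
  have h1 : ∀ y : ℤ, 0 < y → (gen (i + 1)).1 y = _ := fun y => gen_succ_apply_pos i
  have h2 : ∀ y : ℤ, 0 < y → (gen (i + 2)).1 y = _ := fun y => gen_succ_apply_pos (i + 1)
  push_cast at h2
  have a1 : (gen (i + 1)).1 (i + 1) = i + 2 := by rw [h1 _ (by omega)]; split_ifs <;> omega
  have a2 : (gen (i + 1)).1 (i + 2) = i + 1 := by rw [h1 _ (by omega)]; split_ifs <;> omega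
  have a3 : (gen (i + 1)).1 (i + 3) = i + 3 := by rw [h1 _ (by omega)]; split_ifs <;> omega
  have b1 : (gen (i + 2)).1 (i + 1) = i + 1 := by rw [h2 _ (by omega)]; split_ifs <;> omega
  have b2 : (gen (i + 2)).1 (i + 2) = i + 3 := by rw [h2 _ (by omega)]; split_ifs <;> omega
  have b3 : (gen (i + 2)).1 (i + 3) = i + 2 := by rw [h2 _ (by omega)]; split_ifs <;> omega
  simp only [mul_apply']
  by_cases x1 : x = i + 1
  · subst x1; simp only [a1, a3, b1, b2]
  by_cases x2 : x = i + 2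
  · subst x2; simp only [a1, a2, b1, b2, b3, a3]
  by_cases x3 : x = i + 3
  · subst x3; simp only [a2, a3, b1, b3]
  have e0 : (gen (i + 1)).1 x = x := by rw [h1 _ hx]; split_ifs <;> omega
  have e1 : (gen (i + 2)).1 x = x := by rw [h2 _ hx]; split_ifs <;> omega
  simp only [e0, e1]

theorem gen_one_apply (x : ℤ) : (gen 1).1 x = if x = 1 then 2 else if x = 2 then 1 else
    if x = -1 then -2 else if x = -2 then -1 else x := by
  rw [gen_apply]
  unfold rootLo rootHi
  push_cast
  split_ifs <;> omega

theorem gen_braid_zero : gen 0 * gen 1 * gen 0 * gen 1 = gen 1 * gen 0 * gen 1 * gen 0 := by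
  refine ext_pos fun x hx => ?_
  simp only [mul_apply']
  by_cases h1 : x = 1
  · subst h1; simp [gen_zero_apply, gen_one_apply]
  by_cases h2 : x = 2
  · subst h2; simp [gen_zero_apply, gen_one_apply]
  have e0 : (gen 0).1 x = x := by rw [gen_zero_apply]; split_ifs <;> omega
  have e1 : (gen 1).1 x = x := by rw [gen_one_apply]; split_ifs <;> omega
  simp only [e0, e1]

noncomputable instance (n : ℕ) : Fintype (BC n) := @Fintype.ofFinite _ (finite_BC n)

noncomputable instance (n : ℕ) : DecidableEq (BC n) := Classical.decEq _

/-! ### The regular representation of the nilCoxeter algebra by matrices -/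

section

open Classical in
/-- The matrix of right multiplication by the `i`-th generator of the nilCoxeter algebra. -/
noncomputable def nilMat (R : Type*) [CommRing R] (n i : ℕ) : Matrix (BC n) (BC n) R :=
  Matrix.of fun v w => if v.1 = w.1 * gen i ∧ IsDescent w.1 i then 1 else 0

variable {R : Type*} [CommRing R] {n : ℕ}

open Classical in
theorem mul_nilMat_apply (M : Matrix (BC n) (BC n) R) (i : ℕ) (v w : BC n) :
    (M * nilMat R n i) v w =
      if h : IsDescent w.1 i then M v ⟨w.1 * gen i, mul_gen_mem_BC w.2 h⟩ else 0 := by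
  rw [Matrix.mul_apply]
  split_ifs with h
  · rw [Finset.sum_eq_single ⟨w.1 * gen i, mul_gen_mem_BC w.2 h⟩]
    · simp [nilMat, h]
    · intro x _ hx
      have : x.1 ≠ w.1 * gen i := fun hc => hx (Subtype.ext hc)
      simp [nilMat, this]
    · simp
  · exact Finset.sum_eq_zero fun x _ => by simp [nilMat, h]

-- The product sends v to v times the element of the word when the lengths add up, and to 0
-- otherwise. It thus depends only on that element and the number of letters, so group relations
-- between words of equal length pass to the matrices.
open Classical in
theorem prod_nilMat_apply (a : List ℕ) (v w : BC n) :
    (a.map (nilMat R n)).prod v w =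
      if v.1 * wordProd a = w.1 ∧ len v.1 + a.length = len w.1 then 1 else 0 := by
  induction a using List.reverseRecOn generalizing w with
  | nil =>
    simp only [List.map_nil, List.prod_nil, Matrix.one_apply, wordProd, mul_one, List.length_nil,
      add_zero]
    refine if_congr ⟨?_, fun h => Subtype.ext h.1⟩ rfl rfl
    rintro rfl
    exact ⟨rfl, rfl⟩
  | append_singleton a i ih =>
    rw [List.map_append, List.prod_append, List.map_singleton, List.prod_singleton,
      mul_nilMat_apply, wordProd_concat, List.length_append, List.length_singleton, ← mul_assoc]
    split_ifs with h h' h'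
    · rw [ih, if_pos]
      have := len_mul_gen_of_isDescent h
      refine ⟨?_, by simp only; omega⟩
      simp only
      rw [← h'.1, mul_gen_gen]
    · rw [ih, if_neg]
      rintro ⟨h1, h2⟩
      have := len_mul_gen_of_isDescent h
      simp only at h1 h2
      refine h' ⟨by rw [h1, mul_gen_gen], by omega⟩
    · exfalso
      apply h
      rw [← len_mul_gen_lt_iff, ← h'.1, mul_gen_gen, h'.1, ← h'.2]
      have := len_mul_le v.1 (wordProd a)
      have := len_le_length a
      omega
    · rfl

open Classical in
theorem prod_nilMat_one_apply (a : List ℕ) (w : BC n) :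
    (a.map (nilMat R n)).prod 1 w = if a ∈ reducedWords w.1 then 1 else 0 := by
  rw [prod_nilMat_apply]
  refine if_congr ?_ rfl rfl
  simp [reducedWords, len_one]

theorem prod_nilMat_congr {a b : List ℕ} (h : wordProd a = wordProd b)
    (hl : a.length = b.length) : (a.map (nilMat R n)).prod = (b.map (nilMat R n)).prod := by
  ext v w
  rw [prod_nilMat_apply, prod_nilMat_apply, h, hl]

theorem nilMat_isNilCoxeter : IsNilCoxeter (nilMat R n) where
  sq i := by
    ext v w
    have := prod_nilMat_apply (R := R) [i, i] v w
    simp only [List.map_cons, List.map_nil, List.prod_cons, List.prod_nil, mul_one] at this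
    rw [this, if_neg, Matrix.zero_apply]
    simp only [wordProd, List.map_cons, List.map_nil, List.prod_cons, List.prod_nil, mul_one,
      gen_mul_self, List.length_cons, List.length_nil]
    rintro ⟨h, h'⟩
    rw [h] at h'
    omega
  comm i j h := by
    have := prod_nilMat_congr (R := R) (n := n) (a := [i, j]) (b := [j, i])
      (by simp [wordProd, gen_comm h]) rfl
    simpa [Commute, SemiconjBy] using this
  braid i := by
    have := prod_nilMat_congr (R := R) (n := n) (a := [i + 1, i + 2, i + 1])
      (b := [i + 2, i + 1, i + 2]) (by simpa [wordProd, mul_assoc] using gen_braid i) rfl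
    simpa [mul_assoc] using this
  braid_zero := by
    have := prod_nilMat_congr (R := R) (n := n) (a := [0, 1, 0, 1])
      (b := [1, 0, 1, 0]) (by simpa [wordProd, mul_assoc] using gen_braid_zero) rfl
    simpa [mul_assoc] using this

theorem nilMat_eq_zero {i : ℕ} (hi : n ≤ i) : nilMat R n i = 0 := by
  ext v w
  simp only [nilMat, Matrix.of_apply, Matrix.zero_apply, ite_eq_right_iff]
  rintro ⟨-, h⟩
  exact absurd (lt_of_isDescent w.2 h) (by omega)

theorem nilMat_map {S : Type*} [CommRing S] (φ : R →+* S) (i : ℕ) :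
    φ.mapMatrix (nilMat R n i) = nilMat S n i := by
  ext v w
  simp [nilMat, apply_ite φ]

/-! ### Length-raising matrices -/

/-- The entries of `M` are supported where the length increases. -/
def IsRaising (M : Matrix (BC n) (BC n) R) : Prop :=
  ∀ v w, M v w ≠ 0 → len v.1 < len w.1

theorem isRaising_nilMat (i : ℕ) : IsRaising (nilMat R n i) := by
  intro v w h
  simp only [nilMat, Matrix.of_apply, ne_eq, ite_eq_right_iff, Classical.not_imp] at h
  rw [h.1.1]
  exact (len_mul_gen_lt_iff _ _).2 h.1.2

theorem IsRaising.add {M N : Matrix (BC n) (BC n) R} (hM : IsRaising M) (hN : IsRaising N) :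
    IsRaising (M + N) := by
  intro v w h
  by_contra hc
  exact h (by rw [Matrix.add_apply, not_not.1 (mt (hM v w) hc), not_not.1 (mt (hN v w) hc),
    add_zero])

theorem isRaising_zero : IsRaising (0 : Matrix (BC n) (BC n) R) := fun _ _ h => absurd rfl h

theorem IsRaising.smul {M : Matrix (BC n) (BC n) R} (hM : IsRaising M) (c : R) :
    IsRaising (c • M) := by
  intro v w h
  by_contra hc
  exact h (by rw [Matrix.smul_apply, not_not.1 (mt (hM v w) hc), smul_zero])

theorem IsRaising.sum {ι : Type*} (s : Finset ι) (f : ι → Matrix (BC n) (BC n) R)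
    (h : ∀ i ∈ s, IsRaising (f i)) : IsRaising (∑ i ∈ s, f i) := by
  classical
  induction s using Finset.induction_on with
  | empty => exact isRaising_zero
  | insert i s hi ih =>
    rw [Finset.sum_insert hi]
    exact (h i (by simp)).add (ih fun j hj => h j (by simp [hj]))

theorem IsRaising.mul {M N : Matrix (BC n) (BC n) R} (hM : IsRaising M) (hN : IsRaising N) :
    IsRaising (M * N) := by
  intro v w h
  obtain ⟨x, -, hx⟩ := Finset.exists_ne_zero_of_sum_ne_zero h
  exact (hM v x (left_ne_zero_of_mul hx)).trans (hN x w (right_ne_zero_of_mul hx))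

theorem IsRaising.map {S : Type*} [CommRing S] {M : Matrix (BC n) (BC n) R} (hM : IsRaising M)
    {f : R → S} (hf : f 0 = 0) : IsRaising (M.map f) := by
  intro v w h
  by_contra hc
  exact h (by rw [Matrix.map_apply, not_not.1 (mt (hM v w) hc), hf])

/-- The j-th power raises the length by at least j, while the length is bounded on `BC n`.
Nilpotency makes the exponential of the logarithm a finite sum. -/
theorem IsRaising.isNilpotent {M : Matrix (BC n) (BC n) R} (hM : IsRaising M) :
    IsNilpotent M := by
  have key : ∀ j : ℕ, ∀ v w, (M ^ j) v w ≠ 0 → len v.1 + j ≤ len w.1 := by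
    intro j
    induction j with
    | zero =>
      intro v w h
      rw [pow_zero, Matrix.one_apply] at h
      rw [(ite_ne_right_iff.1 h).1, add_zero]
    | succ j ih =>
      intro v w h
      rw [pow_succ] at h
      obtain ⟨x, -, hx⟩ := Finset.exists_ne_zero_of_sum_ne_zero h
      have h1 := ih v x (left_ne_zero_of_mul hx)
      have h2 := hM x w (right_ne_zero_of_mul hx)
      omega
  refine ⟨2 * (n * (n * n)) + 1, ?_⟩
  ext v w
  by_contra h
  have h1 := key _ v w h
  have h2 := len_le_of_mem_BC w.2
  omega

/-- `M` is the identity plus a length-raising matrix. -/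
def IsUnipotent (M : Matrix (BC n) (BC n) R) : Prop := IsRaising (M - 1)

theorem isUnipotent_one : IsUnipotent (1 : Matrix (BC n) (BC n) R) := by
  unfold IsUnipotent
  rw [sub_self]
  exact isRaising_zero

theorem IsUnipotent.mul {M N : Matrix (BC n) (BC n) R} (hM : IsUnipotent M)
    (hN : IsUnipotent N) : IsUnipotent (M * N) := by
  unfold IsUnipotent at *
  have : M * N - 1 = (M - 1) + (N - 1) + (M - 1) * (N - 1) := by noncomm_ring
  rw [this]
  exact (hM.add hN).add (hM.mul hN)

theorem isUnipotent_factor (i : ℕ) (c : R) : IsUnipotent (factor (nilMat R n) i c) := by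
  unfold IsUnipotent factor
  rw [add_sub_cancel_left]
  exact (isRaising_nilMat i).smul c

theorem isUnipotent_descProd (x : R) (m i : ℕ) : IsUnipotent (descProd (nilMat R n) x m i) := by
  induction m generalizing i with
  | zero => exact isUnipotent_one
  | succ m ih => exact (ih _).mul (isUnipotent_factor _ _)

theorem isUnipotent_ascProd (x : R) (m i : ℕ) : IsUnipotent (ascProd (nilMat R n) x m i) := by
  induction m generalizing i with
  | zero => exact isUnipotent_one
  | succ m ih => exact (isUnipotent_factor _ _).mul (ih _)

theorem isUnipotent_gammaProd (c : R) (m : ℕ) (x : R) :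
    IsUnipotent (gammaProd (nilMat R n) c m x) :=
  ((isUnipotent_descProd _ _ _).mul (isUnipotent_factor _ _)).mul (isUnipotent_ascProd _ _ _)

end

/-! ### Base change and evaluation at zero -/

section

variable {R S B B' : Type*} [CommRing R] [CommRing S] [Ring B] [Ring B'] [Algebra R B]
  [Algebra S B'] {u : ℕ → B} {u' : ℕ → B'} {φ : R →+* S} {Φ : B →+* B'}

theorem map_factor (h : ∀ c i, Φ (c • u i) = φ c • u' i) (i : ℕ) (c : R) :
    Φ (factor u i c) = factor u' i (φ c) := by
  simp [factor, h]

theorem map_descProd (h : ∀ c i, Φ (c • u i) = φ c • u' i) (x : R) (m i : ℕ) :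
    Φ (descProd u x m i) = descProd u' (φ x) m i := by
  induction m generalizing i with
  | zero => simp [descProd]
  | succ m ih => rw [descProd, map_mul, ih, map_factor h, descProd]

theorem map_ascProd (h : ∀ c i, Φ (c • u i) = φ c • u' i) (x : R) (m i : ℕ) :
    Φ (ascProd u x m i) = ascProd u' (φ x) m i := by
  induction m generalizing i with
  | zero => simp [ascProd]
  | succ m ih => rw [ascProd, map_mul, ih, map_factor h, ascProd]

theorem map_gammaProd (h : ∀ c i, Φ (c • u i) = φ c • u' i) (c : R) (m : ℕ) (x : R) :
    Φ (gammaProd u c m x) = gammaProd u' (φ c) m (φ x) := by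
  rw [gammaProd, map_mul, map_mul, map_descProd h, map_factor h, map_ascProd h, map_mul φ,
    gammaProd]

theorem descProd_zero (m i : ℕ) : descProd u (0 : R) m i = 1 := by
  induction m generalizing i with
  | zero => rfl
  | succ m ih => rw [descProd, ih, factor_zero, mul_one]

theorem ascProd_zero (m i : ℕ) : ascProd u (0 : R) m i = 1 := by
  induction m generalizing i with
  | zero => rfl
  | succ m ih => rw [ascProd, ih, factor_zero, mul_one]

theorem gammaProd_zero (c : R) (m : ℕ) : gammaProd u c m (0 : R) = 1 := by
  rw [gammaProd, descProd_zero, ascProd_zero, mul_zero, factor_zero, mul_one, mul_one]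

theorem nilMat_smul_map {n : ℕ} (φ : R →+* S) (c : R) (i : ℕ) :
    φ.mapMatrix (c • nilMat R n i) = φ c • nilMat S n i := by
  rw [← nilMat_map φ]
  ext v w
  simp

end

end SignedPD

namespace SignedPD

/-! ### The logarithm of the generating function of a Gamma-block -/

open Polynomial

section

variable {ι : Type*}

/-- The entrywise derivative of a matrix of polynomials. -/
noncomputable def matDeriv (M : Matrix ι ι ℚ[X]) : Matrix ι ι ℚ[X] := M.map derivative

/-- The matrix of coefficients of `X ^ i`. -/
noncomputable def matCoeff (M : Matrix ι ι ℚ[X]) (i : ℕ) : Matrix ι ι ℚ :=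
  M.map fun p => p.coeff i

theorem matDeriv_add (M N : Matrix ι ι ℚ[X]) : matDeriv (M + N) = matDeriv M + matDeriv N := by
  ext1 v w
  simp [matDeriv]

theorem matDeriv_smul (c : ℚ) (M : Matrix ι ι ℚ[X]) : matDeriv (c • M) = c • matDeriv M := by
  ext1 v w
  simp [matDeriv]

theorem matDeriv_sum {κ : Type*} (s : Finset κ) (f : κ → Matrix ι ι ℚ[X]) :
    matDeriv (∑ i ∈ s, f i) = ∑ i ∈ s, matDeriv (f i) := by
  ext1 v w
  simp [matDeriv, Matrix.sum_apply]

theorem matCoeff_ext {M N : Matrix ι ι ℚ[X]} (h : ∀ i, matCoeff M i = matCoeff N i) : M = N := by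
  ext v w i
  exact congr_fun (congr_fun (h i) v) w

theorem matCoeff_matDeriv (M : Matrix ι ι ℚ[X]) (i : ℕ) :
    matCoeff (matDeriv M) i = ((i : ℚ) + 1) • matCoeff M (i + 1) := by
  ext v w
  simp [matCoeff, matDeriv, coeff_derivative, mul_comm]

theorem eq_sum_matCoeff {M : Matrix ι ι ℚ[X]} {d : ℕ} (hd : ∀ v w, (M v w).natDegree < d) :
    M = ∑ i ∈ Finset.range d, (X ^ i : ℚ[X]) • (matCoeff M i).map C := by
  ext1 v w
  rw [Matrix.sum_apply]
  conv_lhs => rw [(M v w).as_sum_range' d (hd v w)]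
  refine Finset.sum_congr rfl fun i _ => ?_
  rw [← C_mul_X_pow_eq_monomial, mul_comm]
  rfl

variable [Fintype ι]

theorem matDeriv_one {ι : Type*} [DecidableEq ι] : matDeriv (1 : Matrix ι ι ℚ[X]) = 0 := by
  ext1 v w
  simp [matDeriv, Matrix.one_apply, apply_ite derivative]

theorem matDeriv_mul (M N : Matrix ι ι ℚ[X]) :
    matDeriv (M * N) = matDeriv M * N + M * matDeriv N := by
  ext1 v w
  simp [matDeriv, Matrix.mul_apply, Finset.sum_add_distrib]

theorem matCoeff_mul_map_C (M : Matrix ι ι ℚ[X]) (T : Matrix ι ι ℚ) (i : ℕ) :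
    matCoeff (M * T.map C) i = matCoeff M i * T := by
  ext v w
  simp [matCoeff, Matrix.mul_apply]

theorem matCoeff_map_C_mul (M : Matrix ι ι ℚ[X]) (T : Matrix ι ι ℚ) (i : ℕ) :
    matCoeff (T.map C * M) i = T * matCoeff M i := by
  ext v w
  simp [matCoeff, Matrix.mul_apply]

theorem commute_map_C_iff {M : Matrix ι ι ℚ[X]} {T : Matrix ι ι ℚ} :
    Commute (T.map C) M ↔ ∀ i, Commute T (matCoeff M i) := by
  constructor
  · intro h i
    rw [Commute, SemiconjBy, ← matCoeff_map_C_mul, ← matCoeff_mul_map_C, h.eq]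
  · intro h
    refine matCoeff_ext fun i => ?_
    rw [matCoeff_map_C_mul, matCoeff_mul_map_C, (h i).eq]

theorem exists_natDegree_lt (M : Matrix ι ι ℚ[X]) : ∃ d, ∀ v w, (M v w).natDegree < d := by
  refine ⟨(Finset.univ.sup fun p : ι × ι => (M p.1 p.2).natDegree) + 1, fun v w => ?_⟩
  exact Nat.lt_succ_of_le
    (Finset.le_sup (f := fun p : ι × ι => (M p.1 p.2).natDegree) (Finset.mem_univ (v, w)))

theorem commute_of_matCoeff {M N : Matrix ι ι ℚ[X]}
    (h : ∀ i, Commute M ((matCoeff N i).map C)) : Commute M N := by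
  obtain ⟨d, hd⟩ := exists_natDegree_lt N
  rw [eq_sum_matCoeff hd]
  exact Commute.sum_right _ _ _ fun i _ => (h i).smul_right _

theorem commute_of_commute_matCoeff {M N : Matrix ι ι ℚ[X]}
    (h : ∀ i j, Commute (matCoeff M i) (matCoeff N j)) : Commute M N :=
  commute_of_matCoeff fun j => (commute_map_C_iff.2 fun i => (h i j).symm).symm

variable [DecidableEq ι]

theorem matDeriv_pow {L : Matrix ι ι ℚ[X]} (h : Commute (matDeriv L) L) (i : ℕ) :
    matDeriv (L ^ (i + 1)) = ((i : ℚ) + 1) • (matDeriv L * L ^ i) := by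
  induction i with
  | zero => simp
  | succ i ih =>
    rw [pow_succ, matDeriv_mul, ih, ← (h.pow_right (i + 1)).eq, smul_mul_assoc, mul_assoc,
      ← pow_succ]
    push_cast
    module

/-- Termwise differentiation; commuting of L with its derivative is what gives the powers of L their
scalar derivative rule. -/
theorem matDeriv_exp {L : Matrix ι ι ℚ[X]} (h : Commute (matDeriv L) L) (hL : IsNilpotent L) :
    matDeriv (IsNilpotent.exp L) = matDeriv L * IsNilpotent.exp L := by
  obtain ⟨k, hk⟩ := hL
  -- One extra vanishing term, since differentiation lowers the exponents by one.
  conv_lhs => rw [IsNilpotent.exp_eq_sum (k := k + 1) (by rw [pow_succ, hk, zero_mul])]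
  rw [IsNilpotent.exp_eq_sum hk, Finset.sum_range_succ', matDeriv_add, matDeriv_sum, pow_zero,
    matDeriv_smul, matDeriv_one, smul_zero, add_zero, Finset.mul_sum]
  refine Finset.sum_congr rfl fun i _ => ?_
  rw [matDeriv_smul, matDeriv_pow h, smul_smul, mul_smul_comm, Nat.factorial_succ]
  congr 1
  push_cast
  have : ((i : ℚ) + 1) ≠ 0 := by positivity
  have : (i.factorial : ℚ) ≠ 0 := by positivity
  field_simp

theorem commute_exp_right {A : Type*} [Ring A] [Algebra ℚ A] {a b : A} (h : Commute a b)
    (hb : IsNilpotent b) : Commute a (IsNilpotent.exp b) := by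
  obtain ⟨k, hk⟩ := hb
  rw [IsNilpotent.exp_eq_sum hk]
  exact Commute.sum_right _ _ _ fun i _ => (h.pow_right i).smul_right _

theorem eq_of_matDeriv_eq_zero {M : Matrix ι ι ℚ[X]} (h : matDeriv M = 0)
    (h0 : (evalRingHom (0 : ℚ)).mapMatrix M = 1) : M = 1 := by
  ext1 v w
  have h1 : derivative (M v w) = 0 := congr_fun (congr_fun h v) w
  have h2 : eval 0 (M v w) = (1 : Matrix ι ι ℚ) v w := congr_fun (congr_fun h0 v) w
  rw [eq_C_of_derivative_eq_zero h1] at h2 ⊢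
  rw [eval_C] at h2
  rw [h2, Matrix.one_apply, Matrix.one_apply]
  split_ifs <;> simp

end

/-! ### The factor of a Γ-block as the exponential of an odd polynomial with commuting coefficients
-/

section

variable (n m : ℕ)

/-- The generating function of a Gamma-block with formal parameter. -/
noncomputable def gammaX : Matrix (BC n) (BC n) ℚ[X] := gammaProd (nilMat ℚ[X] n) 2 m (X : ℚ[X])

/-- The generating function of a Gamma-block at `-X`. -/
noncomputable def gammaNegX : Matrix (BC n) (BC n) ℚ[X] := gammaProd (nilMat ℚ[X] n) 2 m (-X : ℚ[X])

/-- The logarithmic derivative of the generating function of a Gamma-block. -/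
noncomputable def gammaLogDeriv : Matrix (BC n) (BC n) ℚ[X] :=
  matDeriv (gammaX n m) * gammaNegX n m

/-- The coefficients of the logarithm of the generating function of a Gamma-block. -/
noncomputable def gammaLogCoeff (j : ℕ) : Matrix (BC n) (BC n) ℚ :=
  ((2 * j + 1 : ℚ)⁻¹) • matCoeff (gammaLogDeriv n m) (2 * j)

variable {n m}

theorem gammaX_mul_gammaNegX : gammaX n m * gammaNegX n m = 1 :=
  nilMat_isNilCoxeter.gammaProd_mul_neg _ _ _

theorem gammaNegX_mul_gammaX : gammaNegX n m * gammaX n m = 1 := by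
  have := (nilMat_isNilCoxeter (R := ℚ[X]) (n := n)).gammaProd_mul_neg 2 m (-X : ℚ[X])
  rwa [neg_neg] at this

theorem map_gammaProd_nilMat {R S : Type*} [CommRing R] [CommRing S] (φ : R →+* S) (c x : R) :
    φ.mapMatrix (gammaProd (nilMat R n) c m x) = gammaProd (nilMat S n) (φ c) m (φ x) :=
  map_gammaProd (fun c i => nilMat_smul_map φ c i) c m x

/-- γ(X) commutes with γ(t) for each rational t. Comparing coefficients of X makes each coefficient
commute with all γ(t); as polynomials over ℚ are determined by their values, it commutes with γ(X),
and coefficients are compared again. -/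
theorem commute_matCoeff_gammaX (i j : ℕ) :
    Commute (matCoeff (gammaX n m) i) (matCoeff (gammaX n m) j) := by
  have h1 : ∀ t : ℚ, Commute (matCoeff (gammaX n m) i) (gammaProd (nilMat ℚ n) 2 m t) := by
    intro t
    have e : (gammaProd (nilMat ℚ n) 2 m t).map C = gammaProd (nilMat ℚ[X] n) 2 m (C t) := by
      have := map_gammaProd_nilMat (n := n) (m := m) (C : ℚ →+* ℚ[X]) 2 t
      rwa [map_ofNat] at this
    refine (commute_map_C_iff.1 ?_ i).symm
    rw [e]
    exact nilMat_isNilCoxeter.gammaProd_commute _ _ _ _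
  refine commute_map_C_iff.1 ?_ j
  set T := matCoeff (gammaX n m) i
  ext1 v w
  refine Polynomial.funext fun t => ?_
  have e : (evalRingHom t).mapMatrix (gammaX n m) = gammaProd (nilMat ℚ n) 2 m t := by
    have := map_gammaProd_nilMat (n := n) (m := m) (evalRingHom t) 2 X
    rw [map_ofNat] at this
    simpa [gammaX] using this
  have e2 : (evalRingHom t).mapMatrix (T.map C) = T := by
    ext v w
    simp
  have key : (evalRingHom t).mapMatrix (T.map C * gammaX n m) =
      (evalRingHom t).mapMatrix (gammaX n m * T.map C) := by
    rw [map_mul, map_mul, e, e2, (h1 t).eq]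
  exact congr_fun (congr_fun key v) w

/-- Whatever commutes with γ(X) coefficientwise commutes with its derivative and its inverse γ(-X),
hence with the logarithmic derivative. -/
theorem commute_gammaLogCoeff_of_commute {T : Matrix (BC n) (BC n) ℚ}
    (h : ∀ i, Commute T (matCoeff (gammaX n m) i)) (j : ℕ) :
    Commute T (gammaLogCoeff n m j) := by
  have h1 : Commute (T.map C) (gammaX n m) := commute_map_C_iff.2 h
  have h2 : Commute (T.map C) (gammaNegX n m) := by
    have e1 := gammaX_mul_gammaNegX (n := n) (m := m)
    have e2 := gammaNegX_mul_gammaX (n := n) (m := m)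
    calc _ = gammaNegX n m * gammaX n m * T.map C * gammaNegX n m := by rw [e2, one_mul]
      _ = gammaNegX n m * (T.map C * gammaX n m) * gammaNegX n m := by
        rw [h1.eq]; simp only [mul_assoc]
      _ = gammaNegX n m * T.map C * (gammaX n m * gammaNegX n m) := by simp only [mul_assoc]
      _ = _ := by rw [e1, mul_one]
  have h3 : Commute (T.map C) (matDeriv (gammaX n m)) := commute_map_C_iff.2 fun i => by
    rw [matCoeff_matDeriv]
    exact (h _).smul_right _
  exact (commute_map_C_iff.1 (h3.mul_right h2) _).smul_right _

theorem commute_gammaLogCoeff (i j : ℕ) :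
    Commute (gammaLogCoeff n m i) (gammaLogCoeff n m j) :=
  commute_gammaLogCoeff_of_commute (fun k =>
    (commute_gammaLogCoeff_of_commute (fun l => commute_matCoeff_gammaX k l) i).symm) j

/-- The substitution `X ↦ -X` in a matrix. -/
noncomputable def matNeg : Matrix (BC n) (BC n) ℚ[X] →+* Matrix (BC n) (BC n) ℚ[X] :=
  (compRingHom (-X : ℚ[X])).mapMatrix

theorem matNeg_gammaX : matNeg (gammaX n m) = gammaNegX n m := by
  have := map_gammaProd_nilMat (n := n) (m := m) (compRingHom (-X : ℚ[X])) 2 X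
  rw [map_ofNat] at this
  simpa [gammaX, gammaNegX, matNeg] using this

theorem matNeg_gammaNegX : matNeg (gammaNegX n m) = gammaX n m := by
  have := map_gammaProd_nilMat (n := n) (m := m) (compRingHom (-X : ℚ[X])) 2 (-X)
  rw [map_ofNat] at this
  simpa [gammaX, gammaNegX, matNeg] using this

theorem matDeriv_matNeg (M : Matrix (BC n) (BC n) ℚ[X]) :
    matDeriv (matNeg M) = -matNeg (matDeriv M) := by
  ext1 v w
  simp [matDeriv, matNeg, derivative_comp]

theorem matDeriv_gammaNegX : matDeriv (gammaNegX n m) = -matNeg (matDeriv (gammaX n m)) := by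
  rw [← matNeg_gammaX, matDeriv_matNeg]

theorem matCoeff_matNeg (M : Matrix (BC n) (BC n) ℚ[X]) (i : ℕ) :
    matCoeff (matNeg M) i = (-1 : ℚ) ^ i • matCoeff M i := by
  ext v w
  have h := comp_C_mul_X_coeff (p := M v w) (r := (-1 : ℚ)) (n := i)
  rw [C_neg, C_1, neg_one_mul] at h
  simp [matCoeff, matNeg, h, mul_comm]

/-- Differentiating γ(X) γ(-X) = 1 shows that the logarithmic derivative is even. So the logarithm
is odd, and only odd power sums occur. -/
theorem matNeg_gammaLogDeriv : matNeg (gammaLogDeriv n m) = gammaLogDeriv n m := by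
  have h1 : Commute (gammaX n m) (matNeg (matDeriv (gammaX n m))) := by
    refine commute_of_commute_matCoeff fun i j => ?_
    rw [matCoeff_matNeg, matCoeff_matDeriv]
    exact ((commute_matCoeff_gammaX _ _).smul_right _).smul_right _
  have h2 := congr_arg matDeriv (gammaX_mul_gammaNegX (n := n) (m := m))
  rw [matDeriv_mul, matDeriv_one, matDeriv_gammaNegX, mul_neg, add_neg_eq_zero] at h2
  rw [gammaLogDeriv, map_mul, matNeg_gammaNegX, h2, h1.eq]

/-- γ(X) is 1 plus a raising matrix, and the derivative kills the 1. -/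
theorem isRaising_gammaLogCoeff (j : ℕ) : IsRaising (gammaLogCoeff n m j) := by
  refine IsRaising.smul ?_ _
  refine IsRaising.map ?_ (by simp)
  have h1 : IsUnipotent (gammaX n m) := isUnipotent_gammaProd _ _ _
  have h2 : IsUnipotent (gammaNegX n m) := isUnipotent_gammaProd _ _ _
  have h3 : IsRaising (matDeriv (gammaX n m)) := by
    have e : matDeriv (gammaX n m) = matDeriv (gammaX n m - 1) := by
      conv_lhs => rw [← sub_add_cancel (gammaX n m) 1]
      rw [matDeriv_add, matDeriv_one, add_zero]
    rw [e]
    exact IsRaising.map h1 (by simp)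
  have e : gammaLogDeriv n m =
      matDeriv (gammaX n m) + matDeriv (gammaX n m) * (gammaNegX n m - 1) := by
    rw [gammaLogDeriv]; noncomm_ring
  rw [e]
  exact h3.add (h3.mul h2)

/-- The matrix `∑ t_j e_j`, where `e_j` are the coefficients of the logarithm. -/
noncomputable def gammaLog (n m : ℕ) {R : Type*} [CommRing R] [Algebra ℚ R] (J : ℕ) (t : ℕ → R) :
    Matrix (BC n) (BC n) R :=
  ∑ j ∈ Finset.range J, t j • (gammaLogCoeff n m j).map (algebraMap ℚ R)

section

variable {R S : Type*} [CommRing R] [Algebra ℚ R] [CommRing S] [Algebra ℚ S]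

theorem isRaising_gammaLog (J : ℕ) (t : ℕ → R) : IsRaising (gammaLog n m J t) :=
  IsRaising.sum _ _ fun j _ => ((isRaising_gammaLogCoeff j).map (map_zero _)).smul _

theorem isNilpotent_gammaLog (J : ℕ) (t : ℕ → R) : IsNilpotent (gammaLog n m J t) :=
  (isRaising_gammaLog J t).isNilpotent

theorem commute_gammaLog (J : ℕ) (s t : ℕ → R) :
    Commute (gammaLog n m J s) (gammaLog n m J t) := by
  refine Commute.sum_left _ _ _ fun i _ => Commute.sum_right _ _ _ fun j _ => ?_
  exact (((commute_gammaLogCoeff i j).map (algebraMap ℚ R).mapMatrix).smul_left _).smul_right _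

theorem map_gammaLog (φ : R →ₐ[ℚ] S) (J : ℕ) (t : ℕ → R) :
    φ.toRingHom.mapMatrix (gammaLog n m J t) = gammaLog n m J fun j => φ (t j) := by
  simp only [gammaLog, map_sum]
  refine Finset.sum_congr rfl fun j _ => ?_
  ext v w
  simp

theorem gammaLog_add (J : ℕ) (s t : ℕ → R) :
    gammaLog n m J (fun j => s j + t j) = gammaLog n m J s + gammaLog n m J t := by
  simp only [gammaLog, add_smul, Finset.sum_add_distrib]

theorem gammaLog_zero (J : ℕ) : gammaLog n m J (fun _ => (0 : R)) = 0 := by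
  simp [gammaLog]

theorem exp_gammaLog_add (J : ℕ) (s t : ℕ → R) :
    IsNilpotent.exp (gammaLog n m J fun j => s j + t j) =
      IsNilpotent.exp (gammaLog n m J s) * IsNilpotent.exp (gammaLog n m J t) := by
  rw [gammaLog_add, IsNilpotent.exp_add_of_commute (commute_gammaLog J s t)
    (isNilpotent_gammaLog J s) (isNilpotent_gammaLog J t)]

theorem map_exp_gammaLog (φ : R →ₐ[ℚ] S) (J : ℕ) (t : ℕ → R) :
    φ.toRingHom.mapMatrix (IsNilpotent.exp (gammaLog n m J t)) =
      IsNilpotent.exp (gammaLog n m J fun j => φ (t j)) := by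
  rw [IsNilpotent.map_exp (isNilpotent_gammaLog J t), map_gammaLog]

end

/-- With L the termwise integral of γ'(X) γ(-X), the matrix exp(L) γ(-X) has derivative 0 and value
1 at X = 0, so it is 1. Any J above the degree of the logarithmic derivative suffices. -/
theorem exists_exp_gammaLog_X (n m : ℕ) :
    ∃ J, IsNilpotent.exp (gammaLog n m J fun j => (X : ℚ[X]) ^ (2 * j + 1)) = gammaX n m := by
  obtain ⟨J, hJ⟩ := exists_natDegree_lt (gammaLogDeriv n m)
  refine ⟨J, ?_⟩
  set L := gammaLog n m J fun j => (X : ℚ[X]) ^ (2 * j + 1) with hLdef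
  have hL : IsNilpotent L := isNilpotent_gammaLog J _
  have hD : matDeriv L = gammaLogDeriv n m := by
    have e : matDeriv L = ∑ j ∈ Finset.range J,
        (X ^ (2 * j) : ℚ[X]) • (matCoeff (gammaLogDeriv n m) (2 * j)).map C := by
      rw [hLdef, gammaLog, matDeriv_sum]
      refine Finset.sum_congr rfl fun j _ => ?_
      ext1 v w
      have : ((2 : ℚ) * j + 1) ≠ 0 := by positivity
      simp only [matDeriv, gammaLogCoeff, Matrix.map_apply, Matrix.smul_apply, smul_eq_mul,
        algebraMap_eq, derivative_mul, derivative_C, mul_zero, add_zero, derivative_X_pow,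
        Nat.add_sub_cancel]
      rw [mul_comm (C _), mul_assoc, ← C_mul]
      congr 2
      push_cast
      field_simp
    refine matCoeff_ext fun i => ?_
    rw [e]
    ext v w
    simp only [matCoeff, Matrix.map_apply, Matrix.sum_apply, Matrix.smul_apply, smul_eq_mul,
      finsetSum_coeff, coeff_mul_C, coeff_X_pow, ite_mul, one_mul, zero_mul]
    rcases Nat.even_or_odd' i with ⟨k, rfl | rfl⟩
    · by_cases hk : k < J
      · rw [Finset.sum_eq_single k]
        · simp
        · intro b _ hb
          rw [if_neg (by omega)]
        · simp [hk]
      · rw [coeff_eq_zero_of_natDegree_lt ((hJ v w).trans_le (by omega))]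
        refine Finset.sum_eq_zero fun j hj => ?_
        rw [Finset.mem_range] at hj
        rw [if_neg (by omega)]
    -- Odd coefficients of the logarithmic derivative equal their negatives, by evenness.
    · rw [Finset.sum_eq_zero fun j _ => if_neg (by omega)]
      have h := matCoeff_matNeg (gammaLogDeriv n m) (2 * k + 1)
      rw [matNeg_gammaLogDeriv, pow_succ, pow_mul] at h
      have h2 := congr_fun (congr_fun h v) w
      simp [matCoeff] at h2
      linarith
  have hcomm : Commute (matDeriv L) L := by
    refine commute_of_commute_matCoeff fun i j => ?_
    have hLc : ∀ i, ∃ (c : ℚ) (k : ℕ), matCoeff L i = c • gammaLogCoeff n m k := by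
      intro i
      by_cases hi : ∃ k ∈ Finset.range J, i = 2 * k + 1
      · obtain ⟨k, hk, rfl⟩ := hi
        refine ⟨1, k, ?_⟩
        ext v w
        simp only [hLdef, gammaLog, matCoeff, Matrix.map_apply, Matrix.sum_apply,
          Matrix.smul_apply, smul_eq_mul, algebraMap_eq, finsetSum_coeff, coeff_mul_C,
          coeff_X_pow, ite_mul, one_mul, zero_mul]
        rw [Finset.sum_eq_single k]
        · simp
        · intro b _ hb
          rw [if_neg (by omega)]
        · intro h; exact absurd hk h
      · refine ⟨0, 0, ?_⟩
        ext v w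
        simp only [hLdef, gammaLog, matCoeff, Matrix.map_apply, Matrix.sum_apply,
          Matrix.smul_apply, smul_eq_mul, algebraMap_eq, finsetSum_coeff, coeff_mul_C,
          coeff_X_pow, ite_mul, one_mul, zero_mul]
        exact Finset.sum_eq_zero fun k hk => if_neg fun h => hi ⟨k, hk, h⟩
    rw [matCoeff_matDeriv]
    obtain ⟨c, k, h1⟩ := hLc (i + 1)
    obtain ⟨d, l, h2⟩ := hLc j
    rw [h1, h2]
    exact (((commute_gammaLogCoeff k l).smul_right _).smul_left _).smul_left _
  have hexp := matDeriv_exp hcomm hL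
  have hZ : IsNilpotent.exp L * gammaNegX n m = 1 := by
    apply eq_of_matDeriv_eq_zero
    · have hc : Commute (matDeriv L) (IsNilpotent.exp L) := commute_exp_right hcomm hL
      rw [matDeriv_mul, hexp, hc.eq, mul_assoc, ← mul_add, hD, matDeriv_gammaNegX]
      -- By evenness L' = γ'(-X) γ(X), so L' γ(-X) = γ'(-X), which cancels the derivative of γ(-X).
      conv_lhs => rw [← matNeg_gammaLogDeriv]
      rw [gammaLogDeriv, map_mul, matNeg_gammaNegX, mul_assoc, gammaX_mul_gammaNegX, mul_one,
        add_neg_cancel, mul_zero]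
    · have e1 : (evalRingHom (0 : ℚ)).mapMatrix (IsNilpotent.exp L) = 1 := by
        have := map_exp_gammaLog (n := n) (m := m) (aeval (0 : ℚ)) J
          fun j => (X : ℚ[X]) ^ (2 * j + 1)
        rw [← hLdef] at this
        have e : (aeval (0 : ℚ)).toRingHom = evalRingHom (0 : ℚ) := by ext <;> simp
        rw [e] at this
        rw [this]
        simp [gammaLog_zero]
      have e2 : (evalRingHom (0 : ℚ)).mapMatrix (gammaNegX n m) = 1 := by
        have := map_gammaProd_nilMat (n := n) (m := m) (evalRingHom (0 : ℚ)) 2 (-X)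
        rw [map_neg, coe_evalRingHom, eval_X, neg_zero, gammaProd_zero] at this
        exact this
      rw [map_mul, e1, e2, one_mul]
  calc IsNilpotent.exp L = IsNilpotent.exp L * (gammaNegX n m * gammaX n m) := by
        rw [gammaNegX_mul_gammaX, mul_one]
    _ = gammaX n m := by rw [← mul_assoc, hZ, one_mul]

/-- Specialise X to x. The point is that J and the matrices e_j do not depend on the ring or the
parameter, so factors with different parameters can be combined. -/
theorem exists_exp_gammaLog (n m : ℕ) :
    ∃ J, ∀ (R : Type) [CommRing R] [Algebra ℚ R] (x : R),
      IsNilpotent.exp (gammaLog n m J fun j => x ^ (2 * j + 1)) =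
        gammaProd (nilMat R n) 2 m x := by
  obtain ⟨J, hJ⟩ := exists_exp_gammaLog_X n m
  refine ⟨J, fun R _ _ x => ?_⟩
  have h1 := map_exp_gammaLog (n := n) (m := m) (aeval x) J fun j => (X : ℚ[X]) ^ (2 * j + 1)
  have h2 := map_gammaProd_nilMat (n := n) (m := m) (aeval x : ℚ[X] →ₐ[ℚ] R).toRingHom 2 X
  rw [hJ, gammaX, h2, map_ofNat] at h1
  simpa using h1.symm

end

end SignedPD

namespace SignedPD

open MvPolynomial

/-! ### Invariant polynomials are constant -/

theorem eq_C_of_pderiv_eq_zero {σ : Type*} {f : MvPolynomial σ ℚ} (h : ∀ i, pderiv i f = 0) :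
    f = C (constantCoeff f) := by
  classical
  ext m
  rw [coeff_C, constantCoeff_eq]
  split_ifs with hm
  · rw [hm]
  · obtain ⟨i, hi⟩ := Finsupp.ne_iff.1 (Ne.symm hm)
    have h1 := coeff_pderiv (i := i) f (m - Finsupp.single i 1)
    rw [h i, coeff_zero, tsub_add_cancel_of_le
      (Finsupp.single_le_iff.2 (Nat.one_le_iff_ne_zero.2 hi))] at h1
    rcases mul_eq_zero.1 h1.symm with h2 | h2
    · exact h2
    · exfalso
      have : (0 : ℚ) < (((m - Finsupp.single i 1 : σ →₀ ℕ) i : ℕ) : ℚ) + 1 := by positivity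
      exact this.ne' h2

/-- The translation `p_j ↦ p_j + c X ^ (2 j + 1)`. -/
noncomputable def powerShift (c : ℚ) :
    MvPolynomial ℕ ℚ →ₐ[ℚ] Polynomial (MvPolynomial ℕ ℚ) :=
  aeval fun j => Polynomial.C (X j) + Polynomial.C (C c) * Polynomial.X ^ (2 * j + 1)

/-- The extension of the translation to an endomorphism that fixes the parameter. -/
noncomputable def powerShiftExt (c : ℚ) :
    Polynomial (MvPolynomial ℕ ℚ) →+* Polynomial (MvPolynomial ℕ ℚ) :=
  Polynomial.eval₂RingHom (powerShift c).toRingHom Polynomial.X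

theorem powerShiftExt_C (c : ℚ) (f : MvPolynomial ℕ ℚ) :
    powerShiftExt c (Polynomial.C f) = powerShift c f := by
  simp [powerShiftExt]

theorem powerShiftExt_X (c : ℚ) : powerShiftExt c Polynomial.X = Polynomial.X := by
  simp [powerShiftExt]

theorem powerShiftExt_injective : Function.Injective (powerShiftExt 1) := by
  have h : (powerShiftExt (-1)).comp (powerShiftExt 1) = RingHom.id _ := by
    refine Polynomial.ringHom_ext' (MvPolynomial.ringHom_ext ?_ ?_) ?_
    · intro r
      have h1 : ∀ c, powerShift c (C r) = algebraMap ℚ _ r := fun c => (powerShift c).commutes r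
      simp only [RingHom.comp_apply, RingHom.id_apply, powerShiftExt_C, h1]
      have h2 : algebraMap ℚ (Polynomial (MvPolynomial ℕ ℚ)) r = Polynomial.C (C r) := rfl
      rw [h2, powerShiftExt_C, h1, h2]
    · intro j
      simp only [RingHom.comp_apply, RingHom.id_apply, powerShiftExt_C]
      have h1 : ∀ c, powerShift c (X j) = Polynomial.C (X j) +
          Polynomial.C (C c) * Polynomial.X ^ (2 * j + 1) := fun c => by simp [powerShift]
      have h2 : powerShift (-1) (C 1) = 1 := by simp
      rw [h1, map_add, map_mul, map_pow, powerShiftExt_C, powerShiftExt_C, powerShiftExt_X, h1, h2]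
      simp only [map_neg, C_1, Polynomial.C_1]
      ring
    · simp [powerShiftExt_X]
  exact Function.LeftInverse.injective (g := powerShiftExt (-1)) fun f => RingHom.congr_fun h f

/-- The derivation `∑ (2 j + 1) X ^ (2 j) ∂/∂p_j`. -/
noncomputable def powerDerivation :
    Derivation ℚ (MvPolynomial ℕ ℚ) (Polynomial (MvPolynomial ℕ ℚ)) :=
  mkDerivation ℚ fun j => (2 * j + 1 : ℚ) • Polynomial.X ^ (2 * j)

/-- The chain rule for X ↦ f(p_j + X^{2j+1}). -/
theorem derivative_powerShift (f : MvPolynomial ℕ ℚ) :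
    Polynomial.derivative (powerShift 1 f) = powerShiftExt 1 (powerDerivation f) := by
  have hX : ∀ j, powerShift 1 (X j) = Polynomial.C (X j) +
      Polynomial.X ^ (2 * j + 1) := fun c => by simp [powerShift]
  induction f using MvPolynomial.induction_on with
  | C a =>
    have h1 : powerShift 1 (C a) = Polynomial.C (C a) := (powerShift 1).commutes a
    rw [h1, Polynomial.derivative_C]
    simp [powerDerivation]
  | add p q hp hq => simp only [map_add, hp, hq]
  | mul_X p j hp =>
    rw [map_mul, Polynomial.derivative_mul, hp, Derivation.leibniz, map_add, Algebra.smul_def,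
      Algebra.smul_def, map_mul, map_mul]
    have e : ∀ g : MvPolynomial ℕ ℚ, powerShiftExt 1 (algebraMap _ _ g) = powerShift 1 g :=
      powerShiftExt_C 1
    rw [e, e, hX]
    have h2 : powerShiftExt 1 (powerDerivation (X j)) =
        Polynomial.derivative (Polynomial.C (X j) + Polynomial.X ^ (2 * j + 1) :
          Polynomial (MvPolynomial ℕ ℚ)) := by
      rw [powerDerivation, mkDerivation_X]
      have e2 : ((2 * j + 1 : ℚ) • Polynomial.X ^ (2 * j) : Polynomial (MvPolynomial ℕ ℚ)) =
          (2 * (j : Polynomial (MvPolynomial ℕ ℚ)) + 1) * Polynomial.X ^ (2 * j) := by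
        rw [Algebra.smul_def]; simp [map_ofNat]
      rw [e2, map_mul, map_add, map_mul, map_pow, powerShiftExt_X, map_ofNat, map_natCast, map_one,
        map_add, Polynomial.derivative_C, Polynomial.derivative_X_pow, zero_add, Nat.add_sub_cancel,
        map_natCast]
      push_cast
      rfl
    rw [h2]
    ring

theorem coeff_powerDerivation (f : MvPolynomial ℕ ℚ) (j : ℕ) :
    (powerDerivation f).coeff (2 * j) = (2 * j + 1 : ℚ) • pderiv j f := by
  have h : (Polynomial.lcoeff (MvPolynomial ℕ ℚ) (2 * j)).compDer powerDerivation =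
      (2 * j + 1 : ℚ) • pderiv j := by
    refine derivation_ext fun k => ?_
    change (powerDerivation (X k)).coeff (2 * j) = (2 * j + 1 : ℚ) • pderiv j (X k)
    rw [powerDerivation, mkDerivation_X, Polynomial.coeff_smul, Polynomial.coeff_X_pow]
    by_cases hk : k = j
    · subst hk; simp
    · rw [if_neg (by omega), pderiv_X_of_ne hk, smul_zero, smul_zero]
  exact DFunLike.congr_fun h f

/-- If the translate of f does not involve X, its derivative vanishes, and translating back ∑ (2j+1)
X^{2j} ∂f/∂p_j = 0. The powers X^{2j} are distinct, so every partial derivative is 0. -/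
theorem eq_C_of_powerShift_eq {f : MvPolynomial ℕ ℚ} (h : powerShift 1 f = Polynomial.C f) :
    f = C (constantCoeff f) := by
  refine eq_C_of_pderiv_eq_zero fun j => ?_
  have h1 := derivative_powerShift f
  rw [h, Polynomial.derivative_C, eq_comm, map_eq_zero_iff _ powerShiftExt_injective] at h1
  have h2 := coeff_powerDerivation f j
  rw [h1, Polynomial.coeff_zero, eq_comm, smul_eq_zero] at h2
  refine h2.resolve_left ?_
  positivity

/-- Invariance under the transpositions would carry one variable z to all later ones, but a
polynomial has finitely many variables. -/
theorem z_notMem_vars {f : MvPolynomial ZP ℚ} (h : ∀ i, act i f = f) (m : ℕ) :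
    ZP.z m ∉ f.vars := by
  classical
  intro hm
  have hstep : ∀ m, ZP.z m ∈ f.vars → ZP.z (m + 1) ∈ f.vars := by
    intro m hm
    obtain ⟨e, he, hz, hp⟩ : ∃ e : ZP → ZP, (∀ f, act (m + 1) f = rename e f) ∧
        (∀ j, e (.z j) = .z (Equiv.swap m (m + 1) j)) ∧ ∀ j, e (.p j) = .p j :=
      ⟨_, fun _ => rfl, fun _ => rfl, fun _ => rfl⟩
    have h1 : ZP.z m ∈ (rename e f).vars := by rwa [← he, h]
    obtain ⟨v, hv, hv'⟩ := Finset.mem_image.1 (vars_rename e f h1)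
    cases v with
    | p j => rw [hp] at hv'; cases hv'
    | z j =>
      rw [hz, ZP.z.injEq] at hv'
      have : j = m + 1 := by
        rw [← Equiv.swap_apply_self m (m + 1) j, hv', Equiv.swap_apply_left]
      rwa [← this]
  have hall : ∀ k, ZP.z (m + k) ∈ f.vars := fun k => by
    induction k with
    | zero => exact hm
    | succ k ih => exact hstep _ ih
  have hinj : Function.Injective fun k => ZP.z (m + k) := fun a b hab => by
    simpa using hab
  exact (Set.infinite_range_of_injective hinj)
    (f.vars.finite_toSet.subset (Set.range_subset_iff.2 hall))

/-- Once the z variables are excluded, invariance under s_0 is invariance under the translation of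
the power sums, with z_1 as parameter. -/
theorem eq_C_of_act_eq {f : MvPolynomial ZP ℚ} (h : ∀ i, act i f = f) :
    f = C (constantCoeff f) := by
  obtain ⟨g, rfl⟩ := exists_rename_eq_of_vars_subset_range f ZP.p
    (fun a b hab => by simpa using hab) (fun v hv => by
      cases v with
      | z m => exact absurd hv (z_notMem_vars h m)
      | p j => exact ⟨j, rfl⟩)
  let η : MvPolynomial ZP ℚ →ₐ[ℚ] Polynomial (MvPolynomial ℕ ℚ) :=
    aeval fun v => match v with
      | .z _ => Polynomial.X
      | .p j => Polynomial.C (X j)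
  have h1 : η (act 0 (rename ZP.p g)) = powerShift 1 g := by
    have : (η.comp (act 0)).comp (rename ZP.p) = powerShift 1 := by
      ext j
      simp [η, act, powerShift]
    exact AlgHom.congr_fun this g
  have h2 : η (rename ZP.p g) = Polynomial.C g := by
    have : η.comp (rename ZP.p) = (Algebra.ofId (MvPolynomial ℕ ℚ) _).restrictScalars ℚ := by
      ext j
      simp [η, Algebra.ofId_apply]
    exact AlgHom.congr_fun this g
  rw [h 0, h2] at h1
  conv_lhs => rw [eq_C_of_powerShift_eq h1.symm]
  simp

end SignedPD

namespace SignedPD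

/-! ### The product over the staircase -/

section

variable {R B : Type*} [CommRing R] [Ring B] [Algebra R B]

/-- The product over `m` rows of a staircase, beginning with row `i`. -/
def stairProd (u : ℕ → B) (z : ℕ → R) : ℕ → ℕ → B
  | 0, _ => 1
  | m + 1, i => descProd u (z i) (m + 1) (i + 1) * stairProd u z m (i + 1)

variable {u : ℕ → B}

theorem stairProd_eq (z : ℕ → R) (m i : ℕ) :
    stairProd u z m i = descProd u (z i) m (i + 1) * stairProd u z (m - 1) (i + 1) := by
  cases m with
  | zero => simp [stairProd, descProd]
  | succ m => rfl

theorem stairProd_congr {z z' : ℕ → R} (m : ℕ) {i : ℕ} (h : ∀ j, i ≤ j → z j = z' j) :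
    stairProd u z m i = stairProd u z' m i := by
  induction m generalizing i with
  | zero => rfl
  | succ m ih => rw [stairProd, stairProd, h i le_rfl, ih fun j hj => h j (by omega)]

theorem IsNilCoxeter.commute_stairProd (hu : IsNilCoxeter u) (z : ℕ → R) (m : ℕ) {i k : ℕ}
    (h : k + 1 ≤ i) : Commute (u k) (stairProd u z m i) := by
  induction m generalizing i with
  | zero => exact Commute.one_right _
  | succ m ih =>
    exact (hu.commute_gen_descProd (by omega) _ _).mul_right (ih (by omega))

theorem stairProd_zero (m i : ℕ) : stairProd u (fun _ => (0 : R)) m i = 1 := by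
  induction m generalizing i with
  | zero => rfl
  | succ m ih => rw [stairProd, descProd_zero, ih, one_mul]

theorem map_stairProd {S B' : Type*} [CommRing S] [Ring B'] [Algebra S B'] {u' : ℕ → B'}
    {φ : R →+* S} {Φ : B →+* B'} (h : ∀ c i, Φ (c • u i) = φ c • u' i) (z : ℕ → R) (m i : ℕ) :
    Φ (stairProd u z m i) = stairProd u' (fun j => φ (z j)) m i := by
  induction m generalizing i with
  | zero => simp [stairProd]
  | succ m ih => rw [stairProd, map_mul, ih, map_descProd h, stairProd]

/-- The ascending half of the Γ-factor cancels the first row at -z 0; its descending half becomes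
the first row at z 0, and the factor in u 0 commutes with the lower rows, whose letters are at least
2. -/
theorem IsNilCoxeter.gammaProd_mul_stairProd (hu : IsNilCoxeter u) (c : R) {z z' : ℕ → R}
    (h0 : z' 0 = -z 0) (h : ∀ j, 1 ≤ j → z j = z' j) (m : ℕ) :
    gammaProd u c m (z 0) * stairProd u z' m 0 =
      stairProd u z m 0 * factor u 0 (c * z 0) := by
  have h1 := hu.ascProd_mul_descProd (z 0) m 1
  have h2 : Commute (factor u 0 (c * z 0)) (stairProd u z (m - 1) 1) :=
    (Commute.one_left _).add_left ((hu.commute_stairProd z (m - 1) (by omega)).smul_left _)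
  rw [stairProd_eq z, stairProd_eq z', h0, ← stairProd_congr (m - 1) h, gammaProd]
  calc _ = descProd u (z 0) m 1 * factor u 0 (c * z 0) *
        (ascProd u (z 0) m 1 * descProd u (-z 0) m 1) * stairProd u z (m - 1) 1 := by
        simp only [mul_assoc, zero_add]
    _ = descProd u (z 0) m 1 * (factor u 0 (c * z 0) * stairProd u z (m - 1) 1) := by
      rw [h1, mul_one, mul_assoc]
    _ = _ := by rw [h2.eq, zero_add, mul_assoc]

/-- Only rows j and j + 1 change. Lengthening the shorter of them by the factor 1 + z (j+1) u (j+1)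
makes their product symmetric; the compensating factor 1 - z (j+1) u (j+1) is all that distinguishes
the two sides. -/
theorem IsNilCoxeter.stairProd_sub_swap (hu : IsNilCoxeter u) {z z' : ℕ → R} (j : ℕ)
    (h0 : z' j = z (j + 1)) (h1 : z' (j + 1) = z j)
    (h : ∀ r, r ≠ j → r ≠ j + 1 → z r = z' r) (m : ℕ) {i : ℕ} (hij : i ≤ j)
    (hm : ∀ k, i + m < k → u k = 0) :
    stairProd u z m i - stairProd u z' m i =
      (z j - z (j + 1)) • (stairProd u z m i * u (j + 1)) := by
  induction m generalizing i with
  -- The rows are used up, and the right side vanishes because `hm` makes u (j + 1) zero.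
  | zero => simp [stairProd, hm (j + 1) (by omega)]
  | succ m ih =>
    by_cases hj : i = j
    · subst hj
      have h2 : ∀ z : ℕ → R, stairProd u z (m + 1) i =
          descProd u (z i) (m + 1) (i + 1) * descProd u (z (i + 1)) (m + 1) (i + 1) *
            factor u (i + 1) (-z (i + 1)) * stairProd u z (m - 1) (i + 2) := by
        intro z
        rw [stairProd, stairProd_eq z m]
        have : descProd u (z (i + 1)) (m + 1) (i + 1) * factor u (i + 1) (-z (i + 1)) =
            descProd u (z (i + 1)) m (i + 2) := by
          rw [descProd, mul_assoc, hu.factor_mul_neg, mul_one]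
        rw [← this]
        simp only [mul_assoc]
      have h3 : stairProd u z (m - 1) (i + 2) = stairProd u z' (m - 1) (i + 2) :=
        stairProd_congr _ fun r hr => h r (by omega) (by omega)
      have hc := hu.commute_stairProd z (m - 1) (show i + 1 + 1 ≤ i + 2 by omega)
      rw [h2 z, h2 z', h0, h1, ← h3, (hu.descProd_commute (z (i + 1)) (z i) (m + 1) i).eq]
      generalize descProd u (z i) (m + 1) (i + 1) * descProd u (z (i + 1)) (m + 1) (i + 1) = G
      generalize stairProd u z (m - 1) (i + 2) = S at hc
      simp only [factor, mul_add, mul_one, add_mul, mul_assoc, ← hc.eq, neg_smul, mul_neg, neg_mul,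
        smul_mul_assoc, mul_smul_comm]
      rw [← mul_assoc (u (i + 1)) (u (i + 1)), hu.sq, zero_mul, mul_zero]
      module
    · rw [stairProd, stairProd, ← h i (by omega) (by omega), ← mul_sub,
        ih (by omega) fun k hk => hm k (by omega), mul_smul_comm, mul_assoc]

end

/-! ### Construction of the Schubert polynomials -/

open MvPolynomial

/-- The generating matrix of the Schubert polynomials of type C for `BC n`. -/
noncomputable def schubertMat (n J : ℕ) : Matrix (BC n) (BC n) (MvPolynomial ZP ℚ) :=
  IsNilpotent.exp (gammaLog n (n - 1) J fun j => (X (ZP.p j) : MvPolynomial ZP ℚ)) *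
    stairProd (nilMat (MvPolynomial ZP ℚ) n) (fun i => (X (ZP.z i) : MvPolynomial ZP ℚ)) (n - 1) 0

/-- `J` is large enough for the logarithm to give the generating function of a Gamma-block. -/
def IsLogBound (n J : ℕ) : Prop :=
  ∀ (R : Type) [CommRing R] [Algebra ℚ R] (x : R),
    IsNilpotent.exp (gammaLog n (n - 1) J fun j => x ^ (2 * j + 1)) =
      gammaProd (nilMat R n) 2 (n - 1) x

theorem map_stairProd_nilMat {R S : Type*} [CommRing R] [CommRing S] (φ : R →+* S) (n : ℕ)
    (z : ℕ → R) (m i : ℕ) : φ.mapMatrix (stairProd (nilMat R n) z m i) =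
      stairProd (nilMat S n) (fun j => φ (z j)) m i :=
  map_stairProd (fun c i => nilMat_smul_map φ c i) z m i

theorem schubertMat_sub_act {n J : ℕ} (hJ : IsLogBound n J) (i : ℕ) :
    schubertMat n J - (act i).toRingHom.mapMatrix (schubertMat n J) =
      denom i • (schubertMat n J * nilMat _ n i) := by
  rw [schubertMat, map_mul, map_exp_gammaLog, map_stairProd_nilMat]
  set F := IsNilpotent.exp (gammaLog n (n - 1) J fun j => (X (ZP.p j) : MvPolynomial ZP ℚ))
  set z : ℕ → MvPolynomial ZP ℚ := fun i => X (ZP.z i) with hz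
  have hnil := nilMat_isNilCoxeter (R := MvPolynomial ZP ℚ) (n := n)
  cases i with
  | zero =>
    -- The added powers of z 0 split off a factor γ(z 0) from the exponential.
    have hp : (fun j => act 0 (X (.p j))) = fun j => X (.p j) + z 0 ^ (2 * j + 1) := by
      funext j
      simp [act, hz]
    rw [hp, exp_gammaLog_add, hJ, mul_assoc, hnil.gammaProd_mul_stairProd 2]
    · simp only [factor, denom, hz]
      rw [mul_add, mul_one, mul_add, sub_add_cancel_left, mul_smul_comm, mul_smul_comm, mul_assoc,
        ← neg_smul, neg_mul]
    · simp [act, hz]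
    · intro j hj
      obtain ⟨k, rfl⟩ : ∃ k, j = k + 1 := ⟨j - 1, by omega⟩
      simp [act, hz]
  | succ j =>
    have hp : (fun k => act (j + 1) (X (.p k))) = fun k => X (.p k) := by
      funext k
      simp [act]
    rw [hp, ← mul_sub, hnil.stairProd_sub_swap j (i := 0)]
    · rw [mul_smul_comm, mul_assoc]; rfl
    · simp [act, hz]
    · simp [act, hz]
    · intro r h1 h2
      simp [act, hz, Equiv.swap_apply_of_ne_of_ne h1 h2]
    · omega
    · intro k hk
      exact nilMat_eq_zero (by omega)

/-- The defining relations of the Schubert polynomials of type C for the elements of `H`, with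
the homogeneity replaced by the vanishing of the constant coefficients. -/
structure IsSchubertOn (H : Set BCInf) (S : BCInf → MvPolynomial ZP ℚ) : Prop where
  one : S 1 = 1
  constantCoeff : ∀ w ∈ H, w ≠ 1 → constantCoeff (S w) = 0
  descent : ∀ w ∈ H, ∀ i, IsDescent w i → denom i * S (w * gen i) = S w - act i (S w)
  ascent : ∀ w ∈ H, ∀ i, ¬ IsDescent w i → act i (S w) = S w

theorem IsSchubertOn.mono {H H' : Set BCInf} {S : BCInf → MvPolynomial ZP ℚ}
    (hS : IsSchubertOn H S) (h : H' ⊆ H) : IsSchubertOn H' S :=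
  ⟨hS.one, fun w hw => hS.constantCoeff w (h hw), fun w hw => hS.descent w (h hw),
    fun w hw => hS.ascent w (h hw)⟩

/-- Induction on the length: the divided differences of both polynomials agree, so their difference
is invariant under all s_i, hence a constant, and the constant terms vanish. -/
theorem IsSchubertOn.unique {H : Set BCInf} (hH : ∀ w ∈ H, ∀ i, IsDescent w i → w * gen i ∈ H)
    {S S' : BCInf → MvPolynomial ZP ℚ} (hS : IsSchubertOn H S) (hS' : IsSchubertOn H S')
    {w : BCInf} (hw : w ∈ H) : S w = S' w := by
  induction h : len w using Nat.strong_induction_on generalizing w with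
  | _ l ih =>
    by_cases h1 : w = 1
    · rw [h1, hS.one, hS'.one]
    rw [← sub_eq_zero]
    have hact : ∀ i, act i (S w - S' w) = S w - S' w := by
      intro i
      by_cases hi : IsDescent w i
      · have := len_mul_gen_of_isDescent hi
        have e := ih _ (by omega) (hH w hw i hi) rfl
        have e1 := hS.descent w hw i hi
        have e2 := hS'.descent w hw i hi
        rw [e, e2] at e1
        rw [map_sub]
        linear_combination e1
      · rw [map_sub, hS.ascent w hw i hi, hS'.ascent w hw i hi]
    rw [eq_C_of_act_eq hact, map_sub, hS.constantCoeff w hw h1, hS'.constantCoeff w hw h1, sub_zero,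
      map_zero]

open Classical in
/-- The Schubert polynomials of type C for the elements of `BC n`. -/
noncomputable def schubertFin (n J : ℕ) (w : BCInf) : MvPolynomial ZP ℚ :=
  if h : w ∈ BC n then schubertMat n J 1 ⟨w, h⟩ else 0

theorem constantCoeff_schubertMat (n J : ℕ) :
    (constantCoeff : MvPolynomial ZP ℚ →+* ℚ).mapMatrix (schubertMat n J) = 1 := by
  have e : (constantCoeff : MvPolynomial ZP ℚ →+* ℚ) =
      (aeval (fun _ => 0) : MvPolynomial ZP ℚ →ₐ[ℚ] ℚ).toRingHom := by
    ext <;> simp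
  rw [e, schubertMat, map_mul, map_exp_gammaLog, map_stairProd_nilMat]
  simp [gammaLog_zero, stairProd_zero]

theorem isSchubertOn_schubertFin {n J : ℕ} (hJ : IsLogBound n J) :
    IsSchubertOn (BC n) (schubertFin n J) := by
  have hrel : ∀ w (hw : w ∈ BC n) i, denom i * (schubertMat n J * nilMat (MvPolynomial ZP ℚ) n i) 1 ⟨w, hw⟩ =
      schubertFin n J w - act i (schubertFin n J w) := by
    intro w hw i
    have := congr_fun (congr_fun (schubertMat_sub_act hJ i) 1) ⟨w, hw⟩
    simp only [schubertFin, dif_pos hw]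
    exact this.symm
  have hasc : ∀ w ∈ BC n, ∀ i, ¬ IsDescent w i →
      act i (schubertFin n J w) = schubertFin n J w := by
    intro w hw i hi
    have := hrel w hw i
    rw [mul_nilMat_apply, dif_neg hi, mul_zero] at this
    exact (sub_eq_zero.1 this.symm).symm
  have hcc : ∀ w (hw : w ∈ BC n), constantCoeff (schubertFin n J w) =
      (1 : Matrix (BC n) (BC n) ℚ) 1 ⟨w, hw⟩ := by
    intro w hw
    rw [← constantCoeff_schubertMat n J, schubertFin, dif_pos hw]
    rfl
  refine ⟨?_, ?_, ?_, hasc⟩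
  -- The identity has no descents, so its entry is invariant and equals its constant coefficient,
  -- read off at z = p = 0.
  · have h1 : ∀ i, ¬ IsDescent 1 i := fun i hi => by
      rw [← len_mul_gen_lt_iff, len_one] at hi
      omega
    rw [eq_C_of_act_eq fun i => hasc 1 (one_mem _) i (h1 i), hcc 1 (one_mem _)]
    have : (⟨1, one_mem _⟩ : BC n) = 1 := rfl
    rw [this, Matrix.one_apply_eq, C_1]
  · intro w hw h1
    rw [hcc w hw, Matrix.one_apply_ne]
    exact fun h => h1 (congr_arg Subtype.val h).symm
  · intro w hw i hi
    rw [← hrel w hw i, mul_nilMat_apply, dif_pos hi, schubertFin, dif_pos (mul_gen_mem_BC hw hi)]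

theorem exists_isLogBound (n : ℕ) : ∃ J, IsLogBound n J := exists_exp_gammaLog n (n - 1)

/-- A bound that satisfies `IsLogBound`. -/
noncomputable def logBound (n : ℕ) : ℕ := (exists_isLogBound n).choose

theorem isLogBound_logBound (n : ℕ) : IsLogBound n (logBound n) := (exists_isLogBound n).choose_spec

/-- Stability in n comes from uniqueness; matrices of different sizes are never compared. -/
theorem schubertFin_eq {m n : ℕ} (h : m ≤ n) {w : BCInf} (hw : w ∈ BC m) :
    schubertFin m (logBound m) w = schubertFin n (logBound n) w :=
  (isSchubertOn_schubertFin (isLogBound_logBound m)).unique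
    (fun _ hw _ hi => mul_gen_mem_BC hw hi)
    ((isSchubertOn_schubertFin (isLogBound_logBound n)).mono (BC_mono h)) hw

/-- The Schubert polynomials of type C, constructed as entries of matrices. -/
noncomputable def schubertFamily (w : BCInf) : MvPolynomial ZP ℚ :=
  schubertFin (exists_mem_BC w).choose (logBound (exists_mem_BC w).choose) w

theorem schubertFamily_eq {n : ℕ} {w : BCInf} (hw : w ∈ BC n) :
    schubertFamily w = schubertFin n (logBound n) w := by
  have h := (exists_mem_BC w).choose_spec
  rcases le_total (exists_mem_BC w).choose n with hle | hle
  · exact schubertFin_eq hle h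
  · exact (schubertFin_eq hle hw).symm

theorem isSchubertOn_schubertFamily : IsSchubertOn Set.univ schubertFamily := by
  have hS := fun n => isSchubertOn_schubertFin (isLogBound_logBound n)
  refine ⟨?_, ?_, ?_, ?_⟩
  · rw [schubertFamily_eq (one_mem (BC 0)), (hS 0).one]
  · intro w _ h
    obtain ⟨n, hn⟩ := exists_mem_BC w
    rw [schubertFamily_eq hn, (hS n).constantCoeff w hn h]
  · intro w _ i hi
    obtain ⟨n, hn⟩ := exists_mem_BC w
    rw [schubertFamily_eq hn, schubertFamily_eq (mul_gen_mem_BC hn hi), (hS n).descent w hn i hi]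
  · intro w _ i hi
    obtain ⟨n, hn⟩ := exists_mem_BC w
    rw [schubertFamily_eq hn, (hS n).ascent w hn i hi]

/-! ### Homogeneity -/

/-- The automorphism that multiplies polynomials of degree `d` by `c ^ d`. -/
noncomputable def scaling (c : ℚ) : MvPolynomial ZP ℚ →ₐ[ℚ] MvPolynomial ZP ℚ :=
  aeval fun v => C (c ^ degZP v) * X v

theorem scaling_z (c : ℚ) (i : ℕ) : scaling c (X (.z i)) = C c * X (.z i) := by
  simp [scaling, degZP]

theorem scaling_p (c : ℚ) (j : ℕ) : scaling c (X (.p j)) = C (c ^ (2 * j + 1)) * X (.p j) := by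
  simp [scaling, degZP]

theorem coeff_scaling (c : ℚ) (f : MvPolynomial ZP ℚ) (m : ZP →₀ ℕ) :
    coeff m (scaling c f) = c ^ Finsupp.weight degZP m * coeff m f := by
  classical
  induction f using MvPolynomial.induction_on' with
  | add p q hp hq => rw [map_add, coeff_add, coeff_add, hp, hq, mul_add]
  | monomial s a =>
    have : scaling c (monomial s a) = monomial s (c ^ Finsupp.weight degZP s * a) := by
      rw [scaling, aeval_monomial]
      simp only [mul_pow, Finsupp.prod_mul]
      rw [monomial_eq, C_mul, Finsupp.weight_apply, algebraMap_eq]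
      have : (s.prod fun v e => (C (c ^ degZP v) : MvPolynomial ZP ℚ) ^ e) =
          C (c ^ (s.sum fun v e => e • degZP v)) := by
        rw [Finsupp.prod, Finsupp.sum, ← Finset.prod_pow_eq_pow_sum, map_prod]
        refine Finset.prod_congr rfl fun v _ => ?_
        rw [← C_pow, ← pow_mul, smul_eq_mul, mul_comm]
      rw [this]
      ring
    rw [this, coeff_monomial, coeff_monomial]
    split_ifs with h
    · rw [h]
    · rw [mul_zero]

theorem scaling_act (c : ℚ) (i : ℕ) (f : MvPolynomial ZP ℚ) :
    scaling c (act i f) = act i (scaling c f) := by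
  have hC : ∀ g : MvPolynomial ZP ℚ →ₐ[ℚ] MvPolynomial ZP ℚ, ∀ r, g (C r) = C r :=
    fun g r => g.commutes r
  have : (scaling c).comp (act i) = (act i).comp (scaling c) := by
    refine algHom_ext fun v => ?_
    simp only [AlgHom.comp_apply]
    rcases i with _ | i <;> rcases v with (_ | j) | j
    · rw [scaling_z, map_mul, hC]
      simp [act, scaling_z]
    · rw [scaling_z, map_mul, hC]
      simp [act, scaling_z]
    · rw [scaling_p, map_mul, hC]
      simp [act, scaling_z, scaling_p]
      ring
    · rw [scaling_z, map_mul, hC]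
      simp [act, scaling_z]
    · rw [scaling_z, map_mul, hC]
      simp [act, scaling_z]
    · rw [scaling_p, map_mul, hC]
      simp [act, scaling_p]
  exact AlgHom.congr_fun this f

theorem scaling_denom (c : ℚ) (i : ℕ) : scaling c (denom i) = C c * denom i := by
  rcases i with _ | i
  · rw [denom, map_mul, scaling_z, map_neg, map_ofNat]
    ring
  · rw [denom, map_sub, scaling_z, scaling_z]
    ring

/-- Scaling commutes with every s_i and multiplies each denominator by c, which the change of length
by one compensates. Uniqueness then turns this symmetry into homogeneity. -/
theorem isSchubertOn_scaling {S : BCInf → MvPolynomial ZP ℚ} (hS : IsSchubertOn Set.univ S)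
    {c : ℚ} (hc : c ≠ 0) :
    IsSchubertOn Set.univ fun w => C ((c ^ len w)⁻¹) * scaling c (S w) := by
  have hC : ∀ g : MvPolynomial ZP ℚ →ₐ[ℚ] MvPolynomial ZP ℚ, ∀ r, g (C r) = C r :=
    fun g r => g.commutes r
  refine ⟨?_, ?_, ?_, ?_⟩
  · simp [hS.one, len_one]
  · intro w hw h
    have := coeff_scaling c (S w) 0
    rw [← constantCoeff_eq, hS.constantCoeff w hw h, mul_zero] at this
    rw [map_mul, this, mul_zero]
  · intro w hw i hi
    have h1 := congr_arg (scaling c) (hS.descent w hw i hi)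
    rw [map_mul, scaling_denom, map_sub, scaling_act] at h1
    rw [map_mul, hC, ← mul_sub, ← h1, ← len_mul_gen_of_isDescent hi, pow_succ, mul_inv, C_mul]
    have : (C c⁻¹ * C c : MvPolynomial ZP ℚ) = 1 := by rw [← C_mul, inv_mul_cancel₀ hc, C_1]
    linear_combination (-(C (c ^ len (w * gen i))⁻¹ * denom i * scaling c (S (w * gen i)))) * this
  · intro w hw i hi
    rw [map_mul, hC, ← scaling_act, hS.ascent w hw i hi]

theorem IsSchubertOn.isWeightedHomogeneous {S : BCInf → MvPolynomial ZP ℚ}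
    (hS : IsSchubertOn Set.univ S) (w : BCInf) :
    IsWeightedHomogeneous degZP (S w) (len w) := by
  -- One scalar with distinct powers is enough, and c = 2 is one.
  have h := hS.unique (fun _ _ _ _ => Set.mem_univ _) (isSchubertOn_scaling hS two_ne_zero)
    (Set.mem_univ w)
  intro m hm
  have h1 := congr_arg (coeff m) h
  rw [coeff_C_mul, coeff_scaling, ← mul_assoc] at h1
  have h2 := mul_right_cancel₀ hm ((one_mul _).trans h1)
  have h3 : (2 : ℚ) ^ len w = 2 ^ Finsupp.weight degZP m := by
    have : (2 : ℚ) ^ len w ≠ 0 := by positivity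
    field_simp at h2
    exact h2
  exact (pow_right_injective₀ (by norm_num) (by norm_num) h3).symm

theorem IsSchubertOn.isSchubertC {S : BCInf → MvPolynomial ZP ℚ}
    (hS : IsSchubertOn Set.univ S) : IsSchubertC S where
  homogeneous w := ⟨_, hS.isWeightedHomogeneous w⟩
  one := hS.one
  descent w i h := hS.descent w trivial i ((len_mul_gen_lt_iff w i).1 h)
  ascent w i h := by
    rw [IsDividedDiff, hS.ascent w trivial i (mt (len_mul_gen_lt_iff w i).2 h), mul_zero, sub_self]

theorem denom_ne_zero (i : ℕ) : denom i ≠ 0 := by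
  rcases i with _ | i
  · exact mul_ne_zero (by norm_num) (X_ne_zero _)
  · rw [denom, sub_ne_zero, Ne, X_inj]
    simp

theorem degZP_ne_zero (v : ZP) : degZP v ≠ 0 := by
  cases v <;> simp [degZP]

/-- A homogeneous polynomial with nonzero constant term is constant, so its divided differences
vanish; but at a descent of w ≠ 1 the divided difference is a member of the family, and no member is
0. -/
theorem IsSchubertC.isSchubertOn {S : BCInf → MvPolynomial ZP ℚ}
    (hS : IsSchubertC S) : IsSchubertOn Set.univ S := by
  classical
  have hdes : ∀ w i, IsDescent w i → denom i * S (w * gen i) = S w - act i (S w) :=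
    fun w i hi => hS.descent w i ((len_mul_gen_lt_iff w i).2 hi)
  have hne : ∀ l w, len w = l → S w ≠ 0 := by
    intro l
    induction l with
    | zero =>
      intro w hw
      rw [eq_one_of_len_eq_zero hw, hS.one]
      exact one_ne_zero
    | succ l ih =>
      intro w hw h0
      obtain ⟨i, hi⟩ := exists_isDescent (w := w) (by rintro rfl; rw [len_one] at hw; omega)
      have := hdes w i hi
      rw [h0, map_zero, sub_zero] at this
      have h1 := len_mul_gen_of_isDescent hi
      exact mul_ne_zero (denom_ne_zero i) (ih _ (by omega)) this
  refine ⟨hS.one, fun w _ hw => ?_, fun w _ => hdes w, fun w _ i hi => ?_⟩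
  · by_contra hc
    obtain ⟨d, hd⟩ := hS.homogeneous w
    have hd0 : d = 0 := by
      rw [constantCoeff_eq] at hc
      rw [← hd hc, map_zero]
    obtain ⟨i, hi⟩ := exists_isDescent hw
    have hconst : S w = C (constantCoeff (S w)) := by
      ext m
      rw [coeff_C, constantCoeff_eq]
      split_ifs with hm
      · rw [hm]
      · by_contra hne
        have h1 := hd hne
        rw [hd0, Finsupp.weight_apply, Finsupp.sum, Finset.sum_eq_zero_iff] at h1
        apply hm
        ext v
        by_contra hv
        have := h1 v (Finsupp.mem_support_iff.2 (Ne.symm hv))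
        rcases Nat.mul_eq_zero.1 this with h2 | h2
        · exact hv h2.symm
        · exact degZP_ne_zero v h2
    have := hdes w i hi
    rw [hconst, show act i (C (constantCoeff (S w))) = C (constantCoeff (S w)) from
      (act i).commutes _, sub_self] at this
    exact mul_ne_zero (denom_ne_zero i) (hne _ _ rfl) this
  · have := hS.ascent w i (mt (len_mul_gen_lt_iff w i).1 hi)
    rw [IsDividedDiff, mul_zero] at this
    exact (sub_eq_zero.1 this.symm).symm

theorem existsUnique_isSchubertC : ∃! S : BCInf → MvPolynomial ZP ℚ, IsSchubertC S :=
  ⟨schubertFamily, isSchubertOn_schubertFamily.isSchubertC, fun _ hS => funext fun w =>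
    hS.isSchubertOn.unique (fun _ _ _ _ => Set.mem_univ _) isSchubertOn_schubertFamily
      (Set.mem_univ w)⟩

theorem schubertC_eq : schubertC = schubertFamily := by
  have h : IsSchubertC schubertC := Classical.epsilon_spec existsUnique_isSchubertC.exists
  exact existsUnique_isSchubertC.unique h isSchubertOn_schubertFamily.isSchubertC

end SignedPD

namespace SignedPD

/-! ### Reading orders and significant boxes -/

/-- The boxes of all Gamma-blocks in reading order. -/
def xReading (n k : ℕ) : List (Fin k × GammaBox n) :=
  (List.finRange k).reverse.flatMap fun i => (gammaReading n).map fun q => (i, q)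

/-- The order in which the boxes of the Gamma-blocks are read. -/
def xOrder {n k : ℕ} (p q : Fin k × GammaBox n) : Prop :=
  q.1 < p.1 ∨ p.1 = q.1 ∧
    (p.2.1.1.val : ℤ) - (p.2.1.2.val : ℤ) < (q.2.1.1.val : ℤ) - (q.2.1.2.val : ℤ)

/-- The order in which the boxes of the staircase are read. -/
def zOrder {n : ℕ} (p q : StairBox n) : Prop :=
  p.1.1 < q.1.1 ∨ p.1.1 = q.1.1 ∧ q.1.2 < p.1.2

/-- Row minus column is negative along the row, 0 at the corner and positive down the column, so it
records the position along the whole block. -/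
theorem pairwise_gammaReading (n : ℕ) : (gammaReading n).Pairwise fun p q =>
    (p.1.1.val : ℤ) - (p.1.2.val : ℤ) < (q.1.1.val : ℤ) - (q.1.2.val : ℤ) := by
  rw [gammaReading, List.pairwise_flatMap]
  constructor
  · intro r _
    rw [List.pairwise_filterMap, List.pairwise_reverse]
    refine (List.pairwise_lt_finRange n).imp ?_
    intro a b hab p hp q hq
    split_ifs at hp with h1
    split_ifs at hq with h2
    simp only [Option.some.injEq] at hp hq
    subst hp hq
    have : a.val < b.val := hab
    simp only
    omega
  · refine (List.pairwise_lt_finRange n).imp ?_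
    intro a b hab p hp q hq
    obtain ⟨c, -, hc⟩ := List.mem_filterMap.1 hp
    obtain ⟨d, -, hd⟩ := List.mem_filterMap.1 hq
    split_ifs at hc with h1
    split_ifs at hd with h2
    simp only [Option.some.injEq] at hc hd
    subst hc hd
    have : a.val < b.val := hab
    simp only
    omega

theorem mem_gammaReading {n : ℕ} (q : GammaBox n) : q ∈ gammaReading n := by
  obtain ⟨⟨r, c⟩, h⟩ := q
  simp only [gammaReading, List.mem_flatMap, List.mem_filterMap, List.mem_reverse,
    List.mem_finRange, true_and]
  exact ⟨r, c, dif_pos h⟩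

theorem pairwise_xReading (n k : ℕ) : (xReading n k).Pairwise xOrder := by
  rw [xReading, List.pairwise_flatMap]
  constructor
  · intro i _
    rw [List.pairwise_map]
    exact (pairwise_gammaReading n).imp fun h => Or.inr ⟨rfl, h⟩
  · rw [List.pairwise_reverse]
    refine (List.pairwise_lt_finRange k).imp ?_
    intro a b hab p hp q hq
    obtain ⟨c, -, rfl⟩ := List.mem_map.1 hp
    obtain ⟨d, -, rfl⟩ := List.mem_map.1 hq
    exact Or.inl hab

theorem mem_xReading {n k : ℕ} (p : Fin k × GammaBox n) : p ∈ xReading n k := by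
  simp only [xReading, List.mem_flatMap, List.mem_reverse, List.mem_finRange, true_and,
    List.mem_map]
  exact ⟨p.1, p.2, mem_gammaReading _, rfl⟩

theorem pairwise_stairReading (n : ℕ) : (stairReading n).Pairwise zOrder := by
  rw [stairReading, List.pairwise_flatMap]
  constructor
  · intro r _
    rw [List.pairwise_filterMap, List.pairwise_reverse]
    refine (List.pairwise_lt_finRange n).imp ?_
    intro a b hab p hp q hq
    split_ifs at hp with h1
    split_ifs at hq with h2
    simp only [Option.some.injEq] at hp hq
    subst hp hq
    exact Or.inr ⟨rfl, hab⟩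
  · refine (List.pairwise_lt_finRange n).imp ?_
    intro a b hab p hp q hq
    obtain ⟨c, -, hc⟩ := List.mem_filterMap.1 hp
    obtain ⟨d, -, hd⟩ := List.mem_filterMap.1 hq
    split_ifs at hc with h1
    split_ifs at hd with h2
    simp only [Option.some.injEq] at hc hd
    subst hc hd
    exact Or.inl hab

theorem mem_stairReading {n : ℕ} (q : StairBox n) : q ∈ stairReading n := by
  obtain ⟨⟨r, c⟩, h⟩ := q
  simp only [stairReading, List.mem_flatMap, List.mem_filterMap, List.mem_reverse,
    List.mem_finRange, true_and]
  exact ⟨r, c, dif_pos h⟩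

theorem nodup_xReading (n k : ℕ) : (xReading n k).Nodup :=
  (pairwise_xReading n k).imp fun {p q} h hpq => by
    subst hpq
    rcases h with h | h
    · exact lt_irrefl _ h
    · exact lt_irrefl _ h.2

theorem nodup_stairReading (n : ℕ) : (stairReading n).Nodup :=
  (pairwise_stairReading n).imp fun {p q} h hpq => by
    subst hpq
    rcases h with h | h
    · exact lt_irrefl _ h
    · exact lt_irrefl _ h.2

/-- The boxes of the base in reading order. -/
def boxReading (n k : ℕ) : List (Box n k) :=
  (xReading n k).map Sum.inl ++ (stairReading n).map Sum.inr

theorem nodup_boxReading (n k : ℕ) : (boxReading n k).Nodup := by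
  refine List.Nodup.append ((nodup_xReading n k).map Sum.inl_injective)
    ((nodup_stairReading n).map Sum.inr_injective) ?_
  intro q h1 h2
  obtain ⟨_, _, rfl⟩ := List.mem_map.1 h1
  obtain ⟨_, _, h⟩ := List.mem_map.1 h2
  cases h

theorem mem_boxReading {n k : ℕ} (q : Box n k) : q ∈ boxReading n k := by
  rw [boxReading, List.mem_append]
  rcases q with q | q
  · exact Or.inl (List.mem_map_of_mem (mem_xReading q))
  · exact Or.inr (List.mem_map_of_mem (mem_stairReading q))

theorem Tile.Fits.letter_eq {t : Tile} {l : ℕ} (h : t.Fits l) :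
    t.letter l = if t.wt = 1 then some l else none := by
  unfold Tile.Fits at h
  split_ifs at h with h0 <;> rcases h with rfl | rfl <;> simp [Tile.letter, Tile.wt, h0]

theorem filterMap_ite_eq_map_filter {γ δ : Type*} (p : γ → Prop) [DecidablePred p] (f : γ → δ)
    (l : List γ) : (l.filterMap fun q => if p q then some (f q) else none) =
      (l.filter fun q => decide (p q)).map f := by
  induction l with
  | nil => rfl
  | cons q l ih =>
    by_cases h : p q <;> simp [h, ih]

section

variable {n k : ℕ}

/-- The contents of a box labelled `l` that is significant or not. -/
def tileOf (l : ℕ) (s : Prop) [Decidable s] : Tile :=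
  if s then (if l = 0 then .faucet else .cross) else (if l = 0 then .elbow else .elbows)

/-- A pipe dream is determined by its set of significant boxes. -/
noncomputable def pipeDreamEquiv (n k : ℕ) : BPipeDream n k ≃ Finset (Box n k) where
  toFun D := Finset.univ.filter fun q => (D.1 q).wt = 1
  invFun S := ⟨fun q => tileOf (label q) (q ∈ S), fun q => by
    unfold tileOf Tile.Fits
    by_cases hq : q ∈ S <;> by_cases h0 : label q = 0 <;> simp [hq, h0]⟩
  left_inv D := by
    refine Subtype.ext (funext fun q => ?_)
    have h := D.2 q
    simp only [Finset.mem_filter, Finset.mem_univ, true_and]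
    unfold Tile.Fits at h
    unfold tileOf
    split_ifs at h with h0 <;> rcases h with h | h <;> simp [h, Tile.wt, h0]
  right_inv S := by
    ext q
    simp only [Finset.mem_filter, Finset.mem_univ, true_and]
    unfold tileOf
    split_ifs with h1 h2 <;> simp [Tile.wt, h1]

/-- The significant boxes of the Gamma-blocks in reading order. -/
def BPipeDream.listX (D : BPipeDream n k) : List (Fin k × GammaBox n) :=
  (xReading n k).filter fun q => (D.1 (.inl q)).wt = 1

/-- The significant boxes of the staircase in reading order. -/
def BPipeDream.listZ (D : BPipeDream n k) : List (StairBox n) :=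
  (stairReading n).filter fun q => (D.1 (.inr q)).wt = 1

theorem BPipeDream.wordX_eq (D : BPipeDream n k) :
    D.wordX = D.listX.map fun q => gammaLabel q.2 := by
  have h : ∀ q : Fin k × GammaBox n, (D.1 (.inl q)).letter (gammaLabel q.2) =
      if (D.1 (.inl q)).wt = 1 then some (gammaLabel q.2) else none := fun q =>
    (D.2 (.inl q)).letter_eq
  rw [listX, ← filterMap_ite_eq_map_filter, wordX, xReading, List.filterMap_flatMap]
  congr 1
  funext i
  rw [List.filterMap_map]
  congr 1
  funext q
  exact h (i, q)

theorem BPipeDream.wordZ_eq (D : BPipeDream n k) : D.wordZ = D.listZ.map stairLabel := by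
  have h : ∀ q : StairBox n, (D.1 (.inr q)).letter (stairLabel q) =
      if (D.1 (.inr q)).wt = 1 then some (stairLabel q) else none := fun q =>
    (D.2 (.inr q)).letter_eq
  rw [listZ, ← filterMap_ite_eq_map_filter, wordZ]
  congr 1
  funext q
  exact h q

theorem BPipeDream.word_eq (D : BPipeDream n k) :
    D.word = ((boxReading n k).filter fun q => q ∈ pipeDreamEquiv n k D).map label := by
  rw [word, wordX_eq, wordZ_eq, boxReading, List.filter_append, List.map_append]
  congr 1
  · rw [List.filter_map, List.map_map, listX]
    congr 1
    apply List.filter_congr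
    intro q _
    simp [pipeDreamEquiv]
  · rw [List.filter_map, List.map_map, listZ]
    congr 1
    apply List.filter_congr
    intro q _
    simp [pipeDreamEquiv]

open MvPolynomial in
/-- The variable of a box. -/
noncomputable def boxVar : Box n k → MvPolynomial ZX ℚ
  | .inl q => X (.x q.1.val)
  | .inr q => X (.z q.1.1.val)

open MvPolynomial in
theorem xzMonomial_eq (D : BPipeDream n k) :
    xzMonomial D.α D.β = ∏ q ∈ pipeDreamEquiv n k D, boxVar q := by
  have h1 : (D.α.prod fun i e => (X (.x i) : MvPolynomial ZX ℚ) ^ e) =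
      ∏ q : Fin k × GammaBox n, boxVar (.inl q : Box n k) ^ (D.1 (.inl q)).wt := by
    rw [BPipeDream.α, ← Finsupp.prod_finsetSum_index (fun _ => pow_zero _)
      fun _ _ _ => pow_add _ _ _]
    refine Finset.prod_congr rfl fun q _ => ?_
    exact Finsupp.prod_single_index (h := fun i e => (X (.x i) : MvPolynomial ZX ℚ) ^ e)
      (pow_zero _)
  have h2 : (D.β.prod fun i e => (X (.z i) : MvPolynomial ZX ℚ) ^ e) =
      ∏ q : StairBox n, boxVar (.inr q : Box n k) ^ (D.1 (.inr q)).wt := by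
    rw [BPipeDream.β, ← Finsupp.prod_finsetSum_index (fun _ => pow_zero _)
      fun _ _ _ => pow_add _ _ _]
    refine Finset.prod_congr rfl fun q _ => ?_
    exact Finsupp.prod_single_index (h := fun i e => (X (.z i) : MvPolynomial ZX ℚ) ^ e)
      (pow_zero _)
  rw [xzMonomial, h1, h2, ← Fintype.prod_sum_type (fun q : Box n k => boxVar q ^ (D.1 q).wt),
    pipeDreamEquiv, Equiv.coe_fn_mk, Finset.prod_filter]
  refine Finset.prod_congr rfl fun q _ => ?_
  cases D.1 q <;> simp [Tile.wt]

end

/-! ### Expansion of products -/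

/-- The u q need not commute, so each subset contributes its factors in the order of the list. -/
theorem prod_one_add_smul {R B ι : Type*} [CommRing R] [Ring B] [Algebra R B] [DecidableEq ι]
    (c : ι → R) (u : ι → B) {l : List ι} (hl : l.Nodup) :
    (l.map fun q => 1 + c q • u q).prod =
      ∑ S ∈ l.toFinset.powerset, (∏ q ∈ S, c q) • ((l.filter fun q => q ∈ S).map u).prod := by
  induction l with
  | nil => simp
  | cons a l ih =>
    have ha : a ∉ l := (List.nodup_cons.1 hl).1
    have ha' : a ∉ l.toFinset := by simpa using ha
    rw [List.map_cons, List.prod_cons, ih (List.nodup_cons.1 hl).2, List.toFinset_cons,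
      Finset.sum_powerset_insert ha', add_mul, one_mul, Finset.mul_sum]
    congr 1
    · refine Finset.sum_congr rfl fun S hS => ?_
      have : a ∉ S := fun h => ha' (Finset.mem_powerset.1 hS h)
      rw [List.filter_cons_of_neg (by simpa using this)]
    · refine Finset.sum_congr rfl fun S hS => ?_
      have haS : a ∉ S := fun h => ha' (Finset.mem_powerset.1 hS h)
      rw [Finset.prod_insert haS, List.filter_cons_of_pos (by simp), List.map_cons, List.prod_cons,
        smul_mul_smul_comm]
      congr 4
      apply List.filter_congr
      intro q hq
      have : q ≠ a := fun h => ha (h ▸ hq)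
      simp [this]

section

variable {R B : Type*} [CommRing R] [Ring B] [Algebra R B] (u : ℕ → B)

theorem prod_reverse_range_factor (x : R) (m i : ℕ) :
    ((List.range m).reverse.map fun c => factor u (i + c) x).prod = descProd u x m i := by
  induction m generalizing i with
  | zero => rfl
  | succ m ih =>
    rw [List.range_succ_eq_map, List.reverse_cons, List.map_append, List.prod_append, descProd,
      ← ih, ← List.map_reverse, List.map_map, List.map_singleton, List.prod_singleton, add_zero]
    congr 3
    funext c
    simp only [Function.comp_apply, Nat.succ_eq_add_one]
    congr 1
    omega

theorem prod_range_factor (x : R) (m i : ℕ) :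
    ((List.range m).map fun c => factor u (i + c) x).prod = ascProd u x m i := by
  induction m generalizing i with
  | zero => rfl
  | succ m ih =>
    rw [List.range_succ_eq_map, List.map_cons, List.prod_cons, ascProd, ← ih, List.map_map,
      add_zero]
    congr 3
    funext c
    simp only [Function.comp_apply, Nat.succ_eq_add_one]
    congr 1
    omega

theorem map_gammaLabel_gammaReading (m : ℕ) : (gammaReading (m + 1)).map gammaLabel =
    (List.range (m + 1)).reverse ++ (List.range m).map fun c => 1 + c := by
  have hrow : ∀ r : Fin (m + 1), ((List.finRange (m + 1)).reverse.filterMap fun c =>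
      if h : r.val = 0 ∨ c.val = 0 then some (⟨(r, c), h⟩ : GammaBox (m + 1)) else none).map
        gammaLabel = if r = 0 then (List.range (m + 1)).reverse else [r.val] := by
    intro r
    rw [List.map_filterMap]
    split_ifs with hr
    · subst hr
      rw [← List.map_coe_finRange_eq_range, ← List.map_reverse, ← List.filterMap_eq_map]
      congr 1
      funext c
      simp [gammaLabel]
    · have hr' : r.val ≠ 0 := fun h => hr (Fin.ext h)
      rw [List.finRange_succ, List.reverse_cons, List.filterMap_append]
      have h1 : ((List.finRange m).map Fin.succ).reverse.filterMap (fun c =>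
          Option.map gammaLabel (if h : r.val = 0 ∨ c.val = 0 then
            some (⟨(r, c), h⟩ : GammaBox (m + 1)) else none)) = [] := by
        rw [List.filterMap_eq_nil_iff]
        intro c hc
        simp only [List.mem_reverse, List.mem_map, List.mem_finRange, true_and] at hc
        obtain ⟨d, rfl⟩ := hc
        simp [hr']
      rw [h1]
      simp [gammaLabel]
  rw [gammaReading, List.map_flatMap]
  simp only [hrow]
  rw [List.finRange_succ, List.flatMap_cons, if_pos rfl, List.flatMap_map,
    ← List.map_coe_finRange_eq_range (n := m), List.map_map, List.map_eq_flatMap]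
  congr 2
  funext r
  rw [if_neg (Fin.succ_ne_zero r)]
  simp [add_comm]

theorem filter_range_lt {m n : ℕ} (h : m ≤ n) :
    ((List.range n).filter fun c => decide (c < m)) = List.range m := by
  obtain ⟨d, rfl⟩ := Nat.exists_eq_add_of_le h
  rw [List.range_add, List.filter_append, List.filter_eq_self.2, List.filter_eq_nil_iff.2,
    List.append_nil]
  · intro c hc
    obtain ⟨e, -, rfl⟩ := List.mem_map.1 hc
    simp
  · intro c hc
    simpa using hc

theorem prod_gammaReading {n : ℕ} (hu : ∀ i, n ≤ i → u i = 0) (x : R) :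
    ((gammaReading n).map fun q => factor u (gammaLabel q) x).prod =
      gammaProd u 1 (n - 1) x := by
  cases n with
  -- For n = 0 there are no boxes, but `gammaProd` keeps its factor in u 0, which is 1 since u 0 =
  -- 0.
  | zero => simp [gammaReading, gammaProd, descProd, ascProd, factor, hu 0 le_rfl]
  | succ m =>
    have h := map_gammaLabel_gammaReading m
    have : ((gammaReading (m + 1)).map fun q => factor u (gammaLabel q) x) =
        ((gammaReading (m + 1)).map gammaLabel).map fun i => factor u i x := by
      rw [List.map_map]; rfl
    rw [this, h, List.map_append, List.prod_append, List.map_map, Nat.add_sub_cancel, gammaProd,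
      one_mul]
    congr 1
    · have := prod_reverse_range_factor u x (m + 1) 0
      simp only [zero_add] at this
      rw [this]
      rfl
    · exact prod_range_factor u x m 1

theorem map_stairLabel_row (n : ℕ) (r : Fin n) :
    ((List.finRange n).reverse.filterMap fun c =>
      if h : r.val + c.val + 1 < n then some (⟨(r, c), h⟩ : StairBox n) else none).map stairLabel =
    (List.range (n - 1 - r.val)).reverse.map fun c : ℕ => r.val + 1 + c := by
  rw [List.map_filterMap]
  have h1 : (fun c : Fin n => Option.map stairLabel (if h : r.val + c.val + 1 < n then
      some (⟨(r, c), h⟩ : StairBox n) else none)) =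
      (fun c : ℕ => if c < n - 1 - r.val then some (r.val + 1 + c) else none) ∘ Fin.val := by
    funext c
    simp only [Function.comp_apply]
    by_cases h : r.val + c.val + 1 < n
    · rw [dif_pos h, if_pos (by omega)]
      simp [stairLabel]
      omega
    · rw [dif_neg h, if_neg (by omega)]
      rfl
  rw [h1, ← List.filterMap_map, List.map_reverse, List.map_coe_finRange_eq_range,
    filterMap_ite_eq_map_filter, List.filter_reverse, filter_range_lt (by omega)]

theorem stairProd_eq_prod (z : ℕ → R) (m i : ℕ) : stairProd u z m i =
    ((List.range (m + 1)).map fun r => descProd u (z (i + r)) (m - r) (i + r + 1)).prod := by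
  induction m generalizing i with
  | zero => simp [stairProd, descProd]
  | succ m ih =>
    rw [stairProd, List.range_succ_eq_map, List.map_cons, List.prod_cons, ih, List.map_map]
    congr 3
    funext r
    simp only [Function.comp_apply, Nat.succ_eq_add_one]
    rw [show i + 1 + r = i + (r + 1) by omega, show m + 1 - (r + 1) = m - r by omega]

theorem prod_stairReading (n : ℕ) (z : ℕ → R) :
    ((stairReading n).map fun q => factor u (stairLabel q) (z q.1.1)).prod =
      stairProd u z (n - 1) 0 := by
  have hrow : ∀ r : Fin n, (((List.finRange n).reverse.filterMap fun c =>
      if h : r.val + c.val + 1 < n then some (⟨(r, c), h⟩ : StairBox n) else none).map fun q =>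
        factor u (stairLabel q) (z q.1.1)).prod = descProd u (z r) (n - 1 - r) (r + 1) := by
    intro r
    rw [← prod_reverse_range_factor]
    have h := congr_arg (List.map fun l => factor u l (z r)) (map_stairLabel_row n r)
    rw [List.map_map, List.map_map] at h
    rw [show (fun c : ℕ => factor u (r.val + 1 + c) (z r.val)) =
      (fun l => factor u l (z r)) ∘ fun c => r.val + 1 + c from rfl, ← h]
    congr 1
    apply List.map_congr_left
    intro q hq
    obtain ⟨c, -, hc⟩ := List.mem_filterMap.1 hq
    split_ifs at hc
    simp only [Option.some.injEq] at hc
    subst hc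
    rfl
  have hall : ((stairReading n).map fun q => factor u (stairLabel q) (z q.1.1)).prod =
      ((List.finRange n).map fun r : Fin n =>
        descProd u (z r.val) (n - 1 - r.val) (r.val + 1)).prod := by
    rw [stairReading, List.map_flatMap, List.flatMap, List.prod_flatten, List.map_map]
    congr 1
    apply List.map_congr_left
    intro r _
    exact hrow r
  rw [hall]
  cases n with
  | zero => simp [stairProd]
  | succ m =>
    rw [Nat.add_sub_cancel, stairProd_eq_prod, ← List.map_coe_finRange_eq_range, List.map_map]
    simp only [zero_add]
    rfl

end

end SignedPD

namespace SignedPD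

open MvPolynomial

/-! ### Pipe dreams and truncated Schubert polynomials -/

/-- The product of the Gamma-blocks `k - 1, …, 0`. -/
noncomputable def blockProd {n : ℕ} {R : Type*} [CommRing R] (c : R) (x : ℕ → R) (k : ℕ) :
    Matrix (BC n) (BC n) R :=
  ((List.range k).reverse.map fun i => gammaProd (nilMat R n) c (n - 1) (x i)).prod

theorem blockProd_succ {n : ℕ} {R : Type*} [CommRing R] (c : R) (x : ℕ → R) (k : ℕ) :
    (blockProd c x (k + 1) : Matrix (BC n) (BC n) R) =
      gammaProd (nilMat R n) c (n - 1) (x k) * blockProd c x k := by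
  rw [blockProd, List.range_succ, List.reverse_append]
  rfl

/-- The commuting exponents turn a sum of powers of k variables into a product of k Γ-factors; this
is what truncation does to the exponential. -/
theorem exp_gammaLog_sum {n J : ℕ} (hJ : IsLogBound n J) {R : Type} [CommRing R] [Algebra ℚ R]
    (x : ℕ → R) (k : ℕ) :
    IsNilpotent.exp (gammaLog n (n - 1) J fun j => ∑ i ∈ Finset.range k, x i ^ (2 * j + 1)) =
      blockProd 2 x k := by
  induction k with
  | zero => simp [gammaLog_zero, blockProd]
  | succ k ih =>
    rw [blockProd_succ, ← ih, ← hJ R (x k), ← exp_gammaLog_add]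
    congr 2
    funext j
    rw [Finset.sum_range_succ, add_comm]

/-- The product over all boxes of the base. -/
noncomputable def baseProd (n k : ℕ) (c : MvPolynomial ZX ℚ) :
    Matrix (BC n) (BC n) (MvPolynomial ZX ℚ) :=
  blockProd c (fun i => (X (ZX.x i) : MvPolynomial ZX ℚ)) k *
    stairProd (nilMat _ n) (fun i => (X (ZX.z i) : MvPolynomial ZX ℚ)) (n - 1) 0

theorem truncation_schubertMat {n J : ℕ} (hJ : IsLogBound n J) (k : ℕ) :
    (truncation k).toRingHom.mapMatrix (schubertMat n J) =
      baseProd n k 2 := by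
  rw [baseProd, schubertMat, map_mul, map_exp_gammaLog, map_stairProd_nilMat, ← exp_gammaLog_sum hJ]
  congr 2
  · congr 1
    funext j
    simp [truncation]
  · funext j
    simp [truncation]

/-! ### Comparison of types B and C by a diagonal conjugation -/

section

variable {n : ℕ} {R : Type*} [CommRing R]

/-- The diagonal matrix with the powers of two that relate the types B and C. -/
noncomputable def signDiag (R : Type*) [CommRing R] (n : ℕ) : Matrix (BC n) (BC n) R :=
  Matrix.diagonal fun w => 2 ^ numSigns w.1

/-- Appending s_0 at an ascent adds one sign change, so moving the diagonal matrix past u_0 costs a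
factor 2; the other generators preserve the number of sign changes and commute with it. -/
theorem nilMat_zero_mul_signDiag :
    nilMat R n 0 * signDiag R n = (2 : R) • (signDiag R n * nilMat R n 0) := by
  ext v w
  rw [signDiag, Matrix.mul_diagonal, Matrix.smul_apply, Matrix.diagonal_mul, smul_eq_mul]
  simp only [nilMat, Matrix.of_apply]
  split_ifs with h
  · rw [h.1, ← numSigns_mul_gen_zero h.2, pow_succ]
    ring
  · simp

theorem nilMat_mul_signDiag {i : ℕ} (hi : i ≠ 0) :
    Commute (nilMat R n i) (signDiag R n) := by
  ext v w
  rw [signDiag, Matrix.mul_diagonal, Matrix.diagonal_mul]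
  simp only [nilMat, Matrix.of_apply]
  split_ifs with h
  · rw [h.1, numSigns_mul_gen_of_ne_zero w.1 hi, mul_comm]
  · simp

theorem descProd_mul_signDiag (x : R) (m : ℕ) {i : ℕ} (hi : 1 ≤ i) :
    Commute (descProd (nilMat R n) x m i) (signDiag R n) :=
  (commute_descProd (fun _ hj => (nilMat_mul_signDiag (by omega)).symm) x m).symm

theorem ascProd_mul_signDiag (x : R) (m : ℕ) {i : ℕ} (hi : 1 ≤ i) :
    Commute (ascProd (nilMat R n) x m i) (signDiag R n) := by
  induction m generalizing i with
  | zero => exact Commute.one_left _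
  | succ m ih =>
    exact ((Commute.one_left _).add_left ((nilMat_mul_signDiag (by omega)).smul_left x)).mul_left
      (ih (by omega))

theorem stairProd_mul_signDiag (z : ℕ → R) (m i : ℕ) :
    Commute (stairProd (nilMat R n) z m i) (signDiag R n) := by
  induction m generalizing i with
  | zero => exact Commute.one_left _
  | succ m ih => exact (descProd_mul_signDiag _ _ (by omega)).mul_left (ih _)

theorem gammaProd_mul_signDiag (m : ℕ) (x : R) :
    gammaProd (nilMat R n) 1 m x * signDiag R n = signDiag R n * gammaProd (nilMat R n) 2 m x := by
  have h0 : factor (nilMat R n) 0 (1 * x) * signDiag R n =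
      signDiag R n * factor (nilMat R n) 0 (2 * x) := by
    rw [factor, factor, add_mul, mul_add, one_mul, mul_one, one_mul, smul_mul_assoc,
      nilMat_zero_mul_signDiag, mul_smul_comm, smul_smul, mul_comm x]
  rw [gammaProd, gammaProd, mul_assoc, (ascProd_mul_signDiag x m le_rfl).eq, ← mul_assoc,
    mul_assoc (descProd _ _ _ _), h0, ← mul_assoc, (descProd_mul_signDiag x m le_rfl).eq]
  simp only [mul_assoc]

theorem blockProd_mul_signDiag (x : ℕ → R) (k : ℕ) :
    blockProd 1 x k * signDiag R n = signDiag R n * blockProd 2 x k := by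
  induction k with
  | zero => simp [blockProd]
  | succ k ih =>
    rw [blockProd_succ, blockProd_succ, mul_assoc, ih, ← mul_assoc, gammaProd_mul_signDiag,
      mul_assoc]

/-- In the row of the identity the diagonal matrix acts trivially on the left, so only the power of
2 of the column w remains. -/
theorem blockProd_mul_stairProd_apply (x z : ℕ → R) (k m : ℕ) (w : BC n) :
    2 ^ numSigns w.1 *
        (blockProd 1 x k * stairProd (nilMat R n) z m 0 : Matrix (BC n) (BC n) R) 1 w =
      (blockProd 2 x k * stairProd (nilMat R n) z m 0 : Matrix (BC n) (BC n) R) 1 w := by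
  have h : blockProd 1 x k * stairProd (nilMat R n) z m 0 * signDiag R n =
      signDiag R n * (blockProd 2 x k * stairProd (nilMat R n) z m 0) := by
    rw [mul_assoc, (stairProd_mul_signDiag z m 0).eq, ← mul_assoc, blockProd_mul_signDiag,
      mul_assoc]
  have h1 := congr_fun (congr_fun h 1) w
  have h2 : numSigns (1 : BC n).1 = 0 := numSigns_one
  rw [signDiag, Matrix.mul_diagonal, Matrix.diagonal_mul, h2, pow_zero, one_mul] at h1
  rw [← h1, mul_comm]

end

theorem prod_boxReading (n k : ℕ) :
    ((boxReading n k).map fun q =>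
      1 + boxVar q • nilMat (MvPolynomial ZX ℚ) n (label q)).prod =
    baseProd n k 1 := by
  rw [baseProd, boxReading, List.map_append, List.prod_append, List.map_map, List.map_map]
  congr 1
  · rw [xReading, List.map_flatMap, List.flatMap, List.prod_flatten, List.map_map, blockProd,
      ← List.map_coe_finRange_eq_range, ← List.map_reverse, List.map_map]
    congr 1
    apply List.map_congr_left
    intro i _
    simp only [Function.comp_apply]
    rw [← prod_gammaReading _ fun i => nilMat_eq_zero, List.map_map]
    rfl
  · rw [← prod_stairReading]
    rfl

theorem baseProd_eq_sum (n k : ℕ) :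
    baseProd n k 1 =
    ∑ D : BPipeDream n k, xzMonomial D.α D.β • (D.word.map (nilMat _ n)).prod := by
  classical
  have huniv : (boxReading n k).toFinset = Finset.univ := by
    ext q
    simp [mem_boxReading]
  rw [← prod_boxReading, prod_one_add_smul _ (fun q => nilMat (MvPolynomial ZX ℚ) n (label q))
    (nodup_boxReading n k), huniv, Finset.powerset_univ,
    ← (pipeDreamEquiv n k).sum_comp]
  refine Finset.sum_congr rfl fun D _ => ?_
  rw [xzMonomial_eq, BPipeDream.word_eq, List.map_map]
  congr! 4

theorem mem_PD_iff {n k : ℕ} {w : BCInf} {D : BPipeDream n k} :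
    D ∈ PD n k w ↔ D.word ∈ reducedWords w := by
  classical
  rw [PD, Finset.mem_filter, and_iff_right (Finset.mem_univ D)]
  constructor
  · rintro ⟨h, rfl⟩
    exact h
  · intro h
    have : D.shape = w := h.1
    refine ⟨?_, this⟩
    rw [BPipeDream.IsReduced, this]
    exact h

theorem sum_PD_eq_truncation {n : ℕ} (k : ℕ) {w : BCInf} (hw : w ∈ BC n) :
    ∑ D ∈ PD n k w, xzMonomial D.α D.β = truncation k (schubertB w) := by
  classical
  have hsum : ∑ D ∈ PD n k w, xzMonomial D.α D.β =
      baseProd n k 1 1 ⟨w, hw⟩ := by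
    rw [baseProd_eq_sum, Matrix.sum_apply, PD, Finset.sum_filter]
    refine Finset.sum_congr rfl fun D _ => ?_
    rw [Matrix.smul_apply, prod_nilMat_one_apply, smul_eq_mul, mul_ite, mul_one, mul_zero]
    refine if_congr ?_ rfl rfl
    have := mem_PD_iff (D := D) (w := w)
    rwa [PD, Finset.mem_filter, and_iff_right (Finset.mem_univ D)] at this
  have hC : truncation k (schubertC w) =
      baseProd n k 2 1 ⟨w, hw⟩ := by
    rw [← truncation_schubertMat (isLogBound_logBound n), schubertC_eq, schubertFamily_eq hw,
      schubertFin, dif_pos hw]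
    rfl
  have key : 2 ^ numSigns w * baseProd n k 1 1 ⟨w, hw⟩ = baseProd n k 2 1 ⟨w, hw⟩ :=
    blockProd_mul_stairProd_apply _ _ k (n - 1) ⟨w, hw⟩
  have h2 : (2 : MvPolynomial ZX ℚ) ^ numSigns w = C (2 ^ numSigns w) := by
    rw [C_pow, map_ofNat]
  rw [hsum, schubertB, map_smul, hC, ← key, h2, ← smul_eq_C_mul, smul_smul,
    inv_mul_cancel₀ (by positivity), one_smul]

end SignedPD

namespace SignedPD

/-! ### Counting signings of valley-shaped words -/

/-- The order of signed letters: blocks decrease, and the letters of a block increase. -/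
def signOrder (p q : ℤ × ℕ) : Prop := q.2 < p.2 ∨ p.2 = q.2 ∧ p.1 < q.1

instance : DecidableRel signOrder := fun p q => by
  unfold signOrder
  infer_instance

instance : IsTrans (ℤ × ℕ) signOrder := ⟨fun a b c => by
  unfold signOrder
  omega⟩

/-- The letter and the block of a signed letter. -/
def unsign (p : ℤ × ℕ) : ℕ × ℕ := (p.1.natAbs, p.2)

/-- The signings of the word `L` that increase in the order `signOrder`. -/
def signings (L : List (ℕ × ℕ)) : Set (List (ℤ × ℕ)) :=
  {t | t.map unsign = L ∧ t.Pairwise signOrder}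

/-- The number of signings of `L` that can follow the signed letter `p`. -/
def numFollow (p : ℤ × ℕ) : List (ℕ × ℕ) → ℕ
  | [] => 1
  | q :: L => (if signOrder p (q.1, q.2) then numFollow (q.1, q.2) L else 0) +
      if q.1 ≠ 0 ∧ signOrder p (-q.1, q.2) then numFollow (-q.1, q.2) L else 0

/-- The number of signings of `L`. -/
def numSignings : List (ℕ × ℕ) → ℕ
  | [] => 1
  | q :: L => numFollow (q.1, q.2) L + if q.1 ≠ 0 then numFollow (-q.1, q.2) L else 0

/-- The signings of `L` that can follow the signed letter `p`. -/
def followers (p : ℤ × ℕ) (L : List (ℕ × ℕ)) : Set (List (ℤ × ℕ)) :=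
  {t | t.map unsign = L ∧ (p :: t).Pairwise signOrder}

theorem pairwise_cons_cons_signOrder (p q : ℤ × ℕ) (t : List (ℤ × ℕ)) :
    (p :: q :: t).Pairwise signOrder ↔ signOrder p q ∧ (q :: t).Pairwise signOrder := by
  rw [← List.isChain_iff_pairwise, ← List.isChain_iff_pairwise, List.isChain_cons_cons]

theorem unsign_eq_iff (p : ℤ × ℕ) (q : ℕ × ℕ) :
    unsign p = q ↔ p = ((q.1 : ℤ), q.2) ∨ q.1 ≠ 0 ∧ p = (-(q.1 : ℤ), q.2) := by
  obtain ⟨s, i⟩ := p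
  obtain ⟨x, j⟩ := q
  simp only [unsign, Prod.mk.injEq]
  omega

theorem signings_cons (q : ℕ × ℕ) (L : List (ℕ × ℕ)) : signings (q :: L) =
    (fun t => ((q.1 : ℤ), q.2) :: t) '' followers (q.1, q.2) L ∪
      if q.1 ≠ 0 then (fun t => (-(q.1 : ℤ), q.2) :: t) '' followers (-q.1, q.2) L else ∅ := by
  ext t
  simp only [signings, followers, Set.mem_union, Set.mem_image, Set.mem_ofPred_eq]
  constructor
  · rintro ⟨h1, h2⟩
    cases t with
    | nil => simp at h1
    | cons p t =>
      rw [List.map_cons, List.cons.injEq, unsign_eq_iff] at h1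
      obtain ⟨rfl | ⟨h0, rfl⟩, h1⟩ := h1
      · exact Or.inl ⟨t, ⟨h1, h2⟩, rfl⟩
      · right
        rw [if_pos h0]
        exact ⟨t, ⟨h1, h2⟩, rfl⟩
  · rintro (⟨t, ⟨h1, h2⟩, rfl⟩ | h)
    · exact ⟨by simp [h1, unsign], h2⟩
    · split_ifs at h with h0
      · obtain ⟨t, ⟨h1, h2⟩, rfl⟩ := h
        exact ⟨by simp [h1, unsign], h2⟩
      · exact h.elim

theorem followers_cons (p : ℤ × ℕ) (q : ℕ × ℕ) (L : List (ℕ × ℕ)) : followers p (q :: L) =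
    (if signOrder p (q.1, q.2) then (fun t => ((q.1 : ℤ), q.2) :: t) '' followers (q.1, q.2) L
      else ∅) ∪
    if q.1 ≠ 0 ∧ signOrder p (-q.1, q.2) then
      (fun t => (-(q.1 : ℤ), q.2) :: t) '' followers (-q.1, q.2) L else ∅ := by
  ext t
  simp only [Set.mem_union]
  constructor
  · rintro ⟨h1, h2⟩
    cases t with
    | nil => simp at h1
    | cons p t =>
      rw [List.map_cons, List.cons.injEq, unsign_eq_iff] at h1
      rw [pairwise_cons_cons_signOrder] at h2
      obtain ⟨rfl | ⟨h0, rfl⟩, h1⟩ := h1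
      · left
        rw [if_pos h2.1]
        exact ⟨t, ⟨h1, h2.2⟩, rfl⟩
      · right
        rw [if_pos ⟨h0, h2.1⟩]
        exact ⟨t, ⟨h1, h2.2⟩, rfl⟩
  · rintro (h | h)
    · split_ifs at h with h0
      · obtain ⟨t, ⟨h1, h2⟩, rfl⟩ := h
        exact ⟨by simp [h1, unsign], (pairwise_cons_cons_signOrder _ _ _).2 ⟨h0, h2⟩⟩
      · exact h.elim
    · split_ifs at h with h0
      · obtain ⟨t, ⟨h1, h2⟩, rfl⟩ := h
        exact ⟨by simp [h1, unsign], (pairwise_cons_cons_signOrder _ _ _).2 ⟨h0.2, h2⟩⟩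
      · exact h.elim

theorem disjoint_cons_image {x : ℕ} (hx : x ≠ 0) (i : ℕ) (A B : Set (List (ℤ × ℕ))) :
    Disjoint ((fun t => ((x : ℤ), i) :: t) '' A) ((fun t => (-(x : ℤ), i) :: t) '' B) := by
  rw [Set.disjoint_left]
  rintro _ ⟨t, -, rfl⟩ ⟨s, -, h⟩
  simp only [List.cons.injEq, Prod.mk.injEq] at h
  omega

theorem finite_ncard_followers (L : List (ℕ × ℕ)) : ∀ p : ℤ × ℕ,
    (followers p L).Finite ∧ (followers p L).ncard = numFollow p L := by
  induction L with
  | nil =>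
    intro p
    have : followers p [] = {[]} := by
      ext t
      simp only [followers, Set.mem_ofPred_eq, List.map_eq_nil_iff, Set.mem_singleton_iff]
      constructor
      · exact fun h => h.1
      · rintro rfl
        simp
    rw [this]
    simp [numFollow]
  | cons q L ih =>
    intro p
    have hfin : ∀ s : ℤ, ((fun t => (s, q.2) :: t) '' followers (s, q.2) L).Finite :=
      fun s => (ih _).1.image _
    have hcard : ∀ s : ℤ, ((fun t => (s, q.2) :: t) '' followers (s, q.2) L).ncard =
        numFollow (s, q.2) L := fun s => by
      rw [Set.ncard_image_of_injective _ List.cons_injective, (ih _).2]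
    rw [followers_cons, numFollow]
    split_ifs with h1 h2 h2
    · refine ⟨(hfin _).union (hfin _), ?_⟩
      rw [Set.ncard_union_eq (disjoint_cons_image h2.1 _ _ _) (hfin _) (hfin _), hcard, hcard]
    · simp [hfin, hcard]
    · simp [hfin, hcard]
    · simp

theorem finite_ncard_signings (L : List (ℕ × ℕ)) :
    (signings L).Finite ∧ (signings L).ncard = numSignings L := by
  cases L with
  | nil =>
    have : signings [] = {[]} := by
      ext t
      simp only [signings, Set.mem_ofPred_eq, List.map_eq_nil_iff, Set.mem_singleton_iff]
      constructor
      · exact fun h => h.1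
      · rintro rfl
        simp
    rw [this]
    simp [numSignings]
  | cons q L =>
    have ih := finite_ncard_followers L
    have hfin : ∀ s : ℤ, ((fun t => (s, q.2) :: t) '' followers (s, q.2) L).Finite :=
      fun s => (ih _).1.image _
    have hcard : ∀ s : ℤ, ((fun t => (s, q.2) :: t) '' followers (s, q.2) L).ncard =
        numFollow (s, q.2) L := fun s => by
      rw [Set.ncard_image_of_injective _ List.cons_injective, (ih _).2]
    rw [signings_cons, numSignings]
    split_ifs with h
    · refine ⟨(hfin _).union (hfin _), ?_⟩
      rw [Set.ncard_union_eq (disjoint_cons_image h _ _ _) (hfin _) (hfin _), hcard, hcard]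
    · simp [hfin, hcard]

/-- The letters of `L` are valley-shaped in each block, and the blocks decrease. -/
structure IsValleyShaped (L : List (ℕ × ℕ)) : Prop where
  pairwise : L.Pairwise fun p q => q.2 ≤ p.2
  ne : ∀ l₁ p q l₂, L = l₁ ++ p :: q :: l₂ → p.2 = q.2 → p.1 ≠ q.1
  no_peak : ∀ l₁ p q r l₂, L = l₁ ++ p :: q :: r :: l₂ → p.2 = q.2 → q.2 = r.2 →
    ¬ (p.1 < q.1 ∧ r.1 < q.1)

theorem IsValleyShaped.tail {p : ℕ × ℕ} {L : List (ℕ × ℕ)} (h : IsValleyShaped (p :: L)) :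
    IsValleyShaped L :=
  ⟨(List.pairwise_cons.1 h.pairwise).2,
    fun l₁ a b l₂ e => h.ne (p :: l₁) a b l₂ (by rw [e]; rfl),
    fun l₁ a b c l₂ e => h.no_peak (p :: l₁) a b c l₂ (by rw [e]; rfl)⟩

theorem numFollow_of_lt {s : ℤ} {i : ℕ} {q : ℕ × ℕ} (L : List (ℕ × ℕ)) (h : q.2 < i) :
    numFollow (s, i) (q :: L) = numSignings (q :: L) := by
  simp [numFollow, numSignings, signOrder, h]

/-- If the next letter lies in a lower block, or is larger in the same block and therefore forced to
be positive, the sign of x does not affect what follows. -/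
theorem numFollow_neg {x i : ℕ} {L : List (ℕ × ℕ)}
    (hL : ∀ q L', L = q :: L' → q.2 < i ∨ q.2 = i ∧ x < q.1) :
    numFollow (-(x : ℤ), i) L = numFollow ((x : ℤ), i) L := by
  cases L with
  | nil => rfl
  | cons q L =>
    rcases hL q L rfl with h | ⟨h, h'⟩
    · rw [numFollow_of_lt L h, numFollow_of_lt L h]
    · have e1 : signOrder (-(x : ℤ), i) ((q.1 : ℤ), q.2) := Or.inr ⟨h.symm, by simp only; omega⟩
      have e2 : signOrder ((x : ℤ), i) ((q.1 : ℤ), q.2) := Or.inr ⟨h.symm, by simp only; omega⟩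
      have e3 : ¬ signOrder (-(x : ℤ), i) (-(q.1 : ℤ), q.2) := by
        simp only [signOrder]; omega
      have e4 : ¬ signOrder ((x : ℤ), i) (-(q.1 : ℤ), q.2) := by
        simp only [signOrder]; omega
      rw [numFollow, numFollow, if_pos e1, if_pos e2, if_neg fun h => e3 h.2,
        if_neg fun h => e4 h.2]

/-- In each block the letters fall strictly and then rise strictly. Increasing signed values force
minus signs on the falling part and plus signs on the rising part; only the minimum is free, with
two signs, or one if it is 0. The power of 2 on the left makes up for the zeros. -/
theorem numSignings_eq {L : List (ℕ × ℕ)} (hL : IsValleyShaped L) :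
    2 ^ (L.map Prod.fst).count 0 * numSignings L = 2 ^ (L.map Prod.snd).toFinset.card := by
  have htwo : ∀ x m : ℕ, 2 ^ (List.count 0 [x]) * (m + if x ≠ 0 then m else 0) = 2 * m := by
    intro x m
    by_cases hx : x = 0
    · simp [hx]
    · simp [hx]
      ring
  have hcount : ∀ (q : ℕ × ℕ) (L : List (ℕ × ℕ)), ((q :: L).map Prod.fst).count 0 =
      List.count 0 [q.1] + (L.map Prod.fst).count 0 := by
    intro q L
    rw [List.map_cons, ← List.singleton_append, List.count_append]
  induction L with
  | nil => simp [numSignings]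
  | cons p L ih =>
    cases L with
    | nil =>
      have := htwo p.1 1
      simp only [List.map_cons, List.map_nil, numSignings, numFollow]
      simpa using this
    | cons q L =>
      have hcard_le : ∀ r ∈ q :: L, r.2 ≤ q.2 := by
        intro r hr
        rcases List.mem_cons.1 hr with rfl | hr
        · exact le_rfl
        · exact (List.pairwise_cons.1 hL.tail.pairwise).1 r hr
      have ih := ih hL.tail
      have hle : q.2 ≤ p.2 := (List.pairwise_cons.1 hL.pairwise).1 q (by simp)
      rw [hcount, pow_add]
      rcases hle.lt_or_eq with hlt | heq
      · have hnot : p.2 ∉ ((q :: L).map Prod.snd).toFinset := by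
          rw [List.mem_toFinset, List.mem_map]
          rintro ⟨r, hr, h⟩
          have := hcard_le r hr
          omega
        rw [List.map_cons (f := Prod.snd), List.toFinset_cons, Finset.card_insert_of_notMem hnot,
          pow_succ, ← ih, numSignings, numFollow_of_lt L hlt, numFollow_of_lt L hlt,
          mul_right_comm, htwo]
        ring
      · have hmem : p.2 ∈ ((q :: L).map Prod.snd).toFinset := by simp [heq]
        rw [List.map_cons (f := Prod.snd), List.toFinset_cons, Finset.insert_eq_of_mem hmem, ← ih]
        have hne : p.1 ≠ q.1 := hL.ne [] p q L rfl heq.symm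
        rcases lt_or_gt_of_ne hne with hpq | hpq
        -- Now p is the minimum of the block. The sign of q, free in the tail, becomes positive, and
        -- p takes over the freedom.
        · have e : ∀ s : ℤ, s = p.1 ∨ s = -p.1 → numFollow (s, p.2) (q :: L) =
              numFollow (q.1, q.2) L := by
            intro s hs
            have e1 : signOrder (s, p.2) ((q.1 : ℤ), q.2) :=
              Or.inr ⟨heq.symm, by simp only; omega⟩
            have e2 : ¬ signOrder (s, p.2) (-(q.1 : ℤ), q.2) := by
              simp only [signOrder]; omega
            rw [numFollow, if_pos e1, if_neg fun h => e2 h.2, add_zero]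
          have hneg : numFollow (-(q.1 : ℤ), q.2) L = numFollow ((q.1 : ℤ), q.2) L := by
            refine numFollow_neg fun r L' hr => ?_
            subst hr
            have h1 := hcard_le r (by simp)
            have h2 := hL.tail.ne [] q r L' rfl
            have h3 := hL.no_peak [] p q r L' rfl heq.symm
            rcases h1.lt_or_eq with h | h
            · exact Or.inl h
            · have := h2 h.symm
              have := h3 h.symm
              exact Or.inr ⟨h, by omega⟩
          rw [numSignings, e _ (Or.inl rfl), e _ (Or.inr rfl), numSignings,
            if_pos (show q.1 ≠ 0 by omega), hneg, mul_right_comm, htwo]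
          ring
        -- On the falling part p must be negative, and then q is as free as in the tail.
        · have e1 : numFollow ((p.1 : ℤ), p.2) (q :: L) = 0 := by
            have h1 : ¬ signOrder ((p.1 : ℤ), p.2) ((q.1 : ℤ), q.2) := by
              simp only [signOrder]; omega
            have h2 : ¬ signOrder ((p.1 : ℤ), p.2) (-(q.1 : ℤ), q.2) := by
              simp only [signOrder]; omega
            rw [numFollow, if_neg h1, if_neg fun h => h2 h.2]
          have e2 : numFollow (-(p.1 : ℤ), p.2) (q :: L) = numSignings (q :: L) := by
            have h1 : signOrder (-(p.1 : ℤ), p.2) ((q.1 : ℤ), q.2) :=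
              Or.inr ⟨heq.symm, by simp only; omega⟩
            have h2 : signOrder (-(p.1 : ℤ), p.2) (-(q.1 : ℤ), q.2) :=
              Or.inr ⟨heq.symm, by simp only; omega⟩
            rw [numFollow, if_pos h1, numSignings]
            simp only [h2, and_true]
          have hp0 : p.1 ≠ 0 := by omega
          rw [numSignings, e1, e2, if_pos hp0, zero_add]
          simp [hp0]

end SignedPD

namespace SignedPD

/-! ### Pipe dreams as pairs of ordered lists of boxes -/

section

variable {n k : ℕ}

theorem xOrder_asymm {p q : Fin k × GammaBox n} (h : xOrder p q) : ¬ xOrder q p := by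
  unfold xOrder at *
  omega

theorem zOrder_asymm {p q : StairBox n} (h : zOrder p q) : ¬ zOrder q p := by
  unfold zOrder at *
  omega

theorem filter_mem_eq_of_pairwise {γ : Type*} [DecidableEq γ] {R : γ → γ → Prop}
    (hR : ∀ a b, R a b → ¬ R b a) {l m : List γ} (hl : l.Pairwise R) (hm : m.Pairwise R)
    (h : ∀ q, q ∈ m) : m.filter (fun q => q ∈ l) = l := by
  have hnodup : ∀ {s : List γ}, s.Pairwise R → s.Nodup := fun hs =>
    hs.imp fun {a b} hab e => by
      subst e
      exact hR _ _ hab hab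
  refine List.Perm.eq_of_pairwise (le := R) (fun a b _ _ h1 h2 => absurd h2 (hR a b h1))
    (hm.filter _) hl ?_
  rw [List.perm_ext_iff_of_nodup (hnodup (hm.filter _)) (hnodup hl)]
  intro q
  simp [h q]

namespace BPipeDream

theorem pairwise_listX (D : BPipeDream n k) : D.listX.Pairwise xOrder :=
  (pairwise_xReading n k).filter _

theorem pairwise_listZ (D : BPipeDream n k) : D.listZ.Pairwise zOrder :=
  (pairwise_stairReading n).filter _

theorem ext_lists {D E : BPipeDream n k} (hx : D.listX = E.listX) (hz : D.listZ = E.listZ) :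
    D = E := by
  apply (pipeDreamEquiv n k).injective
  ext q
  simp only [pipeDreamEquiv, Equiv.coe_fn_mk, Finset.mem_filter, Finset.mem_univ, true_and]
  rcases q with q | q
  · have : q ∈ D.listX ↔ q ∈ E.listX := by rw [hx]
    simpa [listX, mem_xReading] using this
  · have : q ∈ D.listZ ↔ q ∈ E.listZ := by rw [hz]
    simpa [listZ, mem_stairReading] using this

theorem exists_lists {l : List (Fin k × GammaBox n)} (hl : l.Pairwise xOrder)
    {m : List (StairBox n)} (hm : m.Pairwise zOrder) :
    ∃ D : BPipeDream n k, D.listX = l ∧ D.listZ = m := by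
  classical
  let S : Finset (Box n k) := Finset.univ.filter fun q =>
    match q with
    | .inl q => q ∈ l
    | .inr q => q ∈ m
  obtain ⟨D, hD⟩ := (pipeDreamEquiv n k).surjective S
  have h : ∀ q, (D.1 q).wt = 1 ↔ q ∈ S := by
    intro q
    rw [← hD]
    simp [pipeDreamEquiv]
  refine ⟨D, ?_, ?_⟩
  · refine Eq.trans ?_ (filter_mem_eq_of_pairwise (fun _ _ => xOrder_asymm) hl
      (pairwise_xReading n k) mem_xReading)
    refine List.filter_congr fun q _ => ?_
    rw [decide_eq_decide, h]
    simp [S]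
  · refine Eq.trans ?_ (filter_mem_eq_of_pairwise (fun _ _ => zOrder_asymm) hm
      (pairwise_stairReading n) mem_stairReading)
    refine List.filter_congr fun q _ => ?_
    rw [decide_eq_decide, h]
    simp [S]

theorem ncard_lists (A : Set (List (Fin k × GammaBox n))) (hA : ∀ l ∈ A, l.Pairwise xOrder)
    (B : Set (List (StairBox n))) (hB : ∀ l ∈ B, l.Pairwise zOrder) :
    {D : BPipeDream n k | D.listX ∈ A ∧ D.listZ ∈ B}.ncard = A.ncard * B.ncard := by
  have hinj : Function.Injective fun D : BPipeDream n k => (D.listX, D.listZ) := fun D E h =>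
    ext_lists (congr_arg Prod.fst h) (congr_arg Prod.snd h)
  rw [← Set.ncard_image_of_injective _ hinj, ← Set.ncard_prod]
  congr 1
  ext ⟨l, m⟩
  constructor
  · rintro ⟨D, h, e⟩
    cases e
    exact h
  · rintro ⟨hl, hm⟩
    obtain ⟨D, rfl, rfl⟩ := exists_lists (hA l hl) (hB m hm)
    exact ⟨D, ⟨hl, hm⟩, rfl⟩

end BPipeDream

/-! ### Exponents -/

theorem exponent_map {γ : Type*} (f : γ → ℕ) (l : List γ) :
    exponent (l.map f) = (l.map fun q => Finsupp.single (f q) 1).sum := by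
  induction l with
  | nil => simp [exponent]
  | cons q l ih =>
    rw [List.map_cons, List.map_cons, List.sum_cons, ← ih, exponent, exponent,
      ← Multiset.cons_coe, ← Multiset.singleton_add, map_add, Multiset.toFinsupp_singleton]

theorem exponent_perm {j j' : List ℕ} (h : exponent j = exponent j') : j.Perm j' :=
  Multiset.coe_eq_coe.1 (Multiset.toFinsupp.injective h)

theorem sum_wt_eq_exponent {γ : Type*} [Fintype γ] {Q : List γ} (hQ : Q.Nodup)
    (hmem : ∀ q, q ∈ Q) (t : γ → Tile) (f : γ → ℕ) :
    ∑ q, Finsupp.single (f q) (t q).wt =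
      exponent ((Q.filter fun q => (t q).wt = 1).map f) := by
  classical
  have h : (Finset.univ : Finset γ) = Q.toFinset := by
    ext q
    simp [hmem]
  rw [exponent_map, h, List.sum_toFinset _ hQ]
  clear hQ hmem h
  induction Q with
  | nil => rfl
  | cons q Q ih =>
    rw [List.map_cons, List.sum_cons, ih, List.filter_cons]
    cases t q <;> simp [Tile.wt]

theorem BPipeDream.α_eq (D : BPipeDream n k) :
    D.α = exponent (D.listX.map fun q => q.1.val) :=
  sum_wt_eq_exponent (nodup_xReading n k) mem_xReading (fun q => D.1 (.inl q)) _

theorem BPipeDream.β_eq (D : BPipeDream n k) :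
    D.β = exponent (D.listZ.map fun q => q.1.1.val) :=
  sum_wt_eq_exponent (nodup_stairReading n) mem_stairReading (fun q => D.1 (.inr q)) _

/-! ### Lists of boxes with given letters and indices -/

/-- The ordered lists of boxes of Gamma-blocks with letters `a` and block indices `j`. -/
def xLists (n k : ℕ) (a j : List ℕ) : Set (List (Fin k × GammaBox n)) :=
  {l | l.Pairwise xOrder ∧ (l.map fun q => gammaLabel q.2) = a ∧ (l.map fun q => q.1.val) = j}

/-- The ordered lists of boxes of the staircase with letters `b` and row indices `j`. -/
def zLists (n : ℕ) (b j : List ℕ) : Set (List (StairBox n)) :=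
  {l | l.Pairwise zOrder ∧ l.map stairLabel = b ∧ (l.map fun q => q.1.1.val) = j}

theorem map_eq_zip_iff {γ : Type*} {f g : γ → ℕ} {l : List γ} {a j : List ℕ}
    (h : j.length = a.length) :
    (l.map fun q => (f q, g q)) = a.zip j ↔ l.map f = a ∧ l.map g = j := by
  constructor
  · intro e
    have h1 := congr_arg (List.map Prod.fst) e
    have h2 := congr_arg (List.map Prod.snd) e
    rw [List.map_map, List.map_fst_zip h.ge] at h1
    rw [List.map_map, List.map_snd_zip h.le] at h2
    exact ⟨h1, h2⟩
  · rintro ⟨rfl, rfl⟩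
    rw [List.zip_map']

/-- The signed letter of a box of a Gamma-block: letters in the row are negative. -/
def signedLetter (q : Fin k × GammaBox n) : ℤ × ℕ :=
  ((q.2.1.1.val : ℤ) - (q.2.1.2.val : ℤ), q.1.val)

theorem signedLetter_injective : Function.Injective (signedLetter (n := n) (k := k)) := by
  rintro ⟨i, ⟨⟨r, c⟩, h⟩⟩ ⟨i', ⟨⟨r', c'⟩, h'⟩⟩ e
  simp only [signedLetter, Prod.mk.injEq] at e
  simp only at h h'
  simp only [Prod.mk.injEq, Subtype.mk.injEq, Fin.ext_iff]
  omega

theorem mem_range_signedLetter {p : ℤ × ℕ} :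
    p ∈ Set.range (signedLetter (n := n) (k := k)) ↔ p.1.natAbs < n ∧ p.2 < k := by
  constructor
  · rintro ⟨⟨i, ⟨⟨r, c⟩, h⟩⟩, rfl⟩
    simp only [signedLetter]
    simp only at h
    omega
  · obtain ⟨s, i⟩ := p
    rintro ⟨h1, h2⟩
    -- One of the two coordinates is 0, so row and column are the positive and negative parts of s.
    refine ⟨(⟨i, h2⟩, ⟨(⟨s.toNat, by simp only at h1; omega⟩,
      ⟨(-s).toNat, by simp only at h1; omega⟩), by simp only; omega⟩), ?_⟩
    simp only [signedLetter, Prod.mk.injEq, and_true]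
    omega

theorem unsign_signedLetter (q : Fin k × GammaBox n) :
    unsign (signedLetter q) = (gammaLabel q.2, q.1.val) := by
  have h := q.2.2
  simp only [unsign, signedLetter, gammaLabel, Prod.mk.injEq, and_true]
  omega

theorem signOrder_signedLetter (p q : Fin k × GammaBox n) :
    signOrder (signedLetter p) (signedLetter q) ↔ xOrder p q := by
  simp only [signOrder, signedLetter, xOrder, Fin.lt_def, Fin.ext_iff]

/-- Boxes are signed letters within the bounds n and k, and reading order is `signOrder`; the bounds
on a and j ensure that every signing is realised by boxes. -/
theorem ncard_xLists {a j : List ℕ} (hlen : j.length = a.length) (ha : ∀ i ∈ a, i < n)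
    (hj : ∀ i ∈ j, i < k) : (xLists n k a j).ncard = numSignings (a.zip j) := by
  rw [← (finite_ncard_signings _).2, ← Set.ncard_image_of_injective (xLists n k a j)
    (List.map_injective_iff.2 signedLetter_injective)]
  have key : ∀ l : List (Fin k × GammaBox n),
      l ∈ xLists n k a j ↔ l.map signedLetter ∈ signings (a.zip j) := by
    intro l
    have h : (l.map signedLetter).map unsign = l.map fun q => (gammaLabel q.2, q.1.val) := by
      rw [List.map_map]
      exact List.map_congr_left fun q _ => unsign_signedLetter q
    rw [xLists, signings, Set.mem_ofPred_eq, Set.mem_ofPred_eq, h,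
      map_eq_zip_iff (f := fun q : Fin k × GammaBox n => gammaLabel q.2)
        (g := fun q => q.1.val) hlen, List.pairwise_map, and_comm]
    simp only [signOrder_signedLetter]
  congr 1
  ext t
  constructor
  · rintro ⟨l, hl, rfl⟩
    exact (key l).1 hl
  · intro ht
    have hr : t ∈ Set.range (List.map (signedLetter (n := n) (k := k))) := by
      rw [Set.range_list_map]
      intro p hp
      rw [mem_range_signedLetter]
      have h : unsign p ∈ a.zip j := by
        rw [← ht.1]
        exact List.mem_map_of_mem hp
      have := List.of_mem_zip h
      exact ⟨ha _ this.1, hj _ this.2⟩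
    obtain ⟨l, rfl⟩ := hr
    exact ⟨l, (key l).2 ht, rfl⟩

/-- Row and label determine a box, its column being label - 1 - row. Admissibility says exactly that
this column is nonnegative and that the boxes come in reading order. -/
theorem ncard_zLists {b j : List ℕ} (hb : ∀ i ∈ b, i < n) (h : IsZAdmissible b j) :
    (zLists n b j).ncard = 1 := by
  obtain ⟨hlen, hpair, hle, hlt⟩ := h
  let g : StairBox n → ℕ × ℕ := fun q => (stairLabel q, q.1.1.val)
  have hg : Function.Injective g := by
    rintro ⟨⟨r, c⟩, h⟩ ⟨⟨r', c'⟩, h'⟩ e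
    simp only [g, stairLabel, Prod.mk.injEq] at e
    simp only [Prod.mk.injEq, Subtype.mk.injEq, Fin.ext_iff]
    omega
  have hr : b.zip j ∈ Set.range (List.map g) := by
    rw [Set.range_list_map]
    rintro ⟨x, r⟩ hp
    obtain ⟨i, hi, e⟩ := List.getElem_of_mem hp
    rw [List.getElem_zip, Prod.mk.injEq] at e
    rw [List.length_zip] at hi
    have h1 := hle i (by omega)
    rw [List.getD_eq_getElem _ _ (by omega), List.getD_eq_getElem _ _ (by omega), e.1, e.2] at h1
    have h2 := hb x (List.of_mem_zip hp).1
    refine ⟨⟨(⟨r, by omega⟩, ⟨x - 1 - r, by omega⟩), by simp only; omega⟩, ?_⟩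
    simp only [g, stairLabel, Prod.mk.injEq, and_true]
    omega
  obtain ⟨l, hl⟩ := hr
  rw [Set.ncard_eq_one]
  refine ⟨l, ?_⟩
  have hbj := (map_eq_zip_iff (f := stairLabel) (g := fun q : StairBox n => q.1.1.val) hlen).1 hl
  ext m
  constructor
  · rintro ⟨-, h⟩
    exact List.map_injective_iff.2 hg (((map_eq_zip_iff hlen).2 h).trans hl.symm)
  · rintro rfl
    refine ⟨?_, hbj⟩
    have htrans : IsTrans (StairBox n) zOrder := ⟨fun a b c => by unfold zOrder; omega⟩
    rw [← List.isChain_iff_pairwise, List.isChain_iff_getElem]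
    obtain ⟨rfl, rfl⟩ := hbj
    intro i hi
    have h1 := hlt i (by simpa using hi)
    rw [List.pairwise_map, List.pairwise_iff_getElem] at hpair
    have h2 := hpair i (i + 1) (by omega) hi (by omega)
    simp only [List.getD_eq_getElem?_getD, List.getElem?_map, List.getElem?_eq_getElem hi,
      List.getElem?_eq_getElem (show i < m.length by omega), Option.map_some,
      Option.getD_some, stairLabel] at h1
    unfold zOrder
    simp only [Fin.lt_def, Fin.ext_iff]
    omega

end

end SignedPD

namespace SignedPD

/-! ### Reduced words and admissible monomials -/

theorem not_adjacent_of_reduced {w : BCInf} {a l₁ l₂ : List ℕ} {x : ℕ}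
    (ha : a ∈ reducedWords w) : a ≠ l₁ ++ x :: x :: l₂ := by
  rintro rfl
  have h1 : wordProd (l₁ ++ l₂) = w := by
    rw [← ha.1, wordProd_append, wordProd_append, wordProd_cons, wordProd_cons, ← mul_assoc (gen x),
      gen_mul_self, one_mul]
  have h2 := len_le_length (l₁ ++ l₂)
  rw [h1, ← ha.2] at h2
  simp at h2

/-- Equal neighbours are excluded because the word is reduced, peaks within a block because the
monomial is admissible. -/
theorem isValleyShaped_zip {u : BCInf} {a j : List ℕ} (ha : a ∈ reducedWords u)
    (h : IsXAdmissible a j) : IsValleyShaped (a.zip j) := by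
  obtain ⟨hlen, hpair, hpeak⟩ := h
  have hfst : (a.zip j).map Prod.fst = a := List.map_fst_zip hlen.ge
  have hsnd : (a.zip j).map Prod.snd = j := List.map_snd_zip hlen.le
  refine ⟨?_, ?_, ?_⟩
  · rw [← hsnd, List.pairwise_map] at hpair
    exact hpair
  · intro l₁ p q l₂ e _ h
    rw [e, List.map_append, List.map_cons, List.map_cons, h] at hfst
    exact not_adjacent_of_reduced ha hfst.symm
  · intro l₁ p q r l₂ e h1 h2 h3
    rw [e] at hfst hsnd
    have := hpeak l₁.length
    rw [← hfst, ← hsnd] at this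
    unfold IsPeak at this
    simp [List.getD_eq_getElem?_getD, h1, h2, h3] at this

section

variable {n k : ℕ}

/-- Within a block the labels are absolute values of an increasing sequence of integers, so they
have no peak. -/
theorem isXAdmissible_of_pairwise {l : List (Fin k × GammaBox n)} (hl : l.Pairwise xOrder) :
    IsXAdmissible (l.map fun q => gammaLabel q.2) (l.map fun q => q.1.val) := by
  refine ⟨by simp, ?_, ?_⟩
  · rw [List.pairwise_map]
    refine hl.imp fun {p q} h => ?_
    unfold xOrder at h
    omega
  · intro i hi h1 h2 h3
    rw [List.length_map] at hi
    obtain ⟨-, h3, h4⟩ := h3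
    have o1 := List.pairwise_iff_getElem.1 hl i (i + 1) (by omega) (by omega) (by omega)
    have o2 := List.pairwise_iff_getElem.1 hl (i + 1) (i + 2) (by omega) hi (by omega)
    simp only [List.getD_eq_getElem?_getD, List.getElem?_map, List.getElem?_eq_getElem hi,
      List.getElem?_eq_getElem (show i < l.length by omega),
      List.getElem?_eq_getElem (show i + 1 < l.length by omega), Option.map_some,
      Option.getD_some, gammaLabel] at h1 h2 h3 h4
    have p1 := l[i].2.2
    have p2 := l[i + 1].2.2
    have p3 := l[i + 2].2.2
    unfold xOrder at o1 o2
    omega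

theorem isZAdmissible_of_pairwise {l : List (StairBox n)} (hl : l.Pairwise zOrder) :
    IsZAdmissible (l.map stairLabel) (l.map fun q => q.1.1.val) := by
  refine ⟨by simp, ?_, ?_, ?_⟩
  · rw [List.pairwise_map]
    refine hl.imp fun {p q} h => ?_
    unfold zOrder at h
    omega
  · intro i hi
    rw [List.length_map] at hi
    simp only [List.getD_eq_getElem?_getD, List.getElem?_map, List.getElem?_eq_getElem hi,
      Option.map_some, Option.getD_some, stairLabel]
    omega
  · intro i hi h1
    rw [List.length_map] at hi
    have o1 := List.pairwise_iff_getElem.1 hl i (i + 1) (by omega) (by omega) (by omega)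
    simp only [List.getD_eq_getElem?_getD, List.getElem?_map, List.getElem?_eq_getElem hi,
      List.getElem?_eq_getElem (show i < l.length by omega), Option.map_some,
      Option.getD_some, stairLabel] at h1 ⊢
    unfold zOrder at o1
    omega

theorem exponent_apply (j : List ℕ) (i : ℕ) : exponent j i = j.count i := by
  rw [exponent, Multiset.toFinsupp_apply, Multiset.coe_count]

/-! ### The data of pipe dreams -/

namespace BPipeDream

/-- The words and the exponents of a pipe dream. -/
noncomputable def datum (D : BPipeDream n k) : Datum :=
  ⟨wordProd D.wordX, wordProd D.wordZ, D.wordX, D.wordZ, D.α, D.β⟩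

theorem isAdmissible_datum {D : BPipeDream n k} {w : BCInf} (hD : D ∈ PD n k w) :
    D.datum.IsAdmissible n k w := by
  rw [mem_PD_iff, word] at hD
  have hmul : wordProd D.wordX * wordProd D.wordZ = w := by
    rw [← wordProd_append]
    exact hD.1
  have h0 := hD.2
  rw [List.length_append] at h0
  have h1 := len_le_length D.wordX
  have h2 := len_le_length D.wordZ
  -- The length of w is at most the sum of the lengths of the factors, which is at most the number
  -- of letters, which is the length of w; so equality holds throughout and both parts are reduced.
  have h3 := len_mul_le (wordProd D.wordX) (wordProd D.wordZ)
  rw [hmul] at h3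
  refine ⟨hmul, ?_, ?_, ⟨rfl, ?_⟩, ?_, ?_, ⟨rfl, ?_⟩, ?_⟩
  · simp only [datum]
    omega
  · refine wordProd_mem_Sym fun i hi => ?_
    rw [wordZ_eq, List.mem_map] at hi
    obtain ⟨q, -, rfl⟩ := hi
    have := q.2
    unfold stairLabel
    omega
  · simp only [datum]
    omega
  · refine ⟨_, ?_, D.α_eq.symm⟩
    simp only [datum]
    rw [wordX_eq]
    exact isXAdmissible_of_pairwise D.pairwise_listX
  · intro i hi
    simp only [datum]
    rw [α_eq, exponent_apply, List.count_eq_zero, List.mem_map]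
    rintro ⟨q, -, rfl⟩
    omega
  · simp only [datum]
    omega
  · refine ⟨_, ?_, D.β_eq.symm⟩
    simp only [datum]
    rw [wordZ_eq]
    exact isZAdmissible_of_pairwise D.pairwise_listZ

theorem mem_fiber_iff {d : Datum} {w : BCInf} (hd : d.IsAdmissible n k w) (D : BPipeDream n k) :
    (D.IsReduced ∧ D.wordX = d.a ∧ D.wordZ = d.b ∧ D.α = d.α ∧ D.β = d.β) ↔
      D.wordX = d.a ∧ D.wordZ = d.b ∧ D.α = d.α ∧ D.β = d.β := by
  rw [and_iff_right_iff_imp]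
  rintro ⟨ha, hb, -, -⟩
  have h : D.word ∈ reducedWords w := by
    rw [word, ha, hb]
    refine ⟨?_, ?_⟩
    · rw [wordProd_append, hd.a_mem.1, hd.b_mem.1, hd.mul_eq]
    · rw [List.length_append, hd.a_mem.2, hd.b_mem.2, hd.len_add]
  have hs : D.shape = w := h.1
  rw [IsReduced, hs]
  exact h

theorem datum_eq_iff {d : Datum} {w : BCInf} (hd : d.IsAdmissible n k w) (D : BPipeDream n k) :
    (D ∈ PD n k w ∧ D.datum = d) ↔
      D.wordX = d.a ∧ D.wordZ = d.b ∧ D.α = d.α ∧ D.β = d.β := by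
  constructor
  · rintro ⟨-, rfl⟩
    exact ⟨rfl, rfl, rfl, rfl⟩
  · rintro ⟨ha, hb, hα, hβ⟩
    constructor
    · rw [mem_PD_iff, word, ha, hb]
      refine ⟨?_, ?_⟩
      · rw [wordProd_append, hd.a_mem.1, hd.b_mem.1, hd.mul_eq]
      · rw [List.length_append, hd.a_mem.2, hd.b_mem.2, hd.len_add]
    · obtain ⟨u, v, a, b, α, β⟩ := d
      simp only at ha hb hα hβ
      have h1 := hd.a_mem.1
      have h2 := hd.b_mem.1
      simp only at h1 h2
      simp only [datum, ha, hb, hα, hβ, h1, h2]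

end BPipeDream

/-- The concatenation of the two words is reduced for w, and its zeros all lie in the first word
because the second factor has no sign changes. So s(w) is the number of zeros in `numSignings_eq`.
-/
theorem coeffB_eq {d : Datum} {w : BCInf} (hd : d.IsAdmissible n k w) {j : List ℕ}
    (hj : IsXAdmissible d.a j) (hα : exponent j = d.α) :
    coeffB w d.α = (numSignings (d.a.zip j) : ℚ) := by
  have hword : d.a ++ d.b ∈ reducedWords w :=
    ⟨by rw [wordProd_append, hd.a_mem.1, hd.b_mem.1, hd.mul_eq],
      by rw [List.length_append, hd.a_mem.2, hd.b_mem.2, hd.len_add]⟩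
  have hs : numSigns w = d.a.count 0 := by
    rw [numSigns_eq_count hword, List.count_append,
      List.count_eq_zero.2 (reducedWords_letters_ne_zero hd.v_mem hd.b_mem), add_zero]
  have hsupp : d.α.support.card = j.toFinset.card := by
    rw [← hα, exponent, Multiset.toFinsupp_support]
    rfl
  have h := numSignings_eq (isValleyShaped_zip hd.a_mem hj)
  rw [List.map_fst_zip hj.1.ge, List.map_snd_zip hj.1.le, ← hs, ← hsupp] at h
  rw [coeffB, zpow_sub₀ two_ne_zero, zpow_natCast, zpow_natCast, div_eq_iff (by positivity),
    mul_comm]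
  exact_mod_cast h.symm

theorem ncard_fiber {d : Datum} {w : BCInf} (hw : w ∈ BC n) (hd : d.IsAdmissible n k w) :
    ({D : BPipeDream n k | D.wordX = d.a ∧ D.wordZ = d.b ∧ D.α = d.α ∧ D.β = d.β}.ncard : ℚ) =
      coeffB w d.α := by
  obtain ⟨j, hj, hα⟩ := hd.α_mem
  obtain ⟨m, hm, hβ⟩ := hd.β_mem
  have hu : d.u ∈ BC n := by
    rw [← mul_inv_eq_iff_eq_mul.2 hd.mul_eq.symm]
    exact mul_mem hw (inv_mem hd.v_mem.1)
  have hjk : ∀ i ∈ j, i < k := by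
    intro i hi
    by_contra h
    have := hd.α_zero i (not_lt.1 h)
    rw [← hα, exponent_apply, List.count_eq_zero] at this
    exact this hi
  -- An exponent vector fixes the indices up to order, and both index sequences are sorted, so
  -- fixing the exponents is fixing j and m.
  have hset : {D : BPipeDream n k | D.wordX = d.a ∧ D.wordZ = d.b ∧ D.α = d.α ∧ D.β = d.β} =
      {D | D.listX ∈ xLists n k d.a j ∧ D.listZ ∈ zLists n d.b m} := by
    ext D
    simp only [Set.mem_ofPred_eq, xLists, zLists]
    rw [← D.wordX_eq, ← D.wordZ_eq]
    constructor
    · rintro ⟨h1, h2, h3, h4⟩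
      refine ⟨⟨D.pairwise_listX, h1, ?_⟩, ⟨D.pairwise_listZ, h2, ?_⟩⟩
      · rw [D.α_eq, ← hα] at h3
        exact (exponent_perm h3).eq_of_pairwise (fun a b _ _ h h' => le_antisymm h' h)
          (isXAdmissible_of_pairwise D.pairwise_listX).2.1 hj.2.1
      · rw [D.β_eq, ← hβ] at h4
        exact (exponent_perm h4).eq_of_pairwise (fun a b _ _ h h' => le_antisymm h h')
          (isZAdmissible_of_pairwise D.pairwise_listZ).2.1 hm.2.1
    · rintro ⟨⟨-, h1, h3⟩, -, h2, h4⟩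
      exact ⟨h1, h2, by rw [D.α_eq, h3, hα], by rw [D.β_eq, h4, hβ]⟩
  rw [hset, BPipeDream.ncard_lists _ (fun _ h => h.1) _ (fun _ h => h.1),
    ncard_xLists hj.1 (reducedWords_letters_lt hu hd.a_mem) hjk,
    ncard_zLists (reducedWords_letters_lt hd.v_mem.1 hd.b_mem) hm, mul_one, coeffB_eq hd hj hα]

/-- Every admissible datum comes from a pipe dream because its fibre has a power of two, hence a
nonzero number, of elements. This also gives finiteness of the index set. -/
theorem setOf_isAdmissible_eq {w : BCInf} (hw : w ∈ BC n) :
    {d : Datum | d.IsAdmissible n k w} = BPipeDream.datum '' (PD n k w : Set (BPipeDream n k)) := by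
  ext d
  constructor
  · intro hd
    have h := ncard_fiber hw hd
    have hne : coeffB w d.α ≠ 0 := by
      rw [coeffB]
      positivity
    rw [← h, Nat.cast_ne_zero] at hne
    obtain ⟨D, hD⟩ := Set.nonempty_of_ncard_ne_zero hne
    exact ⟨D, (BPipeDream.datum_eq_iff hd D).2 hD⟩
  · rintro ⟨D, hD, rfl⟩
    exact BPipeDream.isAdmissible_datum hD

theorem sum_PD_eq_finsum {w : BCInf} (hw : w ∈ BC n) :
    ∑ D ∈ PD n k w, xzMonomial D.α D.β =
      ∑ᶠ d ∈ {d : Datum | d.IsAdmissible n k w}, coeffB w d.α • xzMonomial d.α d.β := by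
  classical
  rw [setOf_isAdmissible_eq hw, ← Finset.coe_image, finsum_mem_coe_finset]
  refine (Finset.sum_image' _ fun D hD => ?_).symm
  have hd := BPipeDream.isAdmissible_datum hD
  have hcard : (((PD n k w).filter fun E => E.datum = D.datum).card : ℚ) =
      coeffB w D.datum.α := by
    rw [← ncard_fiber hw hd, ← Set.ncard_coe_finset]
    congr 2
    ext E
    rw [Finset.mem_coe, Finset.mem_filter, BPipeDream.datum_eq_iff hd]
    rfl
  rw [← hcard, Nat.cast_smul_eq_nsmul, ← Finset.sum_const]
  refine Finset.sum_congr rfl fun E hE => ?_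
  have h := (Finset.mem_filter.1 hE).2
  rw [← h]
  rfl

end

end SignedPD

open SignedPD

theorem theorem3p4 (n k : ℕ) (w : BCInf) (hw : w ∈ BC n) :
    -- the defining relations determine the Schubert polynomials
    (∃! S : BCInf → MvPolynomial ZP ℚ, IsSchubertC S) ∧
    -- the index set of the middle sum is finite
    {d : Datum | d.IsAdmissible n k w}.Finite ∧
    -- the two equalities
    (∑ D ∈ PD n k w, xzMonomial (BPipeDream.α D) (BPipeDream.β D) =
      ∑ᶠ d ∈ {d : Datum | d.IsAdmissible n k w}, coeffB w d.α • xzMonomial d.α d.β) ∧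
    (∑ᶠ d ∈ {d : Datum | d.IsAdmissible n k w}, coeffB w d.α • xzMonomial d.α d.β =
      truncation k (schubertB w)) ∧
    -- the number of pipe dreams for given words and monomials
    (∀ d : Datum, d.IsAdmissible n k w →
      ({D : BPipeDream n k | BPipeDream.IsReduced D ∧ BPipeDream.wordX D = d.a ∧
        BPipeDream.wordZ D = d.b ∧ BPipeDream.α D = d.α ∧ BPipeDream.β D = d.β}.ncard : ℚ) =
        coeffB w d.α) := by
  refine ⟨existsUnique_isSchubertC, ?_, sum_PD_eq_finsum hw,
    (sum_PD_eq_finsum hw).symm.trans (sum_PD_eq_truncation k hw), fun d hd => ?_⟩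
  · rw [setOf_isAdmissible_eq hw]
    exact (PD n k w).finite_toSet.image _
  · simp only [BPipeDream.mem_fiber_iff hd]
    exact ncard_fiber hw hd
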